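/- Let $n\ge 1$, let $\Sigma$ be a smooth compact $n$-dimensional Riemannian manifold without boundary, smoothly embedded into $\mathbb{R}^L$, and let $\mathcal N\subset\mathbb{R}^M$ be a connected smooth compact embedded submanifold without boundary. Write $|x-y|$ for the Euclidean distance in $\mathbb{R}^L$ and $dx$ for the Riemannian volume on $\Sigma$, and put, for $t>0$ and $p\geq 1$, $$E_{t,p}(u,\Sigma)=\int_\Sigma\int_\Sigma\frac{|u(x)-u(y)|^{p}}{|x-y|^{n+tp}}\,dx\,dy,\qquad \|u\|_{W^{t,p}}=\|u\|_{L^{p}(\Sigma)}+E_{t,p}(u,\Sigma)^{1/p}.$$ Let $W^{t,p}(\Sigma,\mathcal N)$ be the set of $u\in L^p(\Sigma,\mathbb{R}^M)$ with $E_{t,p}(u,\Sigma)<\infty$ and $u(x)\in\mathcal N$ for a.e. $x$. For $s\in(0,1)$ and $u,v\in W^{s,n/s}(\Sigma,\mathcal N)$ write $u\sim v$ (homotopic) if for any families $u_\varepsilon,v_\varepsilon\in C^\infty(\Sigma,\mathcal N)$, $\varepsilon>0$, converging to $u$ and $v$ respectively in the $W^{s,n/s}$-norm as $\varepsilon\to0$,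 there is $\varepsilon_0>0$ such that for every $\varepsilon\in(0,\varepsilon_0)$ there is a smooth homotopy $[0,1]\times\Sigma\to\mathcal N$ from $u_\varepsilon$ to $v_\varepsilon$. **Theorem.** Let $s\in(0,1)$, and let $\Sigma$, $\mathcal N$ be as above. There exist $\alpha>0$ and $s_1>s$ such that the following holds for every $t\in[s,s_1)$. Let $u\in W^{t,n/s}(\Sigma,\mathcal N)$, let $B(R)\subset\Sigma$ be a geodesic ball (a ball of radius $R>0$ for the Riemannian distance), and assume that $$E_{t,\frac ns}(u,\Sigma)\le E_{t,\frac ns}(v,\Sigma)$$ for all $v\in W^{t,n/s}(\Sigma,\mathcal N)$ such that $v=u$ a.e. in $\Sigma\setminus B(R)$ and $u\sim v$. Then $u\in C^\alpha_{loc}(B(R))$; that is, $u$ agrees a.e. in $B(R)$ with a map that is Hölder continuous with exponent $\alpha$, with respect to the Riemannian distance, on every compact subset of $B(R)$. -/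

import Mathlib

open Set Filter MeasureTheory Manifold Bundle
open scoped Topology ENNReal NNReal ContDiff

noncomputable section

namespace FractionalHarmonic

/-! In this section `S` is an `n`-dimensional Riemannian manifold with its Riemannian (extended)
distance, `μHE[n]` is its Riemannian volume measure (the normalized `n`-dimensional Hausdorff
measure of the Riemannian distance), `ι : S → ℝ^L` is the embedding of `S` and `N ⊆ ℝ^M` is the
target. -/

variable {S : Type*} [EMetricSpace S] [MeasurableSpace S] [BorelSpace S]

/-- The energy `E_{t,p}(u, S) = ∫_S ∫_S |u(x) - u(y)|^p / |x - y|^(n + t p) dx dy`, where `|x - y|`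
is the Euclidean distance of the ambient space `ℝ^L`. -/
def energy (n : ℕ) {L M : ℕ} (ι : S → EuclideanSpace ℝ (Fin L)) (t p : ℝ)
    (u : S → EuclideanSpace ℝ (Fin M)) : ℝ≥0∞ :=
  ∫⁻ x : S, ∫⁻ y : S, ENNReal.ofReal (‖u x - u y‖ ^ p / ‖ι x - ι y‖ ^ ((n : ℝ) + t * p))
    ∂μHE[n] ∂μHE[n]

/-- The norm `‖u‖_{L^p} + [u]_{W^{t,p}}`. -/
def sobolevNorm (n : ℕ) {L M : ℕ} (ι : S → EuclideanSpace ℝ (Fin L)) (t p : ℝ)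
    (u : S → EuclideanSpace ℝ (Fin M)) : ℝ≥0∞ :=
  eLpNorm u (ENNReal.ofReal p) (μHE[n] : Measure S) + energy n ι t p u ^ (1 / p)

/-- `u ∈ W^{t,p}(S, N)`: `u ∈ L^p`, the Gagliardo seminorm of `u` is finite, and `u(x) ∈ N` for
almost every `x`. -/
structure MemSobolev (n : ℕ) {L M : ℕ} (ι : S → EuclideanSpace ℝ (Fin L))
    (N : Set (EuclideanSpace ℝ (Fin M))) (t p : ℝ) (u : S → EuclideanSpace ℝ (Fin M)) : Prop where
  memLp : MemLp u (ENNReal.ofReal p) (μHE[n] : Measure S)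
  energy_lt_top : energy n ι t p u < ⊤
  ae_mem : ∀ᵐ x ∂(μHE[n] : Measure S), u x ∈ N

/-- `u ∈ C^∞(S, N)`, for an embedded submanifold `N ⊆ ℝ^M`. -/
def IsSmoothInto (n : ℕ) {M : ℕ} [ChartedSpace (EuclideanSpace ℝ (Fin n)) S]
    (N : Set (EuclideanSpace ℝ (Fin M))) (u : S → EuclideanSpace ℝ (Fin M)) : Prop :=
  ContMDiff (𝓡 n) 𝓘(ℝ, EuclideanSpace ℝ (Fin M)) ∞ u ∧ ∀ x, u x ∈ N

/-- `u ∼ v` in `C^∞`: there is a smooth homotopy `H : [0,1] × S → N` from `u` to `v`. -/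
def SmoothHomotopic (n : ℕ) {M : ℕ} [ChartedSpace (EuclideanSpace ℝ (Fin n)) S]
    (N : Set (EuclideanSpace ℝ (Fin M))) (u v : S → EuclideanSpace ℝ (Fin M)) : Prop :=
  ∃ H : ℝ × S → EuclideanSpace ℝ (Fin M),
    ContMDiffOn (𝓘(ℝ, ℝ).prod (𝓡 n)) 𝓘(ℝ, EuclideanSpace ℝ (Fin M)) ∞ H (Icc 0 1 ×ˢ univ) ∧
    (∀ r ∈ Icc (0 : ℝ) 1, ∀ x, H (r, x) ∈ N) ∧
    (∀ x, H (0, x) = u x) ∧ (∀ x, H (1, x) = v x)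

/-- `(w_ε)_{ε > 0}` is a smooth approximation of `u` in `W^{s,p}(S, N)`: every `w_ε` lies in
`C^∞(S, N)` and `w_ε → u` in the `W^{s,p}`-norm as `ε → 0`. -/
def IsSmoothApprox (n : ℕ) {L M : ℕ} [ChartedSpace (EuclideanSpace ℝ (Fin n)) S]
    (ι : S → EuclideanSpace ℝ (Fin L)) (N : Set (EuclideanSpace ℝ (Fin M))) (s p : ℝ)
    (u : S → EuclideanSpace ℝ (Fin M)) (w : ℝ → S → EuclideanSpace ℝ (Fin M)) : Prop :=
  (∀ ε : ℝ, 0 < ε → IsSmoothInto n N (w ε)) ∧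
  Tendsto (fun ε : ℝ => sobolevNorm n ι s p (fun x => w ε x - u x)) (𝓝[>] 0) (𝓝 0)

/-- `u ∼ v` for `u, v ∈ W^{s,p}(S, N)`: any smooth approximations `u_ε` of `u` and `v_ε` of `v`
are homotopic in `C^∞` for all sufficiently small `ε`. -/
def SobolevHomotopic (n : ℕ) {L M : ℕ} [ChartedSpace (EuclideanSpace ℝ (Fin n)) S]
    (ι : S → EuclideanSpace ℝ (Fin L)) (N : Set (EuclideanSpace ℝ (Fin M))) (s p : ℝ)
    (u v : S → EuclideanSpace ℝ (Fin M)) : Prop :=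
  ∀ uε vε : ℝ → S → EuclideanSpace ℝ (Fin M),
    IsSmoothApprox n ι N s p u uε → IsSmoothApprox n ι N s p v vε →
      ∃ ε₀ : ℝ, 0 < ε₀ ∧ ∀ ε : ℝ, 0 < ε → ε < ε₀ → SmoothHomotopic n N (uε ε) (vε ε)

/-- `u` is a minimizing `W^{t,n/s}`-harmonic map (in its homotopy class) in the set `B`. Homotopy
is understood in `W^{s,n/s}`, which contains `W^{t,n/s}` for `t ≥ s`. -/
structure IsMinimizingInHomotopy (n : ℕ) {L M : ℕ} [ChartedSpace (EuclideanSpace ℝ (Fin n)) S]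
    (ι : S → EuclideanSpace ℝ (Fin L)) (N : Set (EuclideanSpace ℝ (Fin M))) (s t : ℝ)
    (B : Set S) (u : S → EuclideanSpace ℝ (Fin M)) : Prop where
  mem : MemSobolev n ι N t (n / s) u
  energy_le : ∀ v : S → EuclideanSpace ℝ (Fin M), MemSobolev n ι N t (n / s) v →
    (∀ᵐ x ∂(μHE[n] : Measure S), x ∉ B → v x = u x) →
    SobolevHomotopic n ι N s (n / s) u v →
    energy n ι t (n / s) u ≤ energy n ι t (n / s) v

/-- `u ∈ C^α_loc(B)` for an almost everywhere defined map `u`: on `B`, `u` agrees almost everywhere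
with a map which is Hölder continuous with exponent `α` on every compact subset of `B`. -/
def MemHolderLoc (n : ℕ) {M : ℕ} (α : ℝ≥0) (B : Set S) (u : S → EuclideanSpace ℝ (Fin M)) :
    Prop :=
  ∃ w : S → EuclideanSpace ℝ (Fin M),
    (∀ᵐ x ∂(μHE[n] : Measure S), x ∈ B → w x = u x) ∧
    ∀ K : Set S, K ⊆ B → IsCompact K → ∃ C : ℝ≥0, HolderOnWith C α w K

end FractionalHarmonic

end

/-! The exponent `p = n / s` is critical: `s * p = n`, and for `t ≥ s` the energy controls the
critical one up to a constant (`energyDensity_le_mul`). The proof is hole filling with an explicit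
comparison map, followed by Campanato's criterion; no Euler–Lagrange equation is used. All estimates
use the chordal distance `dist (ι x) (ι y)`, for which compactness gives Ahlfors regularity
(`exists_isAhlfors`).

Comparison map. On a ball `B_r` carrying little energy, replace `u` on the concentric ball `B_{lr}`
by a value `u z` with `z` in the annulus, average the result at a scale `h` proportional to the
distance from the boundary of `B_r`, and project to the target along nearest points. As `h` vanishes
outside `B_r`, the new map equals `u` there. Its energy on `B_r` is bounded by a truncated energy,
in which `dist` is replaced by `max dist h` (`exists_energy_tentAvg_le`). The truncation hides the
jump made by the filling, so that for a well chosen `z` only the energy of `u` on the annulus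
remains (`lintegral_truncDensity_fillBall_le`). Small energy keeps the averages inside the tubular
neighbourhood (`exists_tentAvg_near_range`). Together these give `exists_comparison`.

Homotopy. A smooth map with small critical energy on all balls of radius `r₀` is homotopic to the
projection of its average at scale `r₀`: halve the scale repeatedly until the average is uniformly
close to the map. Two such maps that are also `L^p`-close relative to `r₀` have averages near common
points of the target, hence are homotopic (`exists_smoothHomotopic`). Both conditions pass to
approximations in `W^{s,p}`, which gives `exists_sobolevHomotopic`. By absolute continuity of the
energy they hold for `u` and its comparison map once `r` is small, so that the comparison map is
admissible.

Decay. Minimality bounds the energy on `B_r` by a constant times that on the annulus; filling the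
hole gives a factor `θ < 1` from `B_r` to `B_{lr}` (`exists_energy_decay`). Iteration yields
geometric decay, and the limits of ball averages form a Hölder representative
(`exists_dist_limUnder_le`). The factor `θ`, and with it the Hölder exponent, is uniform for `t` in
`[s, (1 + s) / 2]`: staying away from `1` keeps the kernel `dist ^ (p - n - t p)` uniformly
integrable at the diagonal. Only the radius at which decay starts depends on `u` and `t`. -/

namespace FractionalHarmonic

/-! ### Nearest-point retraction onto the target -/

/-- An immersion into a vector space has a smooth local left inverse. -/
theorem exists_local_left_inverse {k M : ℕ} {N : Type*} [TopologicalSpace N]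
    [ChartedSpace (EuclideanSpace ℝ (Fin k)) N] [IsManifold (𝓡 k) ∞ N]
    {j : N → EuclideanSpace ℝ (Fin M)} {q₀ : N}
    (hj : IsImmersionAt (𝓡 k) 𝓘(ℝ, EuclideanSpace ℝ (Fin M)) ∞ j q₀) :
    ∃ G : EuclideanSpace ℝ (Fin M) → N,
      ContMDiffAt 𝓘(ℝ, EuclideanSpace ℝ (Fin M)) (𝓡 k) ∞ G (j q₀) ∧
      ∀ᶠ q in 𝓝 q₀, G (j q) = q := by
  set h := hj
  have key : ∀ q ∈ h.domChart.source,
      h.codChart (j q) = h.equiv (h.domChart q, 0) := by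
    intro q hq
    have := h.writtenInCharts (show h.domChart q ∈ (h.domChart.extend (𝓡 k)).target by simp [hq])
    simpa [hq] using this
  refine ⟨fun z => h.domChart.symm (h.equiv.symm (h.codChart z)).1, ?_, ?_⟩
  · have h1 : ContMDiffAt 𝓘(ℝ, EuclideanSpace ℝ (Fin M)) 𝓘(ℝ, EuclideanSpace ℝ (Fin M)) ∞
        h.codChart (j q₀) :=
      contMDiffAt_of_mem_maximalAtlas h.codChart_mem_maximalAtlas h.mem_codChart_source
    have h2 : ContDiff ℝ ∞ (fun z => (h.equiv.symm z).1) := by fun_prop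
    have h3 : (h.equiv.symm (h.codChart (j q₀))).1 = h.domChart q₀ := by
      rw [key _ h.mem_domChart_source]; simp
    have h4 : ContMDiffAt 𝓘(ℝ, EuclideanSpace ℝ (Fin k)) (𝓡 k) ∞ h.domChart.symm
        ((h.equiv.symm (h.codChart (j q₀))).1) := by
      rw [h3]
      exact contMDiffAt_symm_of_mem_maximalAtlas h.domChart_mem_maximalAtlas
        (h.domChart.map_source h.mem_domChart_source)
    exact h4.comp (j q₀) (h2.contMDiff.contMDiffAt.comp (j q₀) h1)
  · filter_upwards [h.domChart.open_source.mem_nhds h.mem_domChart_source] with q hq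
    rw [key q hq]; simp [hq]

/-- Local graph form of the equation for nearest points: `z` is a nearest point of `φ`'s image. -/
theorem contDiffAt_normalEquation {E F : Type*} [NormedAddCommGroup E] [InnerProductSpace ℝ E]
    [NormedAddCommGroup F] [NormedSpace ℝ F] {φ : F → E} {x : E} {y : F}
    (hφ : ContDiffAt ℝ ∞ φ y) :
    ContDiffAt ℝ ∞ (fun v : E × F => (innerSL ℝ (v.1 - φ v.2)) ∘L fderiv ℝ φ v.2) (x, y) := by
  have h1 : ContDiffAt ℝ ∞ (fun v : E × F => φ v.2) (x, y) :=
    ContDiffAt.comp (x, y) (f := Prod.snd) (g := φ) hφ contDiffAt_snd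
  have h2 : ContDiffAt ℝ ∞ (fun v : E × F => fderiv ℝ φ v.2) (x, y) :=
    ContDiffAt.comp (x, y) (f := Prod.snd) (g := fderiv ℝ φ)
      (hφ.fderiv_right (by simp)) contDiffAt_snd
  exact ContDiffAt.clm_comp
    ((innerSL ℝ (E := E)).contDiff.contDiffAt.comp (x, y) (contDiffAt_fst.sub h1)) h2

/-- At `x = φ y` the term with the second derivative of `φ` carries the factor `x - φ y = 0`. What
remains is minus the Gram form of `fderiv ℝ φ y`, which is definite because the derivative is
injective; equality of dimensions then gives invertibility. -/
theorem isInvertible_normalEquation {E F : Type*} [NormedAddCommGroup E] [InnerProductSpace ℝ E]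
    [NormedAddCommGroup F] [NormedSpace ℝ F] [FiniteDimensional ℝ F] {φ : F → E} {y : F}
    (hφ : ContDiffAt ℝ ∞ φ y) (hinj : Function.Injective (fderiv ℝ φ y)) :
    (fderiv ℝ (fun v : E × F => (innerSL ℝ (v.1 - φ v.2)) ∘L fderiv ℝ φ v.2) (φ y, y) ∘L
      .inr ℝ E F).IsInvertible := by
  set f := fun v : E × F => (innerSL ℝ (v.1 - φ v.2)) ∘L fderiv ℝ φ v.2
  have hf : DifferentiableAt ℝ f (φ y, y) :=
    (contDiffAt_normalEquation hφ).differentiableAt (by simp)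
  have h1 : HasFDerivAt (fun y' => f (φ y, y')) (fderiv ℝ f (φ y, y) ∘L .inr ℝ E F) y :=
    hf.hasFDerivAt.comp y (hasFDerivAt_prodMk_right (φ y) y)
  have hd : HasFDerivAt φ (fderiv ℝ φ y) y := (hφ.differentiableAt (by simp)).hasFDerivAt
  have h2 : HasFDerivAt (fun y' => innerSL ℝ (φ y - φ y'))
      ((innerSL ℝ (E := E)) ∘L (-fderiv ℝ φ y)) y :=
    (innerSL ℝ (E := E)).hasFDerivAt.comp y (hd.const_sub (φ y))
  have h3 : HasFDerivAt (fderiv ℝ φ) (fderiv ℝ (fderiv ℝ φ) y) y :=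
    ((hφ.fderiv_right (m := ∞) (by simp)).differentiableAt (by simp)).hasFDerivAt
  have h4 := h2.clm_comp h3
  have h5 := h1.unique h4
  have happ : ∀ v w, (fderiv ℝ f (φ y, y) ∘L .inr ℝ E F) v w =
      - inner ℝ (fderiv ℝ φ y v) (fderiv ℝ φ y w) := by
    intro v w
    rw [h5]
    set_option synthInstance.maxHeartbeats 200000 in
    simp [ContinuousLinearMap.compL_apply]
    rfl
  set A := fderiv ℝ f (φ y, y) ∘L .inr ℝ E F
  have hA : Function.Injective A := by
    rw [injective_iff_map_eq_zero]
    intro v hv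
    have := happ v v
    rw [hv] at this
    simp at this
    exact hinj (by simpa using this)
  have hfin : Module.finrank ℝ F = Module.finrank ℝ (F →L[ℝ] ℝ) := by
    rw [← (LinearMap.toContinuousLinearMap (𝕜 := ℝ) (E := F) (F' := ℝ)).finrank_eq]
    exact (Subspace.dual_finrank_eq (K := ℝ) (V := F)).symm
  let e := (LinearEquiv.ofInjectiveOfFinrankEq A.toLinearMap hA hfin).toContinuousLinearEquiv
  exact ⟨e, by ext; rfl⟩

/-- `z` is a nearest point to `x` in `N`. -/
def IsNearest {E : Type*} [NormedAddCommGroup E] (N : Set E) (x z : E) : Prop :=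
  z ∈ N ∧ ∀ z' ∈ N, ‖x - z‖ ≤ ‖x - z'‖

theorem IsNearest.normalEquation {E F : Type*} [NormedAddCommGroup E] [InnerProductSpace ℝ E]
    [NormedAddCommGroup F] [NormedSpace ℝ F] {N : Set E} {φ : F → E} {x : E} {y : F}
    (hφ : ContDiffAt ℝ ∞ φ y) (hN : ∀ᶠ y' in 𝓝 y, φ y' ∈ N) (h : IsNearest N x (φ y)) :
    (innerSL ℝ (x - φ y)) ∘L fderiv ℝ φ y = 0 := by
  have hd : HasFDerivAt φ (fderiv ℝ φ y) y := (hφ.differentiableAt (by simp)).hasFDerivAt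
  have h1 := (hd.const_sub x).norm_sq
  have hmin : IsLocalMin (fun y' => ‖x - φ y'‖ ^ 2) y := by
    filter_upwards [hN] with y' hy'
    have := h.2 _ hy'
    gcongr
  have h2 := hmin.hasFDerivAt_eq_zero h1
  ext w
  have h3 := congrArg (fun A : F →L[ℝ] ℝ => A w) h2
  simp at h3 ⊢
  linarith

/-- Smooth local parametrizations of the compact set `N` with smooth local inverses. -/
def HasLocalParam {E : Type*} (F : Type*) [NormedAddCommGroup E] [NormedSpace ℝ E]
    [NormedAddCommGroup F] [NormedSpace ℝ F] (N : Set E) : Prop :=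
  ∀ p ∈ N, ∃ (φ : F → E) (g : E → F), ContDiffAt ℝ ∞ g p ∧
    (∀ᶠ y in 𝓝 (g p), ContDiffAt ℝ ∞ φ y ∧ φ y ∈ N ∧ g (φ y) = y) ∧
    ∀ᶠ z in 𝓝 p, z ∈ N → φ (g z) = z

/-- The implicit function theorem solves the normal equation uniquely near `(p, g p)`, so a nearest
point close to `p` is a smooth function of the base point. The assertion is made at every pair near
`(p, p)`, with its own `ρ`, because `ContDiffAt ℝ ∞` at one point does not spread to a
neighbourhood. -/
theorem HasLocalParam.eventually_nearest {E F : Type*} [NormedAddCommGroup E]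
    [InnerProductSpace ℝ E] [CompleteSpace E] [NormedAddCommGroup F] [NormedSpace ℝ F]
    [FiniteDimensional ℝ F] {N : Set E} (hN : HasLocalParam F N) {p : E} (hp : p ∈ N) :
    ∀ᶠ v : E × E in 𝓝 (p, p), IsNearest N v.1 v.2 → ∃ ρ : E → E, ContDiffAt ℝ ∞ ρ v.1 ∧
      ∀ᶠ v' : E × E in 𝓝 v, IsNearest N v'.1 v'.2 → ρ v'.1 = v'.2 := by
  have : CompleteSpace F := FiniteDimensional.complete ℝ F
  obtain ⟨φ, g, hg, hφ, hφg⟩ := hN p hp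
  set f := fun v : E × F => (innerSL ℝ (v.1 - φ v.2)) ∘L fderiv ℝ φ v.2
  have hp0 : φ (g p) = p := hφg.self_of_nhds hp
  have hφ0 := hφ.self_of_nhds.1
  have hinj : Function.Injective (fderiv ℝ φ (g p)) := by
    have h1 : HasFDerivAt (g ∘ φ) ((fderiv ℝ g p) ∘L fderiv ℝ φ (g p)) (g p) := by
      refine HasFDerivAt.comp (g p) ?_ (hφ0.differentiableAt (by simp)).hasFDerivAt
      rw [hp0]
      exact (hg.differentiableAt (by simp)).hasFDerivAt
    have h2 : HasFDerivAt (g ∘ φ) (ContinuousLinearMap.id ℝ F) (g p) := by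
      refine (hasFDerivAt_id (g p)).congr_of_eventuallyEq ?_
      filter_upwards [hφ] with y hy using hy.2.2
    have h3 := h1.unique h2
    refine Function.LeftInverse.injective (g := fderiv ℝ g p) fun w => ?_
    exact congrArg (fun A : F →L[ℝ] F => A w) h3
  have hinv := isInvertible_normalEquation hφ0 hinj
  rw [hp0] at hinv
  have hfc : ContinuousAt (fun v => fderiv ℝ f v ∘L .inr ℝ E F) (p, g p) := by
    have h1 : ContinuousAt (fderiv ℝ f) (p, g p) :=
      ((contDiffAt_normalEquation hφ0).fderiv_right (m := ∞) (by simp)).continuousAt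
    exact h1.clm_comp continuousAt_const
  have hev : ∀ᶠ v in 𝓝 (p, g p), (fderiv ℝ f v ∘L .inr ℝ E F).IsInvertible := by
    obtain ⟨e, he⟩ := hinv
    have := ContinuousLinearEquiv.nhds e
    rw [he] at this
    exact hfc.eventually this
  have hgc : ∀ᶠ z in 𝓝 p, ContinuousAt g z := by
    filter_upwards [(hg.of_le (m := 1) (by simp)).eventually (by simp)] with z hz
      using hz.continuousAt
  have t1 : Tendsto (fun v : E × E => v.2) (𝓝 (p, p)) (𝓝 p) := continuousAt_snd
  have t2 : Tendsto (fun v : E × E => g v.2) (𝓝 (p, p)) (𝓝 (g p)) := hg.continuousAt.tendsto.comp t1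
  have t3 : Tendsto (fun v : E × E => (v.1, g v.2)) (𝓝 (p, p)) (𝓝 (p, g p)) :=
    Tendsto.prodMk_nhds continuousAt_fst t2
  filter_upwards [t1.eventually hgc, t1.eventually hφg.eventually_nhds,
    t2.eventually hφ.eventually_nhds, t3.eventually hev] with v h1 h2 h3 h4 hv
  have hφv := h3.self_of_nhds.1
  have hz : φ (g v.2) = v.2 := h2.self_of_nhds hv.1
  have hcd : ContDiffAt ℝ ∞ f (v.1, g v.2) := contDiffAt_normalEquation hφv
  have hf0 : f (v.1, g v.2) = 0 := by
    refine IsNearest.normalEquation (N := N) hφv (h3.mono fun y hy => hy.2.1) ?_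
    rwa [hz]
  refine ⟨fun x => φ (hcd.implicitFunction (by simp) h4 x), ?_, ?_⟩
  · have h5 : ContDiffAt ℝ ∞ φ (hcd.implicitFunction (by simp) h4 v.1) := by
      rw [hcd.implicitFunction_apply_self (by simp) h4]; exact hφv
    exact h5.comp v.1 (hcd.contDiffAt_implicitFunction (by simp) h4)
  · have t4 : Tendsto (fun v' : E × E => g v'.2) (𝓝 v) (𝓝 (g v.2)) :=
      h1.tendsto.comp continuousAt_snd
    have t5 : Tendsto (fun v' : E × E => (v'.1, g v'.2)) (𝓝 v) (𝓝 (v.1, g v.2)) :=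
      Tendsto.prodMk_nhds continuousAt_fst t4
    have t6 : Tendsto (fun v' : E × E => v'.2) (𝓝 v) (𝓝 v.2) := continuousAt_snd
    filter_upwards [t5.eventually (hcd.eventually_apply_eq_iff_implicitFunction (by simp) h4),
      t4.eventually h3.eventually_nhds, t6.eventually h2] with v' h6 h7 h8 hv'
    have hz' : φ (g v'.2) = v'.2 := h8 hv'.1
    have hf' : f (v'.1, g v'.2) = 0 := by
      refine IsNearest.normalEquation (N := N) h7.self_of_nhds.1 (h7.mono fun y hy => hy.2.1) ?_
      rwa [hz']
    have := h6.1 (by rw [hf', hf0])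
    rw [this, hz']

/-- A smooth Lipschitz retraction of a tubular neighbourhood of radius `δ` onto `N`. -/
structure IsTubularRetraction {E : Type*} [NormedAddCommGroup E] [NormedSpace ℝ E] (N : Set E)
    (δ : ℝ) (K : ℝ≥0) (P : E → E) : Prop where
  mem : ∀ x, P x ∈ N
  eq_self : ∀ x ∈ N, P x = x
  contDiffAt : ∀ x ∈ Metric.thickening δ N, ContDiffAt ℝ ∞ P x
  lipschitz : LipschitzOnWith K P (Metric.thickening δ N)

/-- `P` is an arbitrary selection of nearest points on the whole space. Uniqueness is never proved:
near `N` any selection agrees with the local smooth solutions of the normal equation. -/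
theorem HasLocalParam.exists_retraction {E F : Type*} [NormedAddCommGroup E]
    [InnerProductSpace ℝ E] [FiniteDimensional ℝ E] [NormedAddCommGroup F] [NormedSpace ℝ F]
    [FiniteDimensional ℝ F] {N : Set E} (hN : HasLocalParam F N) (hc : IsCompact N)
    (hne : N.Nonempty) :
    ∃ (δ : ℝ) (K : ℝ≥0) (P : E → E), 0 < δ ∧ IsTubularRetraction N δ K P := by
  have : CompleteSpace E := FiniteDimensional.complete ℝ E
  have hex : ∀ x, ∃ z, IsNearest N x z := by
    intro x
    obtain ⟨z, hz, hmin⟩ := hc.exists_isMinOn (f := fun z => ‖x - z‖) hne (by fun_prop)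
    exact ⟨z, hz, fun z' hz' => hmin hz'⟩
  choose P hP using hex
  have hself : ∀ x ∈ N, P x = x := by
    intro x hx
    have := (hP x).2 x hx
    simp only [sub_self, norm_zero, norm_le_zero_iff, sub_eq_zero] at this
    exact this.symm
  have hcont : ∀ p ∈ N, Tendsto P (𝓝 p) (𝓝 p) := by
    intro p hp
    rw [tendsto_iff_norm_sub_tendsto_zero]
    have h0 : Tendsto (fun x => 2 * ‖x - p‖) (𝓝 p) (𝓝 0) := by
      have : Continuous fun x : E => 2 * ‖x - p‖ := by fun_prop
      simpa using this.tendsto p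
    refine squeeze_zero (fun _ => norm_nonneg _) (fun x => ?_) h0
    calc ‖P x - p‖ ≤ ‖x - p‖ + ‖x - P x‖ := by
          have := norm_sub_le (x - p) (x - P x)
          simpa using this
      _ ≤ 2 * ‖x - p‖ := by linarith [(hP x).2 p hp]
  have hsm : ∀ p ∈ N, ∀ᶠ x in 𝓝 p, ContDiffAt ℝ ∞ P x := by
    intro p hp
    have t : Tendsto (fun x => (x, P x)) (𝓝 p) (𝓝 (p, p)) :=
      Tendsto.prodMk_nhds tendsto_id (hcont p hp)
    have hev := hN.eventually_nearest hp
    obtain ⟨ρ, hρ, hρe⟩ := hev.self_of_nhds ⟨hp, fun z' _ => by simp⟩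
    have hPρ : ∀ᶠ x in 𝓝 p, P x = ρ x := by
      filter_upwards [t.eventually hρe] with x hx using (hx (hP x)).symm
    have hρc : ∀ᶠ x in 𝓝 p, ContinuousAt ρ x := by
      filter_upwards [(hρ.of_le (m := 1) (by simp)).eventually (by simp)] with x hx
        using hx.continuousAt
    filter_upwards [t.eventually hev, hPρ.eventually_nhds, hρc] with x h1 h2 h3
    obtain ⟨ρ', hρ', hρe'⟩ := h1 (hP x)
    -- Two local solutions are used: `ρ`, attached to `p`, gives continuity of `P` at `x`. Only then
    -- do the pairs `(y, P y)` stay near `(x, P x)`, so that `P` can be identified with `ρ'`, which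
    -- is smooth at `x`.
    have hPc : ContinuousAt P x := h3.congr (h2.mono fun y hy => hy.symm)
    refine hρ'.congr_of_eventuallyEq ?_
    have t' : Tendsto (fun y => (y, P y)) (𝓝 x) (𝓝 (x, P x)) :=
      Tendsto.prodMk_nhds tendsto_id hPc
    filter_upwards [t'.eventually hρe'] with y hy using (hy (hP y)).symm
  have hopen : IsOpen {x | ∀ᶠ y in 𝓝 x, ContDiffAt ℝ ∞ P y} := isOpen_setOfPred_eventually_nhds
  obtain ⟨δ, hδ, hsub⟩ := hc.exists_cthickening_subset_open hopen hsm
  have hK : IsCompact (Metric.cthickening δ N) := hc.cthickening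
  have hlip : LocallyLipschitzOn (Metric.cthickening δ N) P := by
    intro x hx
    have h1 : ContDiffAt ℝ 1 P x := (hsub hx).self_of_nhds.of_le (by simp)
    obtain ⟨K, t, ht, hKt⟩ := h1.exists_lipschitzOnWith
    exact ⟨K, t, mem_nhdsWithin_of_mem_nhds ht, hKt⟩
  obtain ⟨K, hKL⟩ := hlip.exists_lipschitzOnWith_of_compact hK
  have hs : Metric.thickening δ N ⊆ Metric.cthickening δ N := Metric.thickening_subset_cthickening _ _
  exact ⟨δ, K, P, hδ, fun x => (hP x).1, hself, fun x hx => (hsub (hs hx)).self_of_nhds,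
    hKL.mono hs⟩

/-- The parametrization is `j` in a chart, its inverse the chart after a smooth local left inverse
of `j`. That `j` is a topological embedding, and not just an immersion, ensures that all points of
the range near `j q₀` come from points near `q₀`. -/
theorem hasLocalParam_range {k M : ℕ} {N : Type*} [TopologicalSpace N]
    [ChartedSpace (EuclideanSpace ℝ (Fin k)) N] [IsManifold (𝓡 k) ∞ N]
    {j : N → EuclideanSpace ℝ (Fin M)}
    (hj : IsSmoothEmbedding (𝓡 k) 𝓘(ℝ, EuclideanSpace ℝ (Fin M)) ∞ j) :
    HasLocalParam (EuclideanSpace ℝ (Fin k)) (range j) := by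
  rintro _ ⟨q₀, rfl⟩
  obtain ⟨G, hG, hGj⟩ := exists_local_left_inverse (hj.isImmersion.isImmersionAt q₀)
  have hG0 : G (j q₀) = q₀ := hGj.self_of_nhds
  set e := extChartAt (𝓡 k) q₀
  have he0 : e.symm (e q₀) = q₀ := extChartAt_to_inv q₀
  have hg : ContDiffAt ℝ ∞ (fun z => e (G z)) (j q₀) := by
    rw [← contMDiffAt_iff_contDiffAt]
    refine ContMDiffAt.comp (j q₀) (I' := 𝓡 k) (g := e) ?_ hG
    rw [hG0]
    exact contMDiffAt_extChartAt
  refine ⟨fun y => j (e.symm y), fun z => e (G z), hg, ?_, ?_⟩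
  · beta_reduce
    rw [hG0]
    have h1 : ∀ᶠ y in 𝓝 (e q₀), y ∈ e.target := extChartAt_target_mem_nhds q₀
    have h2 : ∀ᶠ y in 𝓝 (e q₀), G (j (e.symm y)) = e.symm y := by
      have : Tendsto e.symm (𝓝 (e q₀)) (𝓝 q₀) := by
        have := continuousAt_extChartAt_symm (I := 𝓡 k) q₀
        rwa [ContinuousAt, he0] at this
      exact this.eventually hGj
    filter_upwards [h1, h2] with y hy1 hy2
    refine ⟨?_, mem_range_self _, by rw [hy2]; exact e.right_inv hy1⟩
    rw [← contMDiffAt_iff_contDiffAt]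
    refine (hj.contMDiff _).comp y ?_
    exact (contMDiffOn_extChartAt_symm (I := 𝓡 k) q₀).contMDiffAt
      ((isOpen_extChartAt_target q₀).mem_nhds hy1)
  · have h3 : ∀ᶠ q in 𝓝 q₀, j (e.symm (e (G (j q)))) = j q := by
      filter_upwards [hGj, extChartAt_source_mem_nhds (I := 𝓡 k) q₀] with q hq hq'
      rw [hq]; congr 1; exact e.left_inv hq'
    rw [hj.isEmbedding.nhds_eq_comap, eventually_comap] at h3
    filter_upwards [h3] with z hz
    rintro ⟨q, rfl⟩
    exact hz q rfl

end FractionalHarmonic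

/-! ### Riemannian distance, chordal distance and Ahlfors regularity -/

namespace FractionalHarmonic

/-- Composing the chart with a smooth local left inverse of `ι` makes the coordinates a `C^1`, hence
locally Lipschitz, function of the ambient point. -/
theorem exists_dist_extChartAt_le {n L : ℕ} {S : Type*} [EMetricSpace S]
    [ChartedSpace (EuclideanSpace ℝ (Fin n)) S] [IsManifold (𝓡 n) ∞ S]
    {ι : S → EuclideanSpace ℝ (Fin L)} {x₀ : S}
    (hι : IsImmersionAt (𝓡 n) 𝓘(ℝ, EuclideanSpace ℝ (Fin L)) ∞ ι x₀) :
    ∃ C : ℝ≥0, ∃ U ∈ 𝓝 x₀, ∀ x ∈ U, ∀ y ∈ U,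
      edist (extChartAt (𝓡 n) x₀ x) (extChartAt (𝓡 n) x₀ y) ≤ C * edist (ι x) (ι y) := by
  obtain ⟨G, hG, hGι⟩ := exists_local_left_inverse hι
  set e := extChartAt (𝓡 n) x₀
  have hG0 : G (ι x₀) = x₀ := hGι.self_of_nhds
  have hg : ContDiffAt ℝ 1 (fun z => e (G z)) (ι x₀) := by
    rw [← contMDiffAt_iff_contDiffAt]
    refine (ContMDiffAt.comp (ι x₀) (I' := 𝓡 n) (n := ∞) (g := e) ?_ hG).of_le (by simp)
    rw [hG0]
    exact contMDiffAt_extChartAt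
  obtain ⟨K, t, ht, hK⟩ := hg.exists_lipschitzOnWith
  refine ⟨K, _, inter_mem (hι.continuousAt ht) hGι, ?_⟩
  rintro x ⟨hx1, hx2⟩ y ⟨hy1, hy2⟩
  have h : edist (e (G (ι x))) (e (G (ι y))) ≤ K * edist (ι x) (ι y) := hK hx1 hy1
  simp only [mem_ofPred_eq] at hx2 hy2
  rwa [hx2, hy2] at h

section Riemannian

variable {n L : ℕ} {S : Type*} [EMetricSpace S]
    [ChartedSpace (EuclideanSpace ℝ (Fin n)) S] [IsManifold (𝓡 n) ∞ S]
    [RiemannianBundle (fun x : S => TangentSpace (𝓡 n) x)]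
    [IsContMDiffRiemannianBundle (𝓡 n) ∞ (EuclideanSpace ℝ (Fin n))
      (fun x : S => TangentSpace (𝓡 n) x)]

theorem isContinuousRiemannianBundle_tangentSpace :
    IsContinuousRiemannianBundle (EuclideanSpace ℝ (Fin n))
      (fun x : S => TangentSpace (𝓡 n) x) := by
  obtain ⟨g, hg, h⟩ := IsContMDiffRiemannianBundle.exists_contMDiff (IB := 𝓡 n) (n := ∞)
    (F := EuclideanSpace ℝ (Fin n)) (E := fun x : S => TangentSpace (𝓡 n) x)
  exact ⟨g, hg.continuous, h⟩

attribute [local instance] normedAddCommGroupTangentSpaceVectorSpace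
attribute [local instance] normedSpaceTangentSpaceVectorSpace

theorem eventually_enorm_mfderiv_le {f : S → EuclideanSpace ℝ (Fin L)}
    (hf : ContMDiff (𝓡 n) 𝓘(ℝ, EuclideanSpace ℝ (Fin L)) ∞ f) (x₀ : S) :
    ∃ C : ℝ≥0, ∀ᶠ z in 𝓝 x₀, ∀ v : TangentSpace (𝓡 n) z,
      ‖mfderiv (𝓡 n) 𝓘(ℝ, EuclideanSpace ℝ (Fin L)) f z v‖ₑ ≤ C * ‖v‖ₑ := by
  have : IsManifold (𝓡 n) 1 S := .of_le (n := ∞) (by simp)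
  have : IsContinuousRiemannianBundle (EuclideanSpace ℝ (Fin n))
      (fun x : S => TangentSpace (𝓡 n) x) := isContinuousRiemannianBundle_tangentSpace
  obtain ⟨C, -, hC⟩ := eventually_enorm_mfderiv_extChartAt_lt (𝓡 n) x₀
  set e := extChartAt (𝓡 n) x₀
  have hfe : ∀ y ∈ e.target, ContDiffAt ℝ ∞ (fun y => f (e.symm y)) y := by
    intro y hy
    rw [← contMDiffAt_iff_contDiffAt]
    refine (hf _).comp y ?_
    exact (contMDiffOn_extChartAt_symm (I := 𝓡 n) x₀).contMDiffAt
      ((isOpen_extChartAt_target x₀).mem_nhds hy)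
  have h0 : e x₀ ∈ e.target := mem_extChartAt_target x₀
  have hc : ContinuousAt (fun z => ‖fderiv ℝ (fun y => f (e.symm y)) (e z)‖) x₀ := by
    have h1 : ContinuousAt (fderiv ℝ (fun y => f (e.symm y))) (e x₀) :=
      ((hfe _ h0).fderiv_right (m := ∞) (by simp)).continuousAt
    exact (h1.comp (continuousAt_extChartAt x₀)).norm
  set C' := ‖fderiv ℝ (fun y => f (e.symm y)) (e x₀)‖₊ + 1
  have hlt : ∀ᶠ z in 𝓝 x₀, ‖fderiv ℝ (fun y => f (e.symm y)) (e z)‖ < C' :=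
    hc.eventually_lt continuousAt_const (by simp [C'])
  refine ⟨C' * C, ?_⟩
  filter_upwards [hC, hlt, (isOpen_extChartAt_source (I := 𝓡 n) x₀).eventually_mem
    (mem_extChartAt_source x₀)] with z hz1 hz2 hz3 v
  have hez : e z ∈ e.target := e.map_source hz3
  have h0 : mfderiv (𝓡 n) 𝓘(ℝ, EuclideanSpace ℝ (Fin L)) f z =
      mfderiv (𝓡 n) 𝓘(ℝ, EuclideanSpace ℝ (Fin L)) ((fun y => f (e.symm y)) ∘ e) z := by
    have h : f =ᶠ[𝓝 z] ((fun y => f (e.symm y)) ∘ e) := by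
      filter_upwards [(isOpen_extChartAt_source (I := 𝓡 n) x₀).mem_nhds hz3] with w hw
      simp only [Function.comp_apply]
      rw [e.left_inv hw]
    exact h.mfderiv_eq
  have h1 := h0.trans (mfderiv_comp z (I' := 𝓘(ℝ, EuclideanSpace ℝ (Fin n)))
    (M := S) (M' := EuclideanSpace ℝ (Fin n)) (M'' := EuclideanSpace ℝ (Fin L))
    (((hfe _ hez).differentiableAt (by simp)).mdifferentiableAt)
    (mdifferentiableAt_extChartAt (by simpa [e] using hz3)))
  have h2 : mfderiv 𝓘(ℝ, EuclideanSpace ℝ (Fin n)) 𝓘(ℝ, EuclideanSpace ℝ (Fin L))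
      (fun y => f (e.symm y)) (e z) = fderiv ℝ (fun y => f (e.symm y)) (e z) := mfderiv_eq_fderiv
  have h3 : ∀ w : EuclideanSpace ℝ (Fin n), ‖fderiv ℝ (fun y => f (e.symm y)) (e z) w‖ₑ ≤
      C' * ‖w‖ₑ := by
    intro w
    refine (ContinuousLinearMap.le_opENorm _ _).trans ?_
    gcongr
    refine ENNReal.coe_le_coe.2 ?_
    exact_mod_cast hz2.le
  have h4 : ∀ w : EuclideanSpace ℝ (Fin n), ‖mfderiv 𝓘(ℝ, EuclideanSpace ℝ (Fin n))
      𝓘(ℝ, EuclideanSpace ℝ (Fin L)) (fun y => f (e.symm y)) (e z) w‖ₑ ≤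
      C' * ‖w‖ₑ := by
    intro w
    rw [h2]
    exact h3 w
  rw [h1]
  refine (h4 _).trans ?_
  rw [ENNReal.coe_mul, mul_assoc]
  gcongr
  refine (ContinuousLinearMap.le_opENorm _ _).trans ?_
  exact mul_le_mul_left hz1.le _

theorem exists_enorm_mfderiv_le [CompactSpace S] {f : S → EuclideanSpace ℝ (Fin L)}
    (hf : ContMDiff (𝓡 n) 𝓘(ℝ, EuclideanSpace ℝ (Fin L)) ∞ f) :
    ∃ C : ℝ≥0, ∀ z, ∀ v : TangentSpace (𝓡 n) z,
      ‖mfderiv (𝓡 n) 𝓘(ℝ, EuclideanSpace ℝ (Fin L)) f z v‖ₑ ≤ C * ‖v‖ₑ := by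
  choose C hC using eventually_enorm_mfderiv_le hf
  obtain ⟨t, -, ht⟩ := isCompact_univ.elim_nhds_subcover _ (fun x _ => hC x)
  refine ⟨∑ x ∈ t, C x, fun z v => ?_⟩
  obtain ⟨x, hx, hz⟩ := mem_iUnion₂.1 (ht (mem_univ z))
  refine (hz v).trans ?_
  gcongr
  exact Finset.single_le_sum (f := C) (fun _ _ => zero_le) hx

/-- A smooth map on a compact Riemannian manifold is Lipschitz for the Riemannian distance. -/
theorem exists_lipschitzWith_of_contMDiff [CompactSpace S] [IsRiemannianManifold (𝓡 n) S]
    {f : S → EuclideanSpace ℝ (Fin L)}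
    (hf : ContMDiff (𝓡 n) 𝓘(ℝ, EuclideanSpace ℝ (Fin L)) ∞ f) :
    ∃ C : ℝ≥0, LipschitzWith C f := by
  have : IsManifold (𝓡 n) 1 S := .of_le (n := ∞) (by simp)
  obtain ⟨C, hC⟩ := exists_enorm_mfderiv_le hf
  refine ⟨C + 1, fun x y => ?_⟩
  rw [IsRiemannianManifold.out (I := 𝓡 n) x y]
  refine ENNReal.le_of_forall_pos_le_add fun ε hε hfin => ?_
  -- An almost shortest curve; the excess `ε / (C + 1)` becomes at most `ε` after multiplication by
  -- `C`, also when `C = 0`.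
  obtain ⟨γ, hγ0, hγ1, hγs, hγ, -⟩ := exists_lt_locally_constant_of_riemannianEDist_lt
    (I := 𝓡 n) (x := x) (y := y) (r := riemannianEDist (𝓡 n) x y + ε / (C + 1)) (by
      refine ENNReal.lt_add_right ?_ ?_
      · rintro h
        simp [h] at hfin
      · exact (ENNReal.div_pos (by simpa using hε.ne') (by simp)).ne') zero_lt_one
  have hs : ContMDiff 𝓘(ℝ, ℝ) 𝓘(ℝ, EuclideanSpace ℝ (Fin L)) 1 (f ∘ γ) :=
    (hf.of_le (by simp)).comp hγs
  calc edist (f x) (f y) = ‖(f ∘ γ) 1 - (f ∘ γ) 0‖ₑ := by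
        simp [hγ0, hγ1, edist_comm (f x), edist_eq_enorm_sub]
    _ ≤ ∫⁻ t in Icc 0 1, ‖derivWithin (f ∘ γ) (Icc 0 1) t‖ₑ := by
        apply enorm_sub_le_lintegral_derivWithin_Icc_of_contDiffOn_Icc _ zero_le_one
        exact (contMDiff_iff_contDiff.1 hs).contDiffOn
    _ = ∫⁻ t in Icc 0 1, ‖mfderivWithin 𝓘(ℝ, ℝ) 𝓘(ℝ, EuclideanSpace ℝ (Fin L)) (f ∘ γ)
          (Icc 0 1) t 1‖ₑ := by
        simp_rw [← fderivWithin_derivWithin, mfderivWithin_eq_fderivWithin]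
        rfl
    _ ≤ ∫⁻ t in Icc 0 1, C * ‖mfderivWithin 𝓘(ℝ, ℝ) (𝓡 n) γ (Icc 0 1) t 1‖ₑ := by
        apply setLIntegral_mono' measurableSet_Icc (fun t ht ↦ ?_)
        have h1 : mfderivWithin 𝓘(ℝ, ℝ) 𝓘(ℝ, EuclideanSpace ℝ (Fin L)) (f ∘ γ) (Icc 0 1) t =
            (mfderiv (𝓡 n) 𝓘(ℝ, EuclideanSpace ℝ (Fin L)) f (γ t)) ∘L
              (mfderivWithin 𝓘(ℝ, ℝ) (𝓡 n) γ (Icc 0 1) t) := by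
          apply mfderiv_comp_mfderivWithin
          · exact (hf.mdifferentiable (by simp)) _
          · exact (hγs.mdifferentiable one_ne_zero).mdifferentiableOn _ ht
          · rw [uniqueMDiffWithinAt_iff_uniqueDiffWithinAt]
            exact uniqueDiffOn_Icc zero_lt_one _ ht
        rw [h1]
        exact hC _ _
    _ = C * pathELength (𝓡 n) γ 0 1 := by
        rw [lintegral_const_mul' _ _ ENNReal.coe_ne_top,
          pathELength_eq_lintegral_mfderivWithin_Icc]
    _ ≤ C * (riemannianEDist (𝓡 n) x y + ε / (C + 1)) := by gcongr
    _ ≤ (C + 1 : ℝ≥0) * riemannianEDist (𝓡 n) x y + ε := by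
        rw [mul_add]
        gcongr
        · simp
        rw [← mul_div_assoc]
        refine ENNReal.div_le_of_le_mul ?_
        rw [mul_comm]
        gcongr
        simp

/-- The preimage of a straight segment under the chart is a competitor for the Riemannian distance,
and its length is at most `C` times that of the segment. A ball is used because it is convex. -/
theorem exists_edist_le_extChartAt [IsRiemannianManifold (𝓡 n) S] (x₀ : S) :
    ∃ (C : ℝ≥0) (r : ℝ), 0 < r ∧ Metric.ball (extChartAt (𝓡 n) x₀ x₀) r ⊆
        (extChartAt (𝓡 n) x₀).target ∧
      LipschitzOnWith C (extChartAt (𝓡 n) x₀).symm (Metric.ball (extChartAt (𝓡 n) x₀ x₀) r) := by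
  have : IsManifold (𝓡 n) 1 S := .of_le (n := ∞) (by simp)
  have : IsContinuousRiemannianBundle (EuclideanSpace ℝ (Fin n))
      (fun x : S => TangentSpace (𝓡 n) x) := isContinuousRiemannianBundle_tangentSpace
  obtain ⟨C, -, hC⟩ := eventually_enorm_mfderivWithin_symm_extChartAt_lt (𝓡 n) x₀
  set e := extChartAt (𝓡 n) x₀
  have hC' : ∀ᶠ y in 𝓝[range (𝓡 n)] (e x₀), ∀ v : EuclideanSpace ℝ (Fin n),
      ‖mfderivWithin 𝓘(ℝ, EuclideanSpace ℝ (Fin n)) (𝓡 n) e.symm (range (𝓡 n)) y v‖ₑ ≤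
        C * ‖v‖ₑ := by
    filter_upwards [hC] with y hy v
    refine (ContinuousLinearMap.le_opENorm _ _).trans ?_
    exact mul_le_mul_left hy.le _
  obtain ⟨r, r_pos, hr⟩ : ∃ r > 0, Metric.ball (e x₀) r ∩ range (𝓡 n) ⊆ e.target ∩
        {y | ∀ v : EuclideanSpace ℝ (Fin n), ‖mfderivWithin 𝓘(ℝ, EuclideanSpace ℝ (Fin n)) (𝓡 n)
          e.symm (range (𝓡 n)) y v‖ₑ ≤ C * ‖v‖ₑ} :=
    Metric.mem_nhdsWithin_iff.1 (inter_mem (extChartAt_target_mem_nhdsWithin x₀) hC')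
  have hrange : range (𝓡 n) = univ := by simp
  have hr' : Metric.ball (e x₀) r ⊆ e.target := by
    intro y hy; exact (hr ⟨hy, by simp⟩).1
  refine ⟨C, r, r_pos, hr', fun a ha b hb => ?_⟩
  rw [IsRiemannianManifold.out (I := 𝓡 n)]
  let η := ContinuousAffineMap.lineMap (R := ℝ) a b
  set γ := e.symm ∘ η
  have hη : Icc 0 1 ⊆ ⇑η ⁻¹' (e.target ∩
        {y | ∀ v : EuclideanSpace ℝ (Fin n), ‖mfderivWithin 𝓘(ℝ, EuclideanSpace ℝ (Fin n)) (𝓡 n)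
          e.symm (range (𝓡 n)) y v‖ₑ ≤ C * ‖v‖ₑ}) := by
    simp only [← image_subset_iff, ContinuousAffineMap.coe_lineMap_eq,
     ← segment_eq_image_lineMap, η]
    apply Subset.trans _ hr
    rw [hrange, inter_univ]
    exact (convex_ball _ _).segment_subset ha hb
  simp only [preimage_inter, subset_inter_iff] at hη
  have η_smooth : ContMDiffOn 𝓘(ℝ, ℝ) 𝓘(ℝ, EuclideanSpace ℝ (Fin n)) 1 η (Icc 0 1) := by
    apply ContMDiff.contMDiffOn
    rw [contMDiff_iff_contDiff]
    exact ContinuousAffineMap.contDiff _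
  have : riemannianEDist (𝓡 n) (e.symm a) (e.symm b) ≤ pathELength (𝓡 n) γ 0 1 := by
    apply riemannianEDist_le_pathELength _ _ _ zero_le_one
    · exact (contMDiffOn_extChartAt_symm x₀).comp η_smooth hη.1
    · simp [γ, η, ContinuousAffineMap.coe_lineMap_eq]
    · simp [γ, η, ContinuousAffineMap.coe_lineMap_eq]
  apply this.trans
  rw [← lintegral_fderiv_lineMap_eq_edist, pathELength_eq_lintegral_mfderivWithin_Icc,
    ← lintegral_const_mul' _ _ ENNReal.coe_ne_top]
  apply setLIntegral_mono' measurableSet_Icc (fun t ht ↦ ?_)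
  have : mfderivWithin 𝓘(ℝ, ℝ) (𝓡 n) γ (Icc 0 1) t =
      (mfderivWithin 𝓘(ℝ, EuclideanSpace ℝ (Fin n)) (𝓡 n) e.symm (range (𝓡 n)) (η t)) ∘L
        (mfderivWithin 𝓘(ℝ, ℝ) 𝓘(ℝ, EuclideanSpace ℝ (Fin n)) η (Icc 0 1) t) := by
    apply mfderivWithin_comp
    · exact mdifferentiableWithinAt_extChartAt_symm (hη.1 ht)
    · exact η_smooth.mdifferentiableOn one_ne_zero t ht
    · exact hη.1.trans (preimage_mono (extChartAt_target_subset_range x₀))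
    · rw [uniqueMDiffWithinAt_iff_uniqueDiffWithinAt]
      exact uniqueDiffOn_Icc zero_lt_one t ht
  have : mfderivWithin 𝓘(ℝ, ℝ) (𝓡 n) γ (Icc 0 1) t 1 =
      (mfderivWithin 𝓘(ℝ, EuclideanSpace ℝ (Fin n)) (𝓡 n) e.symm (range (𝓡 n)) (η t))
      (mfderivWithin 𝓘(ℝ, ℝ) 𝓘(ℝ, EuclideanSpace ℝ (Fin n)) η (Icc 0 1) t 1) := congr($this 1)
  rw [this]
  refine (hη.2 ht _).trans ?_
  gcongr
  simp only [mfderivWithin_eq_fderivWithin]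
  exact le_of_eq rfl

end Riemannian

/-- The set of points whose image under `ι` is at distance less than `r` from that of `x`. -/
def iball {X E : Type*} [PseudoMetricSpace E] (ι : X → E) (x : X) (r : ℝ) : Set X :=
  {y | dist (ι x) (ι y) < r}

/-- Ahlfors regularity of dimension `n` of the measure `μ` for the distance induced by `ι`. -/
structure IsAhlfors {X E : Type*} [PseudoMetricSpace E] [MeasurableSpace X] (n : ℕ) (ι : X → E)
    (μ : Measure X) (c C : ℝ≥0) : Prop where
  pos : 0 < c
  le_measure : ∀ x r, 0 < r → r ≤ 1 → c * ENNReal.ofReal r ^ n ≤ μ (iball ι x r)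
  measure_le : ∀ x r, 0 < r → μ (iball ι x r) ≤ C * ENNReal.ofReal r ^ n

theorem euclideanHausdorffMeasure_image_le {X Y : Type*} [EMetricSpace X] [MeasurableSpace X]
    [BorelSpace X] [EMetricSpace Y] [MeasurableSpace Y] [BorelSpace Y] {n : ℕ} {K : ℝ≥0}
    {f : X → Y} {s : Set X} (hf : LipschitzOnWith K f s) :
    (μHE[n] : Measure Y) (f '' s) ≤ (K : ℝ≥0∞) ^ n * (μHE[n] : Measure X) s := by
  simp only [Measure.euclideanHausdorffMeasure_def, Measure.smul_apply, ENNReal.smul_def,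
    smul_eq_mul]
  have := hf.hausdorffMeasure_image_le (d := (n : ℝ)) (by positivity)
  rw [ENNReal.rpow_natCast] at this
  calc _ ≤ _ := mul_le_mul_right this _
    _ = _ := by ring

theorem euclideanHausdorffMeasure_ball {n : ℕ} (x : EuclideanSpace ℝ (Fin n)) {r : ℝ}
    (hr : 0 < r) :
    (μHE[n] : Measure (EuclideanSpace ℝ (Fin n))) (Metric.ball x r) =
      ENNReal.ofReal r ^ n *
        ((volume (Metric.ball (0 : EuclideanSpace ℝ (Fin n)) 1)).toNNReal : ℝ≥0) := by
  have h : (μHE[n] : Measure (EuclideanSpace ℝ (Fin n))) = volume :=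
    EuclideanSpace.euclideanHausdorffMeasure_eq_volume n
  rw [h, Measure.addHaar_ball_of_pos _ _ hr, ENNReal.coe_toNNReal measure_ball_lt_top.ne,
    ENNReal.ofReal_pow hr.le]
  simp

section Ahlfors

variable {n L : ℕ} {S : Type*} [EMetricSpace S] [MeasurableSpace S] [BorelSpace S]
    [ChartedSpace (EuclideanSpace ℝ (Fin n)) S] [IsManifold (𝓡 n) ∞ S]
    [RiemannianBundle (fun x : S => TangentSpace (𝓡 n) x)]
    [IsContMDiffRiemannianBundle (𝓡 n) ∞ (EuclideanSpace ℝ (Fin n))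
      (fun x : S => TangentSpace (𝓡 n) x)]

/-- The chart is Lipschitz for the chordal distance and its inverse for the Riemannian one, which in
turn dominates the chordal one. Chordal balls are thus comparable to Euclidean balls in the chart,
and Lipschitz maps of constant `K` enlarge `n`-dimensional Hausdorff measure by at most `K ^ n`. -/
theorem eventually_ahlfors [IsRiemannianManifold (𝓡 n) S] {ι : S → EuclideanSpace ℝ (Fin L)}
    (hι : IsSmoothEmbedding (𝓡 n) 𝓘(ℝ, EuclideanSpace ℝ (Fin L)) ∞ ι) {Cι : ℝ≥0}
    (hL : LipschitzWith Cι ι) (x₀ : S) :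
    ∃ (c C : ℝ≥0) (ρ : ℝ), 0 < c ∧ 0 < ρ ∧ ∀ᶠ x in 𝓝 x₀, ∀ r, 0 < r → r ≤ ρ →
      c * ENNReal.ofReal r ^ n ≤ (μHE[n] : Measure S) (iball ι x r) ∧
      (μHE[n] : Measure S) (iball ι x r) ≤ C * ENNReal.ofReal r ^ n := by
  obtain ⟨C₂, U, hU, hCU⟩ := exists_dist_extChartAt_le (hι.isImmersion.isImmersionAt x₀)
  obtain ⟨C₁, r₁, hr₁, hsub, hlip⟩ := exists_edist_le_extChartAt (n := n) x₀
  set e := extChartAt (𝓡 n) x₀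
  obtain ⟨r₂, hr₂, hr₂U⟩ : ∃ r₂ > 0, Metric.ball (e x₀) r₂ ⊆ e.symm ⁻¹' U :=
    Metric.mem_nhds_iff.1 (extChartAt_preimage_mem_nhds hU)
  set r' := min r₁ r₂
  have hr' : 0 < r' := lt_min hr₁ hr₂
  set T := Metric.ball (e x₀) r'
  have hT₁ : T ⊆ Metric.ball (e x₀) r₁ := Metric.ball_subset_ball (min_le_left _ _)
  have hT₂ : T ⊆ Metric.ball (e x₀) r₂ := Metric.ball_subset_ball (min_le_right _ _)
  have hlipT : LipschitzOnWith C₁ e.symm T := hlip.mono hT₁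
  set W := e.source ∩ e ⁻¹' T
  have hW : ∀ r > 0, e.source ∩ e ⁻¹' Metric.ball (e x₀) r ∈ 𝓝 x₀ := fun r hr =>
    inter_mem (extChartAt_source_mem_nhds x₀)
      (continuousAt_extChartAt x₀ (Metric.ball_mem_nhds _ hr))
  -- The radius `2 * ρ` leaves room for a centre within `ρ` of `x₀` and a ball of radius at most `ρ`
  -- about it.
  obtain ⟨ρ, hρ, hρW⟩ : ∃ ρ > 0, ∀ y, dist (ι y) (ι x₀) < 2 * ρ → y ∈ W := by
    have h := hW r' hr'
    rw [hι.isEmbedding.nhds_eq_comap, mem_comap] at h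
    obtain ⟨t, ht, htW⟩ := h
    obtain ⟨ε, hε, hεt⟩ := Metric.mem_nhds_iff.1 ht
    exact ⟨ε / 2, by positivity, fun y hy => htW (hεt (by simpa using (by linarith : _ < ε)))⟩
  have hWU : W ⊆ U := by
    rintro y ⟨hy1, hy2⟩
    have := hr₂U (hT₂ hy2)
    rwa [mem_preimage, e.left_inv hy1] at this
  set v := (volume (Metric.ball (0 : EuclideanSpace ℝ (Fin n)) 1)).toNNReal
  have hv : 0 < v := ENNReal.toNNReal_pos (Metric.measure_ball_pos _ _ one_pos).ne'
    measure_ball_lt_top.ne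
  -- The coordinate ball of radius `r / K` serves for the lower bound: `Cι * C₁` places its image in
  -- the chordal ball of radius `r`, and `2 * ρ / r'` keeps it inside `T`.
  set K : ℝ≥0 := Cι * C₁ + 1 + (2 * ρ / r').toNNReal
  have hK : 0 < K := by positivity
  have hKr : 2 * ρ / r' ≤ K := by
    simp only [K, NNReal.coe_add, NNReal.coe_mul, NNReal.coe_one]
    have := Real.le_coe_toNNReal (2 * ρ / r')
    have h2 : 0 ≤ (Cι : ℝ) * C₁ := by positivity
    linarith
  refine ⟨v / ((C₂ * Cι + 1) ^ n * K ^ n), C₁ ^ n * (C₂ + 1) ^ n * v, ρ, by positivity, hρ, ?_⟩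
  have hnear : ∀ᶠ x in 𝓝 x₀, dist (ι x) (ι x₀) < ρ :=
    (hι.isEmbedding.continuous.tendsto x₀).eventually (Metric.ball_mem_nhds _ hρ)
  filter_upwards [hnear, hW (r' / 2) (by positivity)] with x hx hx' r hr hrρ
  have hxW : x ∈ W := hρW x (by linarith)
  constructor
  · have hball : Metric.ball (e x) (r / K) ⊆ T := by
      refine Metric.ball_subset_ball' ?_
      have h1 : dist (e x) (e x₀) < r' / 2 := hx'.2
      have h2 : r / K ≤ r' / 2 := by
        rw [div_le_iff₀ (by positivity)]
        rw [div_le_iff₀ hr'] at hKr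
        nlinarith
      linarith
    have hsubB : e.symm '' Metric.ball (e x) (r / K) ⊆ iball ι x r := by
      rintro _ ⟨a, ha, rfl⟩
      have h1 : edist (ι (e.symm (e x))) (ι (e.symm a)) ≤ Cι * (C₁ * edist (e x) a) := by
        refine (hL _ _).trans ?_
        gcongr
        exact hlipT hxW.2 (hball ha)
      rw [e.left_inv hxW.1, edist_nndist, edist_nndist] at h1
      have h2 : dist (ι x) (ι (e.symm a)) ≤ Cι * (C₁ * dist (e x) a) := by exact_mod_cast h1
      have h3 : dist (e x) a < r / K := by rw [dist_comm]; exact ha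
      rw [lt_div_iff₀ (by positivity)] at h3
      have h4 : (Cι * C₁ : ℝ) ≤ K := by
        simp only [K, NNReal.coe_add, NNReal.coe_mul, NNReal.coe_one]
        have := Real.toNNReal (2 * ρ / r') |>.2
        have h2 := NNReal.coe_nonneg (Real.toNNReal (2 * ρ / r'))
        linarith
      have h5 : (Cι * C₁ : ℝ) * dist (e x) a ≤ K * dist (e x) a := by gcongr
      show dist (ι x) (ι (e.symm a)) < r
      nlinarith
    have hlipe : LipschitzOnWith (C₂ * Cι + 1) e (e.symm '' Metric.ball (e x) (r / K)) := by
      rintro _ ⟨a, ha, rfl⟩ _ ⟨b, hb, rfl⟩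
      have haU := hr₂U (hT₂ (hball ha))
      have hbU := hr₂U (hT₂ (hball hb))
      refine (hCU _ haU _ hbU).trans ?_
      calc (C₂ : ℝ≥0∞) * edist (ι (e.symm a)) (ι (e.symm b))
          ≤ C₂ * (Cι * edist (e.symm a) (e.symm b)) := by gcongr; exact hL _ _
        _ ≤ ((C₂ * Cι + 1 : ℝ≥0) : ℝ≥0∞) * edist (e.symm a) (e.symm b) := by
          rw [← mul_assoc]; gcongr; simp
    have himg : e '' (e.symm '' Metric.ball (e x) (r / K)) = Metric.ball (e x) (r / K) :=
      e.image_symm_image_of_subset_target ((hball.trans hT₁).trans hsub)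
    have h1 := euclideanHausdorffMeasure_image_le (n := n) hlipe
    rw [himg, euclideanHausdorffMeasure_ball _ (by positivity)] at h1
    have h2 := h1.trans (mul_le_mul_right (measure_mono hsubB) _)
    rw [ENNReal.coe_div (by positivity), ENNReal.ofReal_div_of_pos (by positivity)] at *
    rw [← ENNReal.mul_div_right_comm]
    refine ENNReal.div_le_of_le_mul ?_
    rw [ENNReal.coe_mul, ENNReal.coe_pow, ENNReal.coe_pow]
    calc (v : ℝ≥0∞) * ENNReal.ofReal r ^ n
        = (ENNReal.ofReal r / ENNReal.ofReal K) ^ n * v * (K : ℝ≥0∞) ^ n := by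
          rw [ENNReal.ofReal_coe_nnreal, mul_right_comm, ← mul_pow, ENNReal.div_mul_cancel
            (by simpa using hK.ne') (by simp), mul_comm]
      _ ≤ _ := by
          refine (mul_le_mul_left h2 _).trans (le_of_eq ?_)
          ring
  · have hsubB : iball ι x r ⊆ e.symm '' (T ∩ Metric.ball (e x) ((C₂ + 1) * r)) := by
      intro y hy
      have hy' : dist (ι x) (ι y) < r := hy
      have hyW : y ∈ W := by
        refine hρW y ?_
        have := dist_triangle (ι y) (ι x) (ι x₀)
        rw [dist_comm (ι y) (ι x)] at this
        linarith
      refine ⟨e y, ⟨hyW.2, ?_⟩, e.left_inv hyW.1⟩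
      have h1 := hCU _ (hWU hxW) _ (hWU hyW)
      rw [edist_nndist, edist_nndist] at h1
      have h2 : dist (e x) (e y) ≤ C₂ * dist (ι x) (ι y) := by exact_mod_cast h1
      rw [Metric.mem_ball, dist_comm]
      have : (C₂ : ℝ) * dist (ι x) (ι y) ≤ C₂ * r := by gcongr
      linarith
    calc (μHE[n] : Measure S) (iball ι x r)
        ≤ (μHE[n] : Measure S) (e.symm '' (T ∩ Metric.ball (e x) ((C₂ + 1) * r))) :=
          measure_mono hsubB
      _ ≤ (C₁ : ℝ≥0∞) ^ n * (μHE[n] : Measure (EuclideanSpace ℝ (Fin n)))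
            (T ∩ Metric.ball (e x) ((C₂ + 1) * r)) :=
          euclideanHausdorffMeasure_image_le (hlipT.mono inter_subset_left)
      _ ≤ (C₁ : ℝ≥0∞) ^ n * (μHE[n] : Measure (EuclideanSpace ℝ (Fin n)))
            (Metric.ball (e x) ((C₂ + 1) * r)) := by gcongr; exact inter_subset_right
      _ = _ := by
          rw [euclideanHausdorffMeasure_ball _ (by positivity),
            ENNReal.ofReal_mul (by positivity), mul_pow]
          have : ENNReal.ofReal ((C₂ : ℝ) + 1) = ((C₂ + 1 : ℝ≥0) : ℝ≥0∞) := by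
            rw [← ENNReal.ofReal_coe_nnreal]; simp
          rw [this]
          push_cast
          ring

theorem exists_isAhlfors [CompactSpace S] [IsRiemannianManifold (𝓡 n) S]
    {ι : S → EuclideanSpace ℝ (Fin L)}
    (hι : IsSmoothEmbedding (𝓡 n) 𝓘(ℝ, EuclideanSpace ℝ (Fin L)) ∞ ι) {Cι : ℝ≥0}
    (hL : LipschitzWith Cι ι) :
    IsFiniteMeasure (μHE[n] : Measure S) ∧ ∃ c C, IsAhlfors n ι (μHE[n] : Measure S) c C := by
  choose c C ρ hc hρ h using fun x₀ => eventually_ahlfors hι hL x₀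
  obtain ⟨t, -, ht⟩ := isCompact_univ.elim_nhds_subcover _ (fun x _ =>
    inter_mem (h x) ((hι.isEmbedding.continuous.tendsto x).eventually
      (Metric.ball_mem_nhds _ (hρ x))))
  have hcov : ∀ y, ∃ x ∈ t, (∀ r, 0 < r → r ≤ ρ x →
      c x * ENNReal.ofReal r ^ n ≤ (μHE[n] : Measure S) (iball ι y r) ∧
      (μHE[n] : Measure S) (iball ι y r) ≤ C x * ENNReal.ofReal r ^ n) ∧
      dist (ι y) (ι x) < ρ x := by
    intro y
    obtain ⟨x, hx, hy⟩ := mem_iUnion₂.1 (ht (mem_univ y))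
    exact ⟨x, hx, hy.1, hy.2⟩
  have hfin : IsFiniteMeasure (μHE[n] : Measure S) := by
    constructor
    have hu : (univ : Set S) ⊆ ⋃ x ∈ t, iball ι x (ρ x) := by
      intro y _
      obtain ⟨x, hx, -, hy⟩ := hcov y
      exact mem_iUnion₂.2 ⟨x, hx, by rw [dist_comm] at hy; exact hy⟩
    refine (measure_mono hu).trans_lt ((measure_biUnion_finset_le _ _).trans_lt ?_)
    refine ENNReal.sum_lt_top.2 fun x _ => ?_
    refine ((h x).self_of_nhds (ρ x) (hρ x) le_rfl).2.trans_lt ?_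
    exact ENNReal.mul_lt_top (by simp) (ENNReal.pow_lt_top (by simp))
  refine ⟨hfin, ?_⟩
  rcases isEmpty_or_nonempty S with hS | hS
  · exact ⟨1, 0, one_pos, fun x => (hS.false x).elim, fun x => (hS.false x).elim⟩
  have htne : t.Nonempty := by
    obtain ⟨x, hx, -⟩ := hcov hS.some
    exact ⟨x, hx⟩
  obtain ⟨x₁, -, hρmin⟩ := t.exists_min_image ρ htne
  obtain ⟨x₂, -, hcmin⟩ := t.exists_min_image c htne
  set ρ₀ := min (ρ x₁) 1
  have hρ₀ : 0 < ρ₀ := lt_min (hρ _) one_pos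
  set V := ((μHE[n] : Measure S) univ).toNNReal
  -- The local bounds hold only up to radius `ρ₀`. The lower bound is therefore applied at radius
  -- `ρ₀ * r`, and the upper bound beyond `ρ₀` comes from the total mass `V`.
  refine ⟨c x₂ * (ρ₀.toNNReal) ^ n, (∑ x ∈ t, C x) + V / (ρ₀.toNNReal) ^ n, ?_, ?_, ?_⟩
  · have := hc x₂
    have h2 : 0 < ρ₀.toNNReal := by simpa using hρ₀
    positivity
  · intro y r hr hr1
    obtain ⟨x, hx, hy, -⟩ := hcov y
    have hle : ρ₀ * r ≤ ρ x := by
      have h1 : ρ₀ * r ≤ ρ₀ * 1 := by gcongr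
      have h2 : ρ₀ ≤ ρ x₁ := min_le_left _ _
      linarith [hρmin x hx]
    have hle' : ρ₀ * r ≤ r := by
      have : ρ₀ * r ≤ 1 * r := by gcongr; exact min_le_right _ _
      linarith
    calc ((c x₂ * (ρ₀.toNNReal) ^ n : ℝ≥0) : ℝ≥0∞) * ENNReal.ofReal r ^ n
        = c x₂ * ENNReal.ofReal (ρ₀ * r) ^ n := by
          rw [ENNReal.ofReal_mul hρ₀.le]
          push_cast
          rw [mul_pow, mul_assoc]
          rfl
      _ ≤ c x * ENNReal.ofReal (ρ₀ * r) ^ n := by gcongr; exact hcmin x hx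
      _ ≤ _ := (hy _ (by positivity) hle).1
      _ ≤ _ := measure_mono fun z hz => lt_of_lt_of_le hz hle'
  · intro y r hr
    obtain ⟨x, hx, hy, -⟩ := hcov y
    push_cast
    rw [add_mul]
    rcases le_or_gt r ρ₀ with hrρ | hrρ
    · refine le_add_right ((hy r hr ?_).2.trans ?_)
      · exact hrρ.trans ((min_le_left _ _).trans (hρmin x hx))
      · gcongr
        exact_mod_cast Finset.single_le_sum (f := C) (fun _ _ => zero_le) hx
    · refine le_add_left ((measure_mono (subset_univ _)).trans ?_)
      have h2 : 0 < ρ₀.toNNReal := by simpa using hρ₀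
      have h3 : (μHE[n] : Measure S) univ = V := (ENNReal.coe_toNNReal (measure_ne_top _ _)).symm
      have h4 : (((ρ₀.toNNReal) ^ n : ℝ≥0) : ℝ≥0∞) ≠ 0 :=
        ENNReal.coe_ne_zero.2 (pow_ne_zero _ h2.ne')
      rw [h3, ENNReal.coe_div (by positivity), ← ENNReal.mul_div_right_comm,
        ENNReal.le_div_iff_mul_le (Or.inl h4)
          (by left; simp)]
      gcongr
      push_cast
      gcongr
      exact ENNReal.ofReal_le_ofReal hrρ.le

end Ahlfors

end FractionalHarmonic

/-! ### Singular kernels and Jensen's inequality -/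

namespace FractionalHarmonic

section Kernel

variable {X : Type*} [MeasurableSpace X] {L n : ℕ} {ι : X → EuclideanSpace ℝ (Fin L)}
  {μ : Measure X} {c C : ℝ≥0}

theorem measurable_dist_map (hι : Measurable ι) (x : X) : Measurable fun y => dist (ι x) (ι y) :=
  measurable_const.dist hι

theorem measurableSet_iball (hι : Measurable ι) (x : X) (r : ℝ) : MeasurableSet (iball ι x r) :=
  measurableSet_lt (measurable_dist_map hι x) measurable_const

theorem setLIntegral_le_const_mul {s : Set X} (hs : MeasurableSet s) {f : X → ℝ≥0∞} {b : ℝ≥0∞}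
    (h : ∀ x ∈ s, f x ≤ b) : ∫⁻ x in s, f x ∂μ ≤ b * μ s := by
  calc ∫⁻ x in s, f x ∂μ ≤ ∫⁻ _ in s, b ∂μ := setLIntegral_mono' hs h
    _ = b * μ s := by simp

/-- Singular kernels of positive order are integrable near the diagonal. -/
theorem exists_lintegral_near_le (hι : Measurable ι) (hA : IsAhlfors n ι μ c C) {κ : ℝ}
    (hκ : 0 < κ) {p : ℝ} :
    ∃ K : ℝ≥0, ∀ a : ℝ, 0 ≤ a → a + κ ≤ p → ∀ x h, 0 < h →
      ∫⁻ y in iball ι x h, ENNReal.ofReal (dist (ι x) (ι y) ^ p / dist (ι x) (ι y) ^ (n + a)) ∂μ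
        ≤ K * ENNReal.ofReal (h ^ (p - a)) := by
  -- Each dyadic annulus contributes a factor `(1 / 2) ^ (p - a)` relative to the previous one.
  -- Bounding it by `b`, which is possible as `κ ≤ p - a`, makes the constant independent of `a`.
  set b : ℝ := (1 / 2 : ℝ) ^ κ
  have hb0 : 0 ≤ b := by positivity
  have hb1 : b < 1 := Real.rpow_lt_one (by norm_num) (by norm_num) hκ
  have hsum : ∑' k : ℕ, ENNReal.ofReal b ^ k ≠ ⊤ := by
    rw [ENNReal.tsum_geometric]
    simp [tsub_eq_zero_iff_le, hb1]
  refine ⟨2 ^ n * 2 ^ n * C * (∑' k : ℕ, ENNReal.ofReal b ^ k).toNNReal, fun a ha hap x h hh => ?_⟩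
  set D := fun y => dist (ι x) (ι y)
  have hD : Measurable D := measurable_dist_map hι x
  set A : ℕ → Set X := fun k => {y | (1 / 2 : ℝ) ^ (k + 1) * h ≤ D y ∧ D y ≤ (1 / 2 : ℝ) ^ k * h}
  have hAm : ∀ k, MeasurableSet (A k) := fun k =>
    (measurableSet_le measurable_const hD).inter (measurableSet_le hD measurable_const)
  have hcov : iball ι x h ⊆ {y | D y = 0} ∪ ⋃ k, A k := by
    intro y hy
    rcases eq_or_lt_of_le (dist_nonneg : 0 ≤ D y) with h0 | h0
    · exact Or.inl h0.symm
    · right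
      obtain ⟨k, hk1, hk2⟩ := exists_nat_pow_near_of_lt_one (x := D y / h) (y := (1 / 2 : ℝ))
        (by positivity) (by rw [div_le_one hh]; exact le_of_lt hy) (by norm_num) (by norm_num)
      exact mem_iUnion.2 ⟨k, ((lt_div_iff₀ hh).1 hk1).le, (div_le_iff₀ hh).1 hk2⟩
  have hk : ∀ k, ∫⁻ y in A k, ENNReal.ofReal (D y ^ p / D y ^ (n + a)) ∂μ ≤
      2 ^ n * 2 ^ n * C * ENNReal.ofReal (h ^ (p - a)) * ENNReal.ofReal b ^ k := by
    intro k
    have h1 : ∀ y ∈ A k, ENNReal.ofReal (D y ^ p / D y ^ (n + a)) ≤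
        ENNReal.ofReal (h ^ (p - a) * b ^ k * (2 ^ n / ((1 / 2 : ℝ) ^ k * h) ^ n)) := by
      rintro y ⟨hy1, hy2⟩
      apply ENNReal.ofReal_le_ofReal
      have hy0 : 0 < D y := lt_of_lt_of_le (by positivity) hy1
      have e1 : D y ^ p / D y ^ (n + a) = D y ^ (p - a) / D y ^ n := by
        rw [← Real.rpow_natCast, ← Real.rpow_sub hy0, ← Real.rpow_sub hy0]
        congr 1; ring
      have e2 : D y ^ (p - a) ≤ h ^ (p - a) * b ^ k := by
        calc D y ^ (p - a) ≤ ((1 / 2 : ℝ) ^ k * h) ^ (p - a) :=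
              Real.rpow_le_rpow hy0.le hy2 (by linarith)
          _ = h ^ (p - a) * ((1 / 2 : ℝ) ^ k) ^ (p - a) := by
              rw [Real.mul_rpow (by positivity) hh.le, mul_comm]
          _ ≤ h ^ (p - a) * ((1 / 2 : ℝ) ^ k) ^ κ := by
              gcongr ?_ * ?_
              exact Real.rpow_le_rpow_of_exponent_ge (by positivity)
                (pow_le_one₀ (by norm_num) (by norm_num)) (by linarith)
          _ = h ^ (p - a) * b ^ k := by
              simp only [b]
              rw [← Real.rpow_natCast, ← Real.rpow_natCast, ← Real.rpow_mul (by norm_num),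
                ← Real.rpow_mul (by norm_num), mul_comm κ]
      have e3 : 1 / D y ^ n ≤ 2 ^ n / ((1 / 2 : ℝ) ^ k * h) ^ n := by
        rw [div_le_div_iff₀ (by positivity) (by positivity), one_mul, ← mul_pow]
        refine pow_le_pow_left₀ (by positivity) ?_ n
        rw [pow_succ] at hy1
        linarith
      rw [e1, div_eq_mul_one_div]
      gcongr
    refine (setLIntegral_le_const_mul (hAm k) h1).trans ?_
    have h2 : μ (A k) ≤ C * ENNReal.ofReal (2 * ((1 / 2 : ℝ) ^ k * h)) ^ n :=
      (measure_mono fun y hy => show D y < _ from hy.2.trans_lt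
        (lt_two_mul_self (by positivity))).trans (hA.measure_le x _ (by positivity))
    calc _ ≤ ENNReal.ofReal (h ^ (p - a) * b ^ k * (2 ^ n / ((1 / 2 : ℝ) ^ k * h) ^ n)) *
          (C * ENNReal.ofReal (2 * ((1 / 2 : ℝ) ^ k * h)) ^ n) := by gcongr
      _ = C * (ENNReal.ofReal (h ^ (p - a) * b ^ k * 2 ^ n * 2 ^ n)) := by
        rw [mul_left_comm, ← ENNReal.ofReal_pow (by positivity), ← ENNReal.ofReal_mul (by positivity)]
        congr 2
        rw [mul_pow 2 _ n]
        field_simp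
      _ = _ := by
        rw [ENNReal.ofReal_mul (by positivity), ENNReal.ofReal_mul (by positivity),
          ENNReal.ofReal_mul (by positivity),
          ENNReal.ofReal_pow (by positivity), ENNReal.ofReal_pow (by positivity)]
        simp only [ENNReal.ofReal_ofNat]
        ring
  calc ∫⁻ y in iball ι x h, ENNReal.ofReal (D y ^ p / D y ^ (n + a)) ∂μ
      ≤ ∫⁻ y in {y | D y = 0} ∪ ⋃ k, A k, ENNReal.ofReal (D y ^ p / D y ^ (n + a)) ∂μ :=
        lintegral_mono_set hcov
    _ ≤ (∫⁻ y in {y | D y = 0}, ENNReal.ofReal (D y ^ p / D y ^ (n + a)) ∂μ) +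
        ∫⁻ y in ⋃ k, A k, ENNReal.ofReal (D y ^ p / D y ^ (n + a)) ∂μ := lintegral_union_le _ _ _
    _ ≤ 0 * μ {y | D y = 0} +
        ∑' k, 2 ^ n * 2 ^ n * C * ENNReal.ofReal (h ^ (p - a)) * ENNReal.ofReal b ^ k := by
        gcongr
        -- On the diagonal the integrand is `0` by the conventions for `0 ^ p` and division, so no
        -- information on the measure of this set is needed.
        · refine setLIntegral_le_const_mul (hD (measurableSet_singleton 0)) fun y hy => ?_
          have hy : D y = 0 := hy
          rw [hy, Real.zero_rpow (by linarith : p ≠ 0)]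
          simp
        · exact (lintegral_iUnion_le _ _).trans (ENNReal.tsum_le_tsum hk)
    _ = _ := by
        rw [zero_mul, zero_add, ENNReal.tsum_mul_left]
        push_cast
        rw [ENNReal.coe_toNNReal hsum]
        ring

/-- Singular kernels of negative order are integrable away from the diagonal. -/
theorem exists_lintegral_far_le (hn : 1 ≤ n) (hι : Measurable ι) (hA : IsAhlfors n ι μ c C) :
    ∃ K : ℝ≥0, ∀ a : ℝ, n ≤ a → ∀ x h, 0 < h →
      ∫⁻ y in (iball ι x h)ᶜ, ENNReal.ofReal (1 / dist (ι x) (ι y) ^ (n + a)) ∂μ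
        ≤ K * ENNReal.ofReal (1 / h ^ a) := by
  -- The ratio between consecutive dyadic annuli is `2 ^ (-a)`, at most `1 / 2` since `1 ≤ n ≤ a`;
  -- again the constant does not depend on `a`.
  set b : ℝ := (1 / 2 : ℝ)
  have hsum : ∑' k : ℕ, ENNReal.ofReal b ^ k ≠ ⊤ := by
    rw [ENNReal.tsum_geometric]
    simp [b]
  refine ⟨2 ^ n * C * (∑' k : ℕ, ENNReal.ofReal b ^ k).toNNReal, fun a ha x h hh => ?_⟩
  set D := fun y => dist (ι x) (ι y)
  have hD : Measurable D := measurable_dist_map hι x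
  set A : ℕ → Set X := fun k => {y | (2 : ℝ) ^ k * h ≤ D y ∧ D y < (2 : ℝ) ^ (k + 1) * h}
  have hAm : ∀ k, MeasurableSet (A k) := fun k =>
    (measurableSet_le measurable_const hD).inter (measurableSet_lt hD measurable_const)
  have hcov : (iball ι x h)ᶜ ⊆ ⋃ k, A k := by
    intro y hy
    have hy : h ≤ D y := not_lt.1 hy
    obtain ⟨k, hk1, hk2⟩ := exists_nat_pow_near (x := D y / h) (y := (2 : ℝ))
      ((one_le_div hh).2 hy) (by norm_num)
    exact mem_iUnion.2 ⟨k, (le_div_iff₀ hh).1 hk1, (div_lt_iff₀ hh).1 hk2⟩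
  have hk : ∀ k, ∫⁻ y in A k, ENNReal.ofReal (1 / D y ^ (n + a)) ∂μ ≤
      2 ^ n * C * ENNReal.ofReal (1 / h ^ a) * ENNReal.ofReal b ^ k := by
    intro k
    have h1 : ∀ y ∈ A k, ENNReal.ofReal (1 / D y ^ (n + a)) ≤
        ENNReal.ofReal (1 / h ^ a * b ^ k * (1 / ((2 : ℝ) ^ k * h) ^ n)) := by
      rintro y ⟨hy1, hy2⟩
      apply ENNReal.ofReal_le_ofReal
      have hy0 : 0 < D y := lt_of_lt_of_le (by positivity) hy1
      have e1 : 1 / D y ^ (n + a) = 1 / D y ^ a * (1 / D y ^ n) := by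
        rw [Real.rpow_add hy0, Real.rpow_natCast]
        field_simp
      have e2 : 1 / D y ^ a ≤ 1 / h ^ a * b ^ k := by
        have : h ^ a * 2 ^ k ≤ D y ^ a := by
          calc h ^ a * 2 ^ k = h ^ a * ((2 : ℝ) ^ k) ^ (1 : ℝ) := by rw [Real.rpow_one]
            _ ≤ h ^ a * ((2 : ℝ) ^ k) ^ a := by
              gcongr ?_ * ?_
              refine Real.rpow_le_rpow_of_exponent_le (one_le_pow₀ (by norm_num)) ?_
              have : (1 : ℝ) ≤ n := by exact_mod_cast hn
              linarith
            _ = ((2 : ℝ) ^ k * h) ^ a := by rw [Real.mul_rpow (by positivity) hh.le, mul_comm]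
            _ ≤ _ := Real.rpow_le_rpow (by positivity) hy1 (le_trans (by positivity) ha)
        calc 1 / D y ^ a ≤ 1 / (h ^ a * 2 ^ k) := by gcongr
          _ = _ := by simp only [b]; rw [div_pow, one_pow]; field_simp
      rw [e1]
      gcongr
    refine (setLIntegral_le_const_mul (hAm k) h1).trans ?_
    have h2 : μ (A k) ≤ C * ENNReal.ofReal ((2 : ℝ) ^ (k + 1) * h) ^ n :=
      (measure_mono fun y hy => hy.2).trans (hA.measure_le x _ (by positivity))
    calc _ ≤ ENNReal.ofReal (1 / h ^ a * b ^ k * (1 / ((2 : ℝ) ^ k * h) ^ n)) *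
          (C * ENNReal.ofReal ((2 : ℝ) ^ (k + 1) * h) ^ n) := by gcongr
      _ = C * (ENNReal.ofReal (1 / h ^ a * b ^ k * 2 ^ n)) := by
        rw [mul_left_comm, ← ENNReal.ofReal_pow (by positivity), ← ENNReal.ofReal_mul (by positivity)]
        congr 2
        rw [pow_succ, mul_pow, mul_pow, mul_pow]
        field_simp
      _ = _ := by
        rw [ENNReal.ofReal_mul (by positivity), ENNReal.ofReal_mul (by positivity),
          ENNReal.ofReal_pow (by positivity), ENNReal.ofReal_pow (by positivity)]
        simp only [ENNReal.ofReal_ofNat]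
        ring
  calc ∫⁻ y in (iball ι x h)ᶜ, ENNReal.ofReal (1 / D y ^ (n + a)) ∂μ
      ≤ ∫⁻ y in ⋃ k, A k, ENNReal.ofReal (1 / D y ^ (n + a)) ∂μ :=
        lintegral_mono_set hcov
    _ ≤ ∑' k, 2 ^ n * C * ENNReal.ofReal (1 / h ^ a) * ENNReal.ofReal b ^ k :=
        (lintegral_iUnion_le _ _).trans (ENNReal.tsum_le_tsum hk)
    _ = _ := by
        rw [ENNReal.tsum_mul_left]
        push_cast
        rw [ENNReal.coe_toNNReal hsum]
        ring

/-- Jensen's inequality for the power `p`, without normalization. -/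
theorem rpow_setLIntegral_le {p : ℝ} (hp : 1 < p) {s : Set X} {f : X → ℝ≥0∞}
    (hf : AEMeasurable f (μ.restrict s)) :
    (∫⁻ x in s, f x ∂μ) ^ p ≤ μ s ^ (p - 1) * ∫⁻ x in s, f x ^ p ∂μ := by
  have hpq := Real.HolderConjugate.conjExponent hp
  have h := ENNReal.lintegral_mul_le_Lp_mul_Lq (μ.restrict s) hpq hf
    (aemeasurable_const (b := (1 : ℝ≥0∞)))
  simp only [Pi.mul_apply, mul_one, ENNReal.one_rpow, lintegral_const, Measure.restrict_apply,
    MeasurableSet.univ, univ_inter, one_mul] at h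
  have hp0 : 0 < p := by linarith
  calc (∫⁻ x in s, f x ∂μ) ^ p
      ≤ ((∫⁻ x in s, f x ^ p ∂μ) ^ (1 / p) * μ s ^ (1 / p.conjExponent)) ^ p := by gcongr
    _ = _ := by
      rw [ENNReal.mul_rpow_of_nonneg _ _ hp0.le, ← ENNReal.rpow_mul, ← ENNReal.rpow_mul,
        one_div_mul_cancel hp0.ne', ENNReal.rpow_one, mul_comm]
      congr 2
      rw [one_div, inv_mul_eq_div, hpq.div_conj_eq_sub_one]

end Kernel

end FractionalHarmonic

/-! ### Averages at a variable scale -/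

namespace FractionalHarmonic

section Average

set_option linter.unusedSectionVars false

variable {X : Type*} [MeasurableSpace X] {L M n : ℕ} {ι : X → EuclideanSpace ℝ (Fin L)}
  {μ : Measure X} [IsFiniteMeasure μ] {c C : ℝ≥0}

theorem IsAhlfors.le_measureReal (hA : IsAhlfors n ι μ c C) (x : X) {r : ℝ} (hr : 0 < r)
    (hr1 : r ≤ 1) : c * r ^ n ≤ μ.real (iball ι x r) := by
  have h := ENNReal.toReal_mono (measure_ne_top μ _) (hA.le_measure x r hr hr1)
  rwa [ENNReal.toReal_mul, ENNReal.toReal_pow, ENNReal.toReal_ofReal hr.le] at h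

theorem IsAhlfors.measureReal_le (hA : IsAhlfors n ι μ c C) (x : X) {r : ℝ} (hr : 0 < r) :
    μ.real (iball ι x r) ≤ C * r ^ n := by
  have h := ENNReal.toReal_mono (by finiteness) (hA.measure_le x r hr)
  rwa [ENNReal.toReal_mul, ENNReal.toReal_pow, ENNReal.toReal_ofReal hr.le] at h

/-- Tent function of radius `h x` centred at `x`. -/
noncomputable def tent (ι : X → EuclideanSpace ℝ (Fin L)) (h : X → ℝ) (x z : X) : ℝ :=
  max 0 (h x - dist (ι x) (ι z))

/-- Average of `u` at the variable scale `h`; the value is `u x` where `h` vanishes. -/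
noncomputable def tentAvg (ι : X → EuclideanSpace ℝ (Fin L)) (μ : Measure X) (h : X → ℝ)
    (u : X → EuclideanSpace ℝ (Fin M)) (x : X) : EuclideanSpace ℝ (Fin M) :=
  if h x = 0 then u x else (∫ z, tent ι h x z ∂μ)⁻¹ • ∫ z, tent ι h x z • u z ∂μ

/-- Admissible scale functions. -/
structure IsScale (ι : X → EuclideanSpace ℝ (Fin L)) (h : X → ℝ) : Prop where
  measurable : Measurable h
  nonneg : ∀ x, 0 ≤ h x
  le_one : ∀ x, h x ≤ 1
  lip : ∀ x y, |h x - h y| ≤ dist (ι x) (ι y) / 8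

variable {h : X → ℝ}

theorem tent_nonneg (x z : X) : 0 ≤ tent ι h x z := le_max_left _ _

theorem IsScale.tent_le (hh : IsScale ι h) (x z : X) : tent ι h x z ≤ h x :=
  max_le (hh.nonneg x) (by linarith [dist_nonneg (x := ι x) (y := ι z)])

theorem tent_eq_zero {x z : X} (hz : z ∉ iball ι x (h x)) : tent ι h x z = 0 := by
  have : h x ≤ dist (ι x) (ι z) := not_lt.1 hz
  exact max_eq_left (by linarith)

theorem IsScale.abs_tent_sub_le (hh : IsScale ι h) (x y z : X) :
    |tent ι h x z - tent ι h y z| ≤ 2 * dist (ι x) (ι y) := by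
  have h1 := abs_max_sub_max_le_abs (h x - dist (ι x) (ι z)) (h y - dist (ι y) (ι z)) 0
  rw [max_comm _ (0 : ℝ), max_comm _ (0 : ℝ)] at h1
  refine h1.trans ?_
  have h2 := abs_dist_sub_le (ι x) (ι y) (ι z)
  have h3 := hh.lip x y
  rw [abs_le] at *
  have := dist_nonneg (x := ι x) (y := ι y)
  constructor <;> linarith [h2.1, h2.2, h3.1, h3.2]

theorem measurable_tent (hι : Measurable ι) (hh : IsScale ι h) :
    Measurable fun q : X × X => tent ι h q.1 q.2 :=
  measurable_const.max ((hh.measurable.comp measurable_fst).sub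
    ((hι.comp measurable_fst).dist (hι.comp measurable_snd)))

theorem measurable_tent_right (hι : Measurable ι) (hh : IsScale ι h) (x : X) :
    Measurable (tent ι h x) := (measurable_tent hι hh).comp measurable_prodMk_left

theorem integrable_tent_smul (hι : Measurable ι) (hh : IsScale ι h)
    {u : X → EuclideanSpace ℝ (Fin M)} (hu : Integrable u μ) (x : X) :
    Integrable (fun z => tent ι h x z • u z) μ := by
  refine hu.bdd_smul (h x) (measurable_tent_right hι hh x).aestronglyMeasurable ?_
  refine Eventually.of_forall fun z => ?_
  rw [Real.norm_of_nonneg (tent_nonneg x z)]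
  exact hh.tent_le x z

theorem integrable_tent (hι : Measurable ι) (hh : IsScale ι h) (x : X) :
    Integrable (tent ι h x) μ := by
  refine Integrable.of_bound (measurable_tent_right hι hh x).aestronglyMeasurable (h x) ?_
  refine Eventually.of_forall fun z => ?_
  rw [Real.norm_of_nonneg (tent_nonneg x z)]
  exact hh.tent_le x z

theorem le_integral_tent (hι : Measurable ι) (hA : IsAhlfors n ι μ c C) (hh : IsScale ι h) {x : X}
    (hx : 0 < h x) : c / 2 ^ (n + 1) * h x ^ (n + 1) ≤ ∫ z, tent ι h x z ∂μ := by
  have h1 : μ.real (iball ι x (h x / 2)) * (h x / 2) ≤ ∫ z, tent ι h x z ∂μ := by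
    rw [← smul_eq_mul, ← setIntegral_const]
    calc ∫ _ in iball ι x (h x / 2), h x / 2 ∂μ ≤ ∫ z in iball ι x (h x / 2), tent ι h x z ∂μ := by
          refine setIntegral_mono_on (integrable_const _) (integrable_tent hι hh x).integrableOn
            (measurableSet_iball hι x _) fun z hz => ?_
          have hz : dist (ι x) (ι z) < h x / 2 := hz
          exact le_max_of_le_right (by linarith)
      _ ≤ ∫ z, tent ι h x z ∂μ := setIntegral_le_integral (integrable_tent hι hh x)
          (Eventually.of_forall (tent_nonneg x))
  refine le_trans ?_ h1
  have h2 := hA.le_measureReal x (r := h x / 2) (by positivity) (by linarith [hh.le_one x])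
  calc c / 2 ^ (n + 1) * h x ^ (n + 1) = c * (h x / 2) ^ n * (h x / 2) := by
        rw [div_pow, pow_succ, pow_succ]; field_simp
    _ ≤ _ := by gcongr

theorem tentAvg_sub (hι : Measurable ι) (hA : IsAhlfors n ι μ c C) (hh : IsScale ι h)
    {u : X → EuclideanSpace ℝ (Fin M)} (hu : Integrable u μ) {x : X} (hx : 0 < h x)
    (e : EuclideanSpace ℝ (Fin M)) :
    tentAvg ι μ h u x - e = (∫ z, tent ι h x z ∂μ)⁻¹ • ∫ z, tent ι h x z • (u z - e) ∂μ := by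
  have hm : 0 < ∫ z, tent ι h x z ∂μ :=
    lt_of_lt_of_le (by have := hA.pos; positivity) (le_integral_tent hι hA hh hx)
  rw [tentAvg, if_neg hx.ne']
  simp_rw [smul_sub]
  rw [integral_sub (integrable_tent_smul hι hh hu x)
    (integrable_tent_smul hι hh (integrable_const e) x), integral_smul_const, smul_sub,
    inv_smul_smul₀ hm.ne']

theorem norm_integral_smul_le {s : Set X} (hs : MeasurableSet s) {f : X → ℝ} {b : ℝ}
    {v : X → EuclideanSpace ℝ (Fin M)} (hv : Integrable v μ) (hf : ∀ z, |f z| ≤ b)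
    (hf0 : ∀ z, z ∉ s → f z = 0) : ‖∫ z, f z • v z ∂μ‖ ≤ b * ∫ z in s, ‖v z‖ ∂μ := by
  rw [← integral_indicator hs, ← integral_const_mul]
  refine norm_integral_le_of_norm_le ((hv.norm.indicator hs).const_mul b)
    (Eventually.of_forall fun z => ?_)
  by_cases hz : z ∈ s
  · rw [indicator_of_mem hz, norm_smul]
    exact mul_le_mul_of_nonneg_right (hf z) (norm_nonneg _)
  · simp [hf0 z hz, hz]

theorem norm_tentAvg_sub_le (hι : Measurable ι) (hA : IsAhlfors n ι μ c C) (hh : IsScale ι h)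
    {u : X → EuclideanSpace ℝ (Fin M)} (hu : Integrable u μ) {x : X} (hx : 0 < h x)
    (e : EuclideanSpace ℝ (Fin M)) :
    ‖tentAvg ι μ h u x - e‖ ≤
      2 ^ (n + 1) / c / h x ^ n * ∫ z in iball ι x (h x), ‖u z - e‖ ∂μ := by
  have hc : (0 : ℝ) < c := hA.pos
  have hm := le_integral_tent hι hA hh hx
  have hm0 : 0 < c / 2 ^ (n + 1) * h x ^ (n + 1) := by positivity
  rw [tentAvg_sub hι hA hh hu hx, norm_smul, norm_inv, Real.norm_of_nonneg (hm0.le.trans hm)]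
  have h1 := norm_integral_smul_le (measurableSet_iball hι x (h x)) (hu.sub (integrable_const e))
    (f := tent ι h x) (b := h x) (fun z => by
      rw [abs_of_nonneg (tent_nonneg x z)]; exact hh.tent_le x z) (fun z hz => tent_eq_zero hz)
  have h2 : 0 ≤ ∫ z in iball ι x (h x), ‖u z - e‖ ∂μ := integral_nonneg fun _ => norm_nonneg _
  calc _ ≤ (c / 2 ^ (n + 1) * h x ^ (n + 1))⁻¹ * (h x * ∫ z in iball ι x (h x), ‖u z - e‖ ∂μ) := by
        gcongr
        exact h1
    _ = _ := by
        rw [pow_succ (h x)]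
        field_simp

/-- The weights are tents rather than indicators so that averages are Lipschitz in the centre, with
constant of order `1 / h x`. The slow variation of `h` makes `h y` comparable to `h x`, so both
tents live in the ball of radius `2 * h x`. -/
theorem norm_tentAvg_sub_tentAvg_le (hι : Measurable ι) (hA : IsAhlfors n ι μ c C)
    (hh : IsScale ι h) {u : X → EuclideanSpace ℝ (Fin M)} (hu : Integrable u μ) {x y : X}
    (hx : 0 < h x) (hxy : dist (ι x) (ι y) ≤ h x / 4) (e : EuclideanSpace ℝ (Fin M)) :
    ‖tentAvg ι μ h u x - tentAvg ι μ h u y‖ ≤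
      (2 ^ (n + 2) / c + C * 2 ^ (4 * n + 5) / c ^ 2) * dist (ι x) (ι y) / h x ^ (n + 1) *
        ∫ z in iball ι x (2 * h x), ‖u z - e‖ ∂μ := by
  have hc : (0 : ℝ) < c := hA.pos
  set D := dist (ι x) (ι y)
  have hD : 0 ≤ D := dist_nonneg
  have hyx := abs_le.1 (hh.lip x y)
  have hy1 : h x / 2 ≤ h y := by linarith
  have hy2 : h y ≤ 3 / 2 * h x := by linarith
  have hy : 0 < h y := by linarith
  have hsub : iball ι x (h x) ⊆ iball ι x (2 * h x) := fun z hz => by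
    have hz : dist (ι x) (ι z) < h x := hz
    show dist (ι x) (ι z) < _
    linarith
  have hsub' : iball ι y (h y) ⊆ iball ι x (2 * h x) := fun z hz => by
    have hz : dist (ι y) (ι z) < h y := hz
    have := dist_triangle (ι x) (ι y) (ι z)
    show dist (ι x) (ι z) < _
    linarith
  set T := ∫ z in iball ι x (2 * h x), ‖u z - e‖ ∂μ
  have hT : 0 ≤ T := integral_nonneg fun _ => norm_nonneg _
  have hs := measurableSet_iball hι x (2 * h x)
  have hmx := le_integral_tent hι hA hh hx
  have hmy := le_integral_tent hι hA hh hy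
  set mx := ∫ z, tent ι h x z ∂μ
  set my := ∫ z, tent ι h y z ∂μ
  set k := (c : ℝ) / 2 ^ (n + 1) * h x ^ (n + 1)
  have hk : 0 < k := by positivity
  have hmx0 : 0 < mx := hk.trans_le hmx
  have hmy' : k / 2 ^ (n + 1) ≤ my := by
    refine le_trans ?_ hmy
    calc k / 2 ^ (n + 1) = c / 2 ^ (n + 1) * (h x / 2) ^ (n + 1) := by
          simp only [k]; rw [div_pow]; field_simp
      _ ≤ _ := by gcongr
  have hmy0 : 0 < my := lt_of_lt_of_le (by positivity) hmy'
  have hv : Integrable (fun z => u z - e) μ := hu.sub (integrable_const e)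
  set Ax := ∫ z, tent ι h x z • (u z - e) ∂μ
  set Ay := ∫ z, tent ι h y z • (u z - e) ∂μ
  have hAxy : ‖Ax - Ay‖ ≤ 2 * D * T := by
    have : Ax - Ay = ∫ z, (tent ι h x z - tent ι h y z) • (u z - e) ∂μ := by
      simp_rw [sub_smul]
      exact (integral_sub (integrable_tent_smul hι hh hv x) (integrable_tent_smul hι hh hv y)).symm
    rw [this]
    refine norm_integral_smul_le hs hv (fun z => hh.abs_tent_sub_le x y z) fun z hz => ?_
    rw [tent_eq_zero fun h' => hz (hsub h'), tent_eq_zero fun h' => hz (hsub' h'), sub_zero]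
  have hAy : ‖Ay‖ ≤ 2 * h x * T := by
    refine norm_integral_smul_le hs hv (fun z => ?_) fun z hz => tent_eq_zero fun h' => hz (hsub' h')
    rw [abs_of_nonneg (tent_nonneg y z)]
    linarith [hh.tent_le y z]
  have hmm : |my - mx| ≤ 2 * D * (C * (2 * h x) ^ n) := by
    have h1 : my - mx = ∫ z, (tent ι h y z - tent ι h x z) ∂μ :=
      (integral_sub (integrable_tent hι hh y) (integrable_tent hι hh x)).symm
    have h2 : ∫ z, (tent ι h y z - tent ι h x z) ∂μ =
        ∫ z in iball ι x (2 * h x), (tent ι h y z - tent ι h x z) ∂μ := by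
      refine (setIntegral_eq_integral_of_forall_compl_eq_zero fun z hz => ?_).symm
      rw [tent_eq_zero fun h' => hz (hsub h'), tent_eq_zero fun h' => hz (hsub' h'), sub_zero]
    rw [h1, h2, ← Real.norm_eq_abs]
    refine (norm_setIntegral_le_of_norm_le_const (measure_lt_top _ _) (C := 2 * D)
      fun z _ => ?_).trans ?_
    · rw [Real.norm_eq_abs, abs_sub_comm]
      exact hh.abs_tent_sub_le x y z
    · gcongr
      exact hA.measureReal_le x (by positivity)
  -- A difference of two quotients `Ax / mx - Ay / my`, split into the change of the numerator and
  -- the change of the mass; both changes are of order `D`.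
  have key : tentAvg ι μ h u x - tentAvg ι μ h u y =
      mx⁻¹ • (Ax - Ay) + ((my - mx) / (mx * my)) • Ay := by
    have h1 : tentAvg ι μ h u x - tentAvg ι μ h u y =
        (tentAvg ι μ h u x - e) - (tentAvg ι μ h u y - e) := by abel
    rw [h1, tentAvg_sub hι hA hh hu hx, tentAvg_sub hι hA hh hu hy]
    have h2 : (my - mx) / (mx * my) = mx⁻¹ - my⁻¹ := by field_simp
    rw [h2, smul_sub, sub_smul]
    abel
  rw [key]
  calc _ ≤ mx⁻¹ * (2 * D * T) + (2 * D * (C * (2 * h x) ^ n)) / (mx * my) * (2 * h x * T) := by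
        refine (norm_add_le _ _).trans ?_
        rw [norm_smul, norm_smul, norm_inv, norm_div, norm_mul, Real.norm_of_nonneg hmx0.le,
          Real.norm_of_nonneg hmy0.le, Real.norm_eq_abs]
        gcongr
    _ ≤ k⁻¹ * (2 * D * T) + (2 * D * (C * (2 * h x) ^ n)) / (k * (k / 2 ^ (n + 1))) *
          (2 * h x * T) := by gcongr
    _ = _ := by
        simp only [k]
        rw [mul_pow]
        field_simp
        ring

theorem measurable_tentAvg (hι : Measurable ι) (hh : IsScale ι h)
    {u : X → EuclideanSpace ℝ (Fin M)} (hu : Measurable u) : Measurable (tentAvg ι μ h u) := by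
  refine Measurable.ite (hh.measurable (measurableSet_singleton 0)) hu ?_
  have h1 : StronglyMeasurable fun x => ∫ z, tent ι h x z ∂μ :=
    StronglyMeasurable.integral_prod_right (measurable_tent hι hh).stronglyMeasurable
  have h2 : StronglyMeasurable fun x => ∫ z, tent ι h x z • u z ∂μ :=
    StronglyMeasurable.integral_prod_right
      ((measurable_tent hι hh).smul (hu.comp measurable_snd)).stronglyMeasurable
  exact h1.measurable.inv.smul h2.measurable

/-- The `p`-th power of a local average is controlled by the average of `p`-th powers. -/
theorem ofReal_setIntegral_rpow_le (hA : IsAhlfors n ι μ c C) {p : ℝ}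
    (hp : 1 < p) {v : X → EuclideanSpace ℝ (Fin M)} (hv : Integrable v μ) (x : X) {R : ℝ}
    (hR : 0 < R) :
    ENNReal.ofReal ((∫ z in iball ι x R, ‖v z‖ ∂μ) ^ p) ≤
      ENNReal.ofReal ((C * R ^ n) ^ (p - 1)) *
        ∫⁻ z in iball ι x R, ENNReal.ofReal (‖v z‖ ^ p) ∂μ := by
  have hp0 : 0 < p := by linarith
  rw [← ENNReal.ofReal_rpow_of_nonneg (integral_nonneg fun _ => norm_nonneg _) hp0.le,
    ofReal_integral_eq_lintegral_ofReal hv.norm.integrableOn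
      (Eventually.of_forall fun _ => norm_nonneg _)]
  refine (rpow_setLIntegral_le hp
    hv.norm.aemeasurable.ennreal_ofReal.restrict).trans ?_
  simp_rw [ENNReal.ofReal_rpow_of_nonneg (norm_nonneg _) hp0.le]
  gcongr
  rw [← ENNReal.ofReal_rpow_of_nonneg (by positivity) (by linarith)]
  refine ENNReal.rpow_le_rpow ?_ (by linarith)
  refine (hA.measure_le x R hR).trans (le_of_eq ?_)
  rw [ENNReal.ofReal_mul (by positivity), ENNReal.ofReal_pow hR.le, ENNReal.ofReal_coe_nnreal]

end Average

end FractionalHarmonic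

/-! ### Energy of the averages against the truncated energy -/

namespace FractionalHarmonic

section AverageEnergy

set_option linter.unusedSectionVars false

variable {X : Type*} [MeasurableSpace X] {L M n : ℕ} {ι : X → EuclideanSpace ℝ (Fin L)}
  {μ : Measure X} [IsFiniteMeasure μ] {c C : ℝ≥0} {h : X → ℝ}

/-- Energy density of `u` at `x`, regularized at scale `h x`. -/
noncomputable def truncDensity (ι : X → EuclideanSpace ℝ (Fin L)) (μ : Measure X) (p q : ℝ)
    (h : X → ℝ) (u : X → EuclideanSpace ℝ (Fin M)) (x : X) : ℝ≥0∞ :=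
  ∫⁻ y, ENNReal.ofReal (‖u x - u y‖ ^ p / max (dist (ι x) (ι y)) (h x) ^ q) ∂μ

theorem setLIntegral_le_truncDensity (hι : Measurable ι) {p q : ℝ} (hq : 0 ≤ q)
    {u : X → EuclideanSpace ℝ (Fin M)} {x : X} (hx : 0 < h x) :
    ∫⁻ z in iball ι x (2 * h x), ENNReal.ofReal (‖u z - u x‖ ^ p) ∂μ ≤
      ENNReal.ofReal ((2 * h x) ^ q) * truncDensity ι μ p q h u x := by
  rw [truncDensity, ← lintegral_const_mul' _ _ ENNReal.ofReal_ne_top]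
  refine (setLIntegral_mono' (measurableSet_iball hι _ _) fun z hz => ?_).trans
    (setLIntegral_le_lintegral _ _)
  have hz : dist (ι x) (ι z) < 2 * h x := hz
  rw [← ENNReal.ofReal_mul (by positivity)]
  refine ENNReal.ofReal_le_ofReal ?_
  have hm : 0 < max (dist (ι x) (ι z)) (h x) := lt_max_of_lt_right hx
  have h1 : max (dist (ι x) (ι z)) (h x) ^ q ≤ (2 * h x) ^ q :=
    Real.rpow_le_rpow hm.le (max_le hz.le (by linarith)) hq
  rw [norm_sub_rev, mul_div_assoc', le_div_iff₀ (by positivity), mul_comm]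
  gcongr

theorem rpow_div_mul_rpow {A B H p : ℝ} (hA : 0 ≤ A) (hB : 0 ≤ B) (hH : 0 < H) :
    (A / H) ^ p * (B * H) ^ (p - 1) = A ^ p * B ^ (p - 1) / H := by
  rw [Real.div_rpow hA hH.le, Real.mul_rpow hB hH.le, Real.rpow_sub_one hH.ne']
  have : H ^ p ≠ 0 := (Real.rpow_pos_of_pos hH p).ne'
  field_simp

theorem exists_tentAvg_sub_rpow_le (hι : Measurable ι) (hA : IsAhlfors n ι μ c C) {p : ℝ}
    (hp : 1 < p) :
    ∃ K : ℝ≥0, ∀ h : X → ℝ, IsScale ι h → ∀ u : X → EuclideanSpace ℝ (Fin M), Integrable u μ →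
      ∀ x, 0 < h x → ∀ e, ENNReal.ofReal (‖tentAvg ι μ h u x - e‖ ^ p) ≤
        K * ENNReal.ofReal (1 / h x ^ n) *
          ∫⁻ z in iball ι x (h x), ENNReal.ofReal (‖u z - e‖ ^ p) ∂μ := by
  have hc : (0 : ℝ) < c := hA.pos
  refine ⟨((2 ^ (n + 1) / c : ℝ) ^ p * (C : ℝ) ^ (p - 1)).toNNReal, fun h hh u hu x hx e => ?_⟩
  have h1 := norm_tentAvg_sub_le hι hA hh hu hx e
  have h2 := ofReal_setIntegral_rpow_le hA hp (hu.sub (integrable_const e)) x hx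
  have h0 : 0 ≤ ∫ z in iball ι x (h x), ‖u z - e‖ ∂μ := integral_nonneg fun _ => norm_nonneg _
  calc ENNReal.ofReal (‖tentAvg ι μ h u x - e‖ ^ p)
      ≤ ENNReal.ofReal ((2 ^ (n + 1) / c / h x ^ n) ^ p *
          (∫ z in iball ι x (h x), ‖u z - e‖ ∂μ) ^ p) := by
        rw [← Real.mul_rpow (by positivity) h0]
        gcongr
    _ ≤ ENNReal.ofReal ((2 ^ (n + 1) / c / h x ^ n) ^ p) *
        (ENNReal.ofReal ((C * h x ^ n) ^ (p - 1)) *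
        ∫⁻ z in iball ι x (h x), ENNReal.ofReal (‖u z - e‖ ^ p) ∂μ) := by
        rw [ENNReal.ofReal_mul (by positivity)]
        gcongr
        exact h2
    _ = _ := by
        rw [← mul_assoc, ← ENNReal.ofReal_mul (by positivity),
          rpow_div_mul_rpow (by positivity) (by positivity) (by positivity), div_eq_mul_one_div,
          ENNReal.ofReal_mul (by positivity)]
        rfl

theorem exists_tentAvg_sub_tentAvg_rpow_le (hι : Measurable ι) (hA : IsAhlfors n ι μ c C) {p : ℝ}
    (hp : 1 < p) :
    ∃ K : ℝ≥0, ∀ h : X → ℝ, IsScale ι h → ∀ u : X → EuclideanSpace ℝ (Fin M), Integrable u μ →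
      ∀ x y, 0 < h x → dist (ι x) (ι y) ≤ h x / 4 → ∀ e,
      ENNReal.ofReal (‖tentAvg ι μ h u x - tentAvg ι μ h u y‖ ^ p) ≤
        K * ENNReal.ofReal (dist (ι x) (ι y) ^ p / h x ^ p / h x ^ n) *
          ∫⁻ z in iball ι x (2 * h x), ENNReal.ofReal (‖u z - e‖ ^ p) ∂μ := by
  have hc : (0 : ℝ) < c := hA.pos
  set k : ℝ := 2 ^ (n + 2) / c + C * 2 ^ (4 * n + 5) / c ^ 2
  have hk : 0 ≤ k := by positivity
  refine ⟨(k ^ p * (C * 2 ^ n : ℝ) ^ (p - 1)).toNNReal, fun h hh u hu x y hx hxy e => ?_⟩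
  have h1 := norm_tentAvg_sub_tentAvg_le hι hA hh hu hx hxy e
  have h2 := ofReal_setIntegral_rpow_le hA hp (hu.sub (integrable_const e)) x
    (R := 2 * h x) (by positivity)
  have h0 : 0 ≤ ∫ z in iball ι x (2 * h x), ‖u z - e‖ ∂μ := integral_nonneg fun _ => norm_nonneg _
  set D := dist (ι x) (ι y)
  have hD : 0 ≤ D := dist_nonneg
  calc ENNReal.ofReal (‖tentAvg ι μ h u x - tentAvg ι μ h u y‖ ^ p)
      ≤ ENNReal.ofReal ((k * D / h x ^ (n + 1)) ^ p *
          (∫ z in iball ι x (2 * h x), ‖u z - e‖ ∂μ) ^ p) := by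
        rw [← Real.mul_rpow (by positivity) h0]
        gcongr
    _ ≤ ENNReal.ofReal ((k * D / h x ^ (n + 1)) ^ p) *
        (ENNReal.ofReal ((C * (2 * h x) ^ n) ^ (p - 1)) *
        ∫⁻ z in iball ι x (2 * h x), ENNReal.ofReal (‖u z - e‖ ^ p) ∂μ) := by
        rw [ENNReal.ofReal_mul (by positivity)]
        gcongr
        exact h2
    _ = _ := by
        have e1 : k * D / h x ^ (n + 1) = (k * D / h x) / h x ^ n := by
          rw [pow_succ]; field_simp
        have e2 : (C : ℝ) * (2 * h x) ^ n = C * 2 ^ n * h x ^ n := by rw [mul_pow]; ring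
        rw [← mul_assoc, ← ENNReal.ofReal_mul (by positivity), e1, e2,
          rpow_div_mul_rpow (by positivity) (by positivity) (by positivity),
          Real.div_rpow (by positivity) hx.le, Real.mul_rpow hk hD]
        have e3 : k ^ p * D ^ p / h x ^ p * (C * 2 ^ n : ℝ) ^ (p - 1) / h x ^ n =
          k ^ p * (C * 2 ^ n : ℝ) ^ (p - 1) * (D ^ p / h x ^ p / h x ^ n) := by ring
        rw [e3, ENNReal.ofReal_mul (by positivity)]
        rfl

theorem two_mul_rpow_div_le {H a p : ℝ} (hH : 0 < H) (hap : a ≤ p) :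
    (2 * H) ^ (n + a) / H ^ n ≤ 2 ^ (n + p) * H ^ a := by
  rw [Real.mul_rpow (by norm_num) hH.le, Real.rpow_add hH, Real.rpow_natCast]
  have : (2 : ℝ) ^ (n + a) ≤ 2 ^ (n + p) :=
    Real.rpow_le_rpow_of_exponent_le (by norm_num) (by linarith)
  calc _ = (2 : ℝ) ^ (n + a) * H ^ a := by field_simp
    _ ≤ _ := by gcongr

/-- The choice `e = u x` turns the oscillation on the ball of radius `h x` into the truncated
density at `x`, because there `max dist h` is comparable to `h x`. The constant is uniform in `a`,
`h` and `u`. -/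
theorem exists_tentAvg_sub_self_le (hι : Measurable ι) (hA : IsAhlfors n ι μ c C) {p : ℝ}
    (hp : 1 < p) :
    ∃ K : ℝ≥0, ∀ a : ℝ, 0 ≤ a → a ≤ p → ∀ h : X → ℝ, IsScale ι h →
      ∀ u : X → EuclideanSpace ℝ (Fin M), Integrable u μ → ∀ x, 0 < h x →
      ENNReal.ofReal (‖tentAvg ι μ h u x - u x‖ ^ p) ≤
        K * ENNReal.ofReal (h x ^ a) * truncDensity ι μ p (n + a) h u x := by
  obtain ⟨K, hK⟩ := exists_tentAvg_sub_rpow_le (M := M) hι hA hp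
  refine ⟨K * ((2 : ℝ) ^ (n + p)).toNNReal, fun a ha hap h hh u hu x hx => ?_⟩
  refine (hK h hh u hu x hx (u x)).trans ?_
  have h1 : ∫⁻ z in iball ι x (h x), ENNReal.ofReal (‖u z - u x‖ ^ p) ∂μ ≤
      ENNReal.ofReal ((2 * h x) ^ (n + a)) * truncDensity ι μ p (n + a) h u x := by
    refine (lintegral_mono_set fun z hz => ?_).trans
      (setLIntegral_le_truncDensity hι (by positivity) hx)
    have hz : dist (ι x) (ι z) < h x := hz
    show dist (ι x) (ι z) < _
    linarith
  calc _ ≤ K * ENNReal.ofReal (1 / h x ^ n) *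
        (ENNReal.ofReal ((2 * h x) ^ (n + a)) * truncDensity ι μ p (n + a) h u x) := by gcongr
    _ = K * ENNReal.ofReal ((2 * h x) ^ (n + a) / h x ^ n) * truncDensity ι μ p (n + a) h u x := by
        rw [show (2 * h x) ^ (n + a) / h x ^ n = 1 / h x ^ n * (2 * h x) ^ (n + a) by ring,
          ENNReal.ofReal_mul (by positivity)]
        ring
    _ ≤ K * ENNReal.ofReal (2 ^ (n + p) * h x ^ a) * truncDensity ι μ p (n + a) h u x := by
        gcongr
        exact two_mul_rpow_div_le hx hap
    _ = _ := by
        rw [ENNReal.ofReal_mul (by positivity)]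
        push_cast
        rw [← mul_assoc]
        rfl

theorem exists_tentAvg_sub_tentAvg_le (hι : Measurable ι) (hA : IsAhlfors n ι μ c C) {p : ℝ}
    (hp : 1 < p) :
    ∃ K : ℝ≥0, ∀ a : ℝ, 0 ≤ a → a ≤ p → ∀ h : X → ℝ, IsScale ι h →
      ∀ u : X → EuclideanSpace ℝ (Fin M), Integrable u μ → ∀ x y, 0 < h x →
      dist (ι x) (ι y) ≤ h x / 4 →
      ENNReal.ofReal (‖tentAvg ι μ h u x - tentAvg ι μ h u y‖ ^ p) ≤
        K * ENNReal.ofReal (dist (ι x) (ι y) ^ p * h x ^ (a - p)) *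
          truncDensity ι μ p (n + a) h u x := by
  obtain ⟨K, hK⟩ := exists_tentAvg_sub_tentAvg_rpow_le (M := M) hι hA hp
  refine ⟨K * ((2 : ℝ) ^ (n + p)).toNNReal, fun a ha hap h hh u hu x y hx hxy => ?_⟩
  refine (hK h hh u hu x y hx hxy (u x)).trans ?_
  have h1 := setLIntegral_le_truncDensity (μ := μ) (p := p) (q := n + a) (u := u) hι
    (by positivity) hx
  set D := dist (ι x) (ι y)
  have hD : 0 ≤ D := dist_nonneg
  calc _ ≤ K * ENNReal.ofReal (D ^ p / h x ^ p / h x ^ n) *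
        (ENNReal.ofReal ((2 * h x) ^ (n + a)) * truncDensity ι μ p (n + a) h u x) := by gcongr
    _ = K * ENNReal.ofReal (D ^ p / h x ^ p * ((2 * h x) ^ (n + a) / h x ^ n)) *
          truncDensity ι μ p (n + a) h u x := by
        rw [mul_div_assoc', mul_div_right_comm, ENNReal.ofReal_mul (by positivity)]; ring
    _ ≤ K * ENNReal.ofReal (D ^ p / h x ^ p * (2 ^ (n + p) * h x ^ a)) *
          truncDensity ι μ p (n + a) h u x := by
        gcongr
        exact two_mul_rpow_div_le hx hap
    _ = _ := by
        have e : D ^ p / h x ^ p * (2 ^ (n + p) * h x ^ a) =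
            2 ^ (n + p) * (D ^ p * h x ^ (a - p)) := by
          rw [Real.rpow_sub hx]; ring
        rw [e, ENNReal.ofReal_mul (by positivity)]
        push_cast
        rw [← mul_assoc]
        rfl

theorem norm_rpow_le_three {F : Type*} [NormedAddCommGroup F] {p : ℝ} (hp : 0 < p) (a b d : F) :
    ‖a + b + d‖ ^ p ≤ 3 ^ p * (‖a‖ ^ p + ‖b‖ ^ p + ‖d‖ ^ p) := by
  set m := max (max ‖a‖ ‖b‖) ‖d‖
  have h1 : ‖a + b + d‖ ≤ 3 * m := by
    have := norm_add₃_le (a := a) (b := b) (c := d)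
    have h2 : ‖a‖ ≤ m := (le_max_left _ _).trans (le_max_left _ _)
    have h3 : ‖b‖ ≤ m := (le_max_right _ _).trans (le_max_left _ _)
    have h4 : ‖d‖ ≤ m := le_max_right _ _
    linarith
  have hm : 0 ≤ m := (norm_nonneg d).trans (le_max_right _ _)
  have h5 : m ^ p ≤ ‖a‖ ^ p + ‖b‖ ^ p + ‖d‖ ^ p := by
    have ha : 0 ≤ ‖a‖ ^ p := by positivity
    have hb : 0 ≤ ‖b‖ ^ p := by positivity
    have hd : 0 ≤ ‖d‖ ^ p := by positivity
    rcases max_choice (max ‖a‖ ‖b‖) ‖d‖ with h | h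
    · rcases max_choice ‖a‖ ‖b‖ with h' | h' <;> simp only [m, h, h'] <;> linarith
    · simp only [m, h]; linarith
  calc ‖a + b + d‖ ^ p ≤ (3 * m) ^ p := by gcongr
    _ = 3 ^ p * m ^ p := Real.mul_rpow (by norm_num) hm
    _ ≤ _ := by gcongr

theorem measurable_one_div_dist_rpow (hι : Measurable ι) (q : ℝ) :
    Measurable fun z : X × X => ENNReal.ofReal (1 / dist (ι z.1) (ι z.2) ^ q) :=
  (measurable_const.div (((hι.comp measurable_fst).dist
    (hι.comp measurable_snd)).pow_const q)).ennreal_ofReal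

/-- Tonelli, exchanging the roles of `x` and `y`. If `dist ≥ h x / 4`, the Lipschitz bound on `h`
gives `h y ≤ (4 + 1 / 8) * dist`, hence `dist ≥ h y / 5`. Points with `h y = 0` drop out because `g`
vanishes there. -/
theorem lintegral_far_le (hι : Measurable ι) {g : X → ℝ≥0∞} (hg : Measurable g)
    (hh : IsScale ι h) (hg0 : ∀ y, h y = 0 → g y = 0) (q : ℝ) :
    ∫⁻ x in {x | 0 < h x}, ∫⁻ y in (iball ι x (h x / 4))ᶜ,
        g y * ENNReal.ofReal (1 / dist (ι x) (ι y) ^ q) ∂μ ∂μ ≤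
      ∫⁻ y in {y | 0 < h y}, g y * ∫⁻ x in (iball ι y (h y / 5))ᶜ,
        ENNReal.ofReal (1 / dist (ι y) (ι x) ^ q) ∂μ ∂μ := by
  set A : Set (X × X) := {z | 0 < h z.2 ∧ h z.2 / 5 ≤ dist (ι z.1) (ι z.2)}
  have hdist : Measurable fun z : X × X => dist (ι z.1) (ι z.2) :=
    (hι.comp measurable_fst).dist (hι.comp measurable_snd)
  have hAm : MeasurableSet A :=
    (measurableSet_lt measurable_const (hh.measurable.comp measurable_snd)).inter
      (measurableSet_le ((hh.measurable.comp measurable_snd).div_const 5) hdist)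
  set G : X × X → ℝ≥0∞ := A.indicator fun z => g z.2 * ENNReal.ofReal (1 / dist (ι z.1) (ι z.2) ^ q)
  have hG : Measurable G :=
    ((hg.comp measurable_snd).mul (measurable_one_div_dist_rpow hι q)).indicator hAm
  have hset : MeasurableSet {y | 0 < h y} := measurableSet_lt measurable_const hh.measurable
  calc _ ≤ ∫⁻ x, ∫⁻ y, G (x, y) ∂μ ∂μ := by
        refine (lintegral_mono fun x => ?_).trans (setLIntegral_le_lintegral _ _)
        refine (setLIntegral_mono' (measurableSet_iball hι _ _).compl fun y hy => ?_).trans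
          (setLIntegral_le_lintegral _ _)
        have hy : h x / 4 ≤ dist (ι x) (ι y) := not_lt.1 hy
        rcases (hh.nonneg y).eq_or_lt with h0 | h0
        · simp [hg0 y h0.symm]
        · have hA : (x, y) ∈ A := by
            refine ⟨h0, ?_⟩
            have := abs_le.1 (hh.lip x y)
            simp only
            linarith
          simp only [G, indicator_of_mem hA, le_refl]
    _ = ∫⁻ y, ∫⁻ x, G (x, y) ∂μ ∂μ := lintegral_lintegral_swap hG.aemeasurable
    _ ≤ _ := by
        rw [← lintegral_indicator hset]
        refine lintegral_mono fun y => ?_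
        by_cases hy : 0 < h y
        · have hm : Measurable fun x => ENNReal.ofReal (1 / dist (ι y) (ι x) ^ q) :=
            (measurable_const.div ((measurable_dist_map hι y).pow_const q)).ennreal_ofReal
          rw [indicator_of_mem (show y ∈ {y | 0 < h y} from hy), ← lintegral_const_mul _ hm,
            ← lintegral_indicator (measurableSet_iball hι _ _).compl]
          refine lintegral_mono fun x => ?_
          by_cases hA : (x, y) ∈ A
          · have hx : x ∈ (iball ι y (h y / 5))ᶜ := by
              have := hA.2
              simp only [dist_comm (ι x)] at this
              exact not_lt.2 this
            simp only [G, indicator_of_mem hA, indicator_of_mem hx, dist_comm (ι x), le_refl]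
          · simp [G, hA]
        · have : ∀ x, (x, y) ∉ A := fun x hA => hy hA.1
          simp [G, this]

theorem measurable_truncDensity (hι : Measurable ι) {p q : ℝ} (hh : Measurable h)
    {u : X → EuclideanSpace ℝ (Fin M)} (hu : Measurable u) :
    Measurable (truncDensity ι μ p q h u) := by
  refine Measurable.lintegral_prod_right' (f := fun z : X × X => ENNReal.ofReal
    (‖u z.1 - u z.2‖ ^ p / max (dist (ι z.1) (ι z.2)) (h z.1) ^ q)) ?_
  exact ((((hu.comp measurable_fst).sub (hu.comp measurable_snd)).norm.pow_const p).div
    ((((hι.comp measurable_fst).dist (hι.comp measurable_snd)).max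
      (hh.comp measurable_fst)).pow_const _)).ennreal_ofReal

theorem ofReal_rpow_mul_one_div_le {a p k H : ℝ} (hap : a ≤ p) (hk : 1 ≤ k) (hH : 0 < H) :
    ENNReal.ofReal (H ^ a) * ENNReal.ofReal (1 / (H / k) ^ a) ≤ ENNReal.ofReal (k ^ p) := by
  rw [← ENNReal.ofReal_mul (by positivity)]
  refine ENNReal.ofReal_le_ofReal ?_
  rw [Real.div_rpow hH.le (by linarith)]
  have : H ^ a * (1 / (H ^ a / k ^ a)) = k ^ a := by
    have : H ^ a ≠ 0 := (Real.rpow_pos_of_pos hH a).ne'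
    field_simp
  rw [this]
  exact Real.rpow_le_rpow_of_exponent_le hk hap

/-- Below the scale `h x` the averages are Lipschitz, so the singular kernel is multiplied by `dist
^ p` and becomes integrable; the powers `h ^ (a - p)` and `(h / 4) ^ (p - a)` cancel. -/
theorem setLIntegral_near_tentAvg_le (hι : Measurable ι) {p a : ℝ} (hap : a ≤ p)
    {K₁ K₄ : ℝ≥0} {u : X → EuclideanSpace ℝ (Fin M)} {x : X} (hx : 0 < h x)
    (hK₁ : ∫⁻ y in iball ι x (h x / 4), ENNReal.ofReal
      (dist (ι x) (ι y) ^ p / dist (ι x) (ι y) ^ (n + a)) ∂μ ≤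
        K₁ * ENNReal.ofReal ((h x / 4) ^ (p - a)))
    (hK₄ : ∀ y, dist (ι x) (ι y) ≤ h x / 4 →
      ENNReal.ofReal (‖tentAvg ι μ h u x - tentAvg ι μ h u y‖ ^ p) ≤
        K₄ * ENNReal.ofReal (dist (ι x) (ι y) ^ p * h x ^ (a - p)) *
          truncDensity ι μ p (n + a) h u x) :
    ∫⁻ y in iball ι x (h x / 4), ENNReal.ofReal (‖tentAvg ι μ h u x - tentAvg ι μ h u y‖ ^ p /
      dist (ι x) (ι y) ^ (n + a)) ∂μ ≤ K₄ * K₁ * truncDensity ι μ p (n + a) h u x := by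
  set w := tentAvg ι μ h u
  set J := truncDensity ι μ p (n + a) h u
  calc _ ≤ ∫⁻ y in iball ι x (h x / 4), (K₄ * J x * ENNReal.ofReal (h x ^ (a - p))) *
        ENNReal.ofReal (dist (ι x) (ι y) ^ p / dist (ι x) (ι y) ^ (n + a)) ∂μ := by
        refine setLIntegral_mono' (measurableSet_iball hι _ _) fun y hy => ?_
        have hy : dist (ι x) (ι y) < h x / 4 := hy
        have := hK₄ y hy.le
        rw [div_eq_mul_one_div, ENNReal.ofReal_mul (by positivity)]
        refine (mul_le_mul_left this _).trans (le_of_eq ?_)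
        rw [div_eq_mul_one_div (dist (ι x) (ι y) ^ p), ENNReal.ofReal_mul (by positivity),
          ENNReal.ofReal_mul (p := dist (ι x) (ι y) ^ p) (by positivity)]
        ring
    _ = (K₄ * J x * ENNReal.ofReal (h x ^ (a - p))) * ∫⁻ y in iball ι x (h x / 4),
        ENNReal.ofReal (dist (ι x) (ι y) ^ p / dist (ι x) (ι y) ^ (n + a)) ∂μ := by
        refine lintegral_const_mul _ (Measurable.ennreal_ofReal ?_)
        exact ((measurable_dist_map hι x).pow_const p).div
          ((measurable_dist_map hι x).pow_const _)
    _ ≤ (K₄ * J x * ENNReal.ofReal (h x ^ (a - p))) *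
        (K₁ * ENNReal.ofReal ((h x / 4) ^ (p - a))) := mul_le_mul_right hK₁ _
    _ = K₄ * K₁ * J x * (ENNReal.ofReal (h x ^ (a - p)) *
          ENNReal.ofReal ((h x / 4) ^ (p - a))) := by ring
    _ ≤ K₄ * K₁ * J x * 1 := by
        refine mul_le_mul_right ?_ _
        rw [← ENNReal.ofReal_mul (by positivity), ENNReal.ofReal_le_one]
        have : (h x / 4) ^ (p - a) ≤ h x ^ (p - a) :=
          Real.rpow_le_rpow (by positivity) (by linarith) (by linarith)
        calc _ ≤ h x ^ (a - p) * h x ^ (p - a) := by gcongr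
          _ = 1 := by rw [← Real.rpow_add hx]; simp
    _ = _ := mul_one _

/-- Beyond `h x / 4` truncation changes the distance by a factor of at most `4`. -/
theorem setLIntegral_far_energy_le (hι : Measurable ι) {p a : ℝ} (ha : 0 ≤ a) (hap : a ≤ p)
    {u : X → EuclideanSpace ℝ (Fin M)} {x : X} (hx : 0 < h x) :
    ∫⁻ y in (iball ι x (h x / 4))ᶜ, ENNReal.ofReal (‖u x - u y‖ ^ p /
      dist (ι x) (ι y) ^ (n + a)) ∂μ ≤
        ((4 : ℝ) ^ (n + p)).toNNReal * truncDensity ι μ p (n + a) h u x := by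
  simp only [truncDensity]
  rw [← lintegral_const_mul' _ _ ENNReal.coe_ne_top]
  refine (setLIntegral_mono' (measurableSet_iball hι _ _).compl fun y hy => ?_).trans
    (setLIntegral_le_lintegral _ _)
  have hy : h x / 4 ≤ dist (ι x) (ι y) := not_lt.1 hy
  set D := dist (ι x) (ι y)
  have hD : 0 < D := by linarith
  have hm : 0 < max D (h x) := lt_max_of_lt_left hD
  change _ ≤ ENNReal.ofReal _ * _
  rw [← ENNReal.ofReal_mul (by positivity)]
  refine ENNReal.ofReal_le_ofReal ?_
  have h1 : max D (h x) ^ (n + a) ≤ 4 ^ (n + p) * D ^ (n + a) := by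
    calc max D (h x) ^ (n + a) ≤ (4 * D) ^ (n + a) :=
          Real.rpow_le_rpow hm.le (max_le (by linarith) (by linarith)) (by positivity)
      _ = 4 ^ (n + a) * D ^ (n + a) := Real.mul_rpow (by norm_num) hD.le
      _ ≤ _ := by
          gcongr
          norm_num
  rw [mul_div_assoc', div_le_div_iff₀ (by positivity) (by positivity)]
  calc _ ≤ ‖u x - u y‖ ^ p * (4 ^ (n + p) * D ^ (n + a)) := by gcongr
    _ = _ := by ring

theorem ofReal_three_point_le {F : Type*} [NormedAddCommGroup F] {p : ℝ} (hp : 0 < p)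
    (w₁ w₂ u₁ u₂ : F) {d : ℝ} (hd : 0 ≤ d) :
    ENNReal.ofReal (‖w₁ - w₂‖ ^ p / d) ≤
      ((3 : ℝ) ^ p).toNNReal * (ENNReal.ofReal (‖w₁ - u₁‖ ^ p) * ENNReal.ofReal (1 / d) +
        ENNReal.ofReal (‖u₁ - u₂‖ ^ p / d) +
        ENNReal.ofReal (‖w₂ - u₂‖ ^ p) * ENNReal.ofReal (1 / d)) := by
  have h1 := norm_rpow_le_three hp (w₁ - u₁) (u₁ - u₂) (u₂ - w₂)
  rw [sub_add_sub_cancel, sub_add_sub_cancel, norm_sub_rev u₂] at h1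
  rw [← ENNReal.ofReal_mul (by positivity), ← ENNReal.ofReal_mul (by positivity),
    ← ENNReal.ofReal_add (by positivity) (by positivity),
    ← ENNReal.ofReal_add (by positivity) (by positivity)]
  change _ ≤ ENNReal.ofReal _ * _
  rw [← ENNReal.ofReal_mul (by positivity)]
  refine ENNReal.ofReal_le_ofReal ?_
  rw [div_eq_mul_one_div, div_eq_mul_one_div (‖u₁ - u₂‖ ^ p), ← add_mul, ← add_mul, ← mul_assoc]
  gcongr

theorem lintegral_energy_split_le (hι : Measurable ι) {p q : ℝ} (hp : 0 < p)
    {u w : X → EuclideanSpace ℝ (Fin M)} (hu : Measurable u) (x : X) (s : Set X) :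
    ∫⁻ y in s, ENNReal.ofReal (‖w x - w y‖ ^ p / dist (ι x) (ι y) ^ q) ∂μ ≤
      ((3 : ℝ) ^ p).toNNReal * (ENNReal.ofReal (‖w x - u x‖ ^ p) *
          ∫⁻ y in s, ENNReal.ofReal (1 / dist (ι x) (ι y) ^ q) ∂μ +
        ∫⁻ y in s, ENNReal.ofReal (‖u x - u y‖ ^ p / dist (ι x) (ι y) ^ q) ∂μ +
        ∫⁻ y in s, ENNReal.ofReal (‖w y - u y‖ ^ p) *
          ENNReal.ofReal (1 / dist (ι x) (ι y) ^ q) ∂μ) := by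
  have hkm : Measurable fun y => ENNReal.ofReal (1 / dist (ι x) (ι y) ^ q) :=
    (measurable_const.div ((measurable_dist_map hι x).pow_const q)).ennreal_ofReal
  have hum : Measurable fun y => ENNReal.ofReal (‖u x - u y‖ ^ p / dist (ι x) (ι y) ^ q) :=
    (((measurable_const.sub hu).norm.pow_const p).div
      ((measurable_dist_map hι x).pow_const _)).ennreal_ofReal
  have hsum : Measurable fun y => ENNReal.ofReal (‖w x - u x‖ ^ p) *
      ENNReal.ofReal (1 / dist (ι x) (ι y) ^ q) +
      ENNReal.ofReal (‖u x - u y‖ ^ p / dist (ι x) (ι y) ^ q) := (hkm.const_mul _).add hum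
  rw [← lintegral_const_mul _ hkm, ← lintegral_add_left (hkm.const_mul _), ← lintegral_add_left hsum,
    ← lintegral_const_mul' _ _ ENNReal.coe_ne_top]
  exact lintegral_mono fun y => ofReal_three_point_le hp _ _ _ _ (by positivity)

/-- The energy of the variable-scale average of `u` is controlled by the truncated energy of `u`. -/
theorem exists_energy_tentAvg_le (hn : 1 ≤ n) (hι : Measurable ι) (hA : IsAhlfors n ι μ c C)
    {p κ : ℝ} (hp : 1 < p) (hκ : 0 < κ) :
    ∃ K : ℝ≥0, ∀ a : ℝ, n ≤ a → a + κ ≤ p → ∀ h : X → ℝ, IsScale ι h →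
      ∀ u : X → EuclideanSpace ℝ (Fin M), Measurable u → Integrable u μ →
      ∫⁻ x in {x | 0 < h x}, ∫⁻ y, ENNReal.ofReal (‖tentAvg ι μ h u x - tentAvg ι μ h u y‖ ^ p /
        dist (ι x) (ι y) ^ (n + a)) ∂μ ∂μ ≤
      K * ∫⁻ x in {x | 0 < h x}, truncDensity ι μ p (n + a) h u x ∂μ := by
  obtain ⟨K₁, hK₁⟩ := exists_lintegral_near_le (μ := μ) hι hA hκ (p := p)
  obtain ⟨K₂, hK₂⟩ := exists_lintegral_far_le (μ := μ) hn hι hA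
  obtain ⟨K₃, hK₃⟩ := exists_tentAvg_sub_self_le (M := M) hι hA hp
  obtain ⟨K₄, hK₄⟩ := exists_tentAvg_sub_tentAvg_le (M := M) hι hA hp
  have hp0 : 0 < p := by linarith
  refine ⟨K₄ * K₁ + ((3 : ℝ) ^ p).toNNReal * (K₃ * K₂ * ((4 : ℝ) ^ p).toNNReal +
    ((4 : ℝ) ^ (n + p)).toNNReal + K₃ * K₂ * ((5 : ℝ) ^ p).toNNReal),
    fun a ha hap h hh u hu hui => ?_⟩
  have ha0 : 0 ≤ a := le_trans (by positivity) ha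
  have hap' : a ≤ p := by linarith
  set w := tentAvg ι μ h u with hwdef
  have hw : Measurable w := measurable_tentAvg hι hh hu
  have hJm : Measurable (truncDensity ι μ p (n + a) h u) :=
    measurable_truncDensity hι hh.measurable hu
  have hnear := fun x (hx : 0 < h x) => setLIntegral_near_tentAvg_le (n := n) (u := u) hι hap' hx
    (hK₁ a ha0 hap x (h x / 4) (by positivity)) (hK₄ a ha0 hap' h hh u hui x · hx)
  have hfar2 := fun x (hx : 0 < h x) =>
    setLIntegral_far_energy_le (μ := μ) (n := n) (u := u) hι ha0 hap' hx
  set J := truncDensity ι μ p (n + a) h u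
  set B : Set X := {x | 0 < h x}
  have hB : MeasurableSet B := measurableSet_lt measurable_const hh.measurable
  set g : X → ℝ≥0∞ := fun x => ENNReal.ofReal (‖w x - u x‖ ^ p) with hgdef
  have hgm : Measurable g := ((hw.sub hu).norm.pow_const p).ennreal_ofReal
  have hg0 : ∀ y, h y = 0 → g y = 0 := by
    intro y hy
    simp [g, w, tentAvg, hy, hp0.ne']
  have hgJ : ∀ x, 0 < h x → g x ≤ K₃ * ENNReal.ofReal (h x ^ a) * J x := fun x hx =>
    hK₃ a ha0 hap' h hh u hui x hx
  have hfar1 : ∀ (k : ℝ), 1 ≤ k → ∀ x, 0 < h x → g x * ∫⁻ y in (iball ι x (h x / k))ᶜ,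
      ENNReal.ofReal (1 / dist (ι x) (ι y) ^ (n + a)) ∂μ ≤
        K₃ * K₂ * (k ^ p).toNNReal * J x := by
    intro k hk x hx
    calc _ ≤ (K₃ * ENNReal.ofReal (h x ^ a) * J x) *
          (K₂ * ENNReal.ofReal (1 / (h x / k) ^ a)) :=
          mul_le_mul' (hgJ x hx) (hK₂ a ha x _ (by positivity))
      _ = K₃ * K₂ * (ENNReal.ofReal (h x ^ a) * ENNReal.ofReal (1 / (h x / k) ^ a)) * J x := by ring
      _ ≤ _ := mul_le_mul_left (mul_le_mul_right (ofReal_rpow_mul_one_div_le hap' hk hx) _) _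
  -- Near the diagonal the Lipschitz bound on `w` applies. Far from it, `w x - w y` is compared with
  -- `u x - u y`, and the errors `w - u` at the two end points are integrated against the kernel.
  have hpt : ∀ x, 0 < h x → ∫⁻ y, ENNReal.ofReal (‖w x - w y‖ ^ p /
      dist (ι x) (ι y) ^ (n + a)) ∂μ ≤
      (K₄ * K₁ + ((3 : ℝ) ^ p).toNNReal * (K₃ * K₂ * ((4 : ℝ) ^ p).toNNReal +
        ((4 : ℝ) ^ (n + p)).toNNReal)) * J x +
      ((3 : ℝ) ^ p).toNNReal * ∫⁻ y in (iball ι x (h x / 4))ᶜ,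
        g y * ENNReal.ofReal (1 / dist (ι x) (ι y) ^ (n + a)) ∂μ := by
    intro x hx
    rw [← lintegral_add_compl _ (measurableSet_iball hι x (h x / 4))]
    have h1 := lintegral_energy_split_le (μ := μ) (w := w) (q := n + a) hι hp0 hu x
      (iball ι x (h x / 4))ᶜ
    refine (add_le_add (hnear x hx) (h1.trans (mul_le_mul_right (add_le_add_left (add_le_add
      (hfar1 4 (by norm_num) x hx) (hfar2 x hx)) _) _))).trans (le_of_eq ?_)
    ring
  -- The error at `y` is not controlled by the density at `x`; after the exchange of variables it is
  -- treated like the error at `x`.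
  have hT3 : ∫⁻ x in B, ∫⁻ y in (iball ι x (h x / 4))ᶜ,
        g y * ENNReal.ofReal (1 / dist (ι x) (ι y) ^ (n + a)) ∂μ ∂μ ≤
      K₃ * K₂ * ((5 : ℝ) ^ p).toNNReal * ∫⁻ x in B, J x ∂μ := by
    refine (lintegral_far_le hι hgm hh hg0 _).trans ?_
    rw [← lintegral_const_mul _ hJm]
    exact setLIntegral_mono' hB fun y hy => hfar1 5 (by norm_num) y hy
  refine (setLIntegral_mono' hB hpt).trans ?_
  rw [lintegral_add_left (hJm.const_mul _), lintegral_const_mul _ hJm,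
    lintegral_const_mul' _ _ ENNReal.coe_ne_top]
  refine (add_le_add_right (mul_le_mul_right hT3 _) _).trans (le_of_eq ?_)
  push_cast
  ring

end AverageEnergy

end FractionalHarmonic

/-! ### The comparison map -/

namespace FractionalHarmonic

section Competitor

set_option linter.unusedSectionVars false

variable {X : Type*} [MeasurableSpace X] {L M n : ℕ} {ι : X → EuclideanSpace ℝ (Fin L)}
  {μ : Measure X} [IsFiniteMeasure μ] {c C : ℝ≥0} {h : X → ℝ}

/-- Integrand of the Gagliardo energy. -/
noncomputable def pairEnergy (ι : X → EuclideanSpace ℝ (Fin L)) (p q : ℝ)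
    (u : X → EuclideanSpace ℝ (Fin M)) (x y : X) : ℝ≥0∞ :=
  ENNReal.ofReal (‖u x - u y‖ ^ p / dist (ι x) (ι y) ^ q)

/-- Density of the Gagliardo energy. -/
noncomputable def energyDensity (ι : X → EuclideanSpace ℝ (Fin L)) (μ : Measure X) (p q : ℝ)
    (u : X → EuclideanSpace ℝ (Fin M)) (x : X) : ℝ≥0∞ :=
  ∫⁻ y, pairEnergy ι p q u x y ∂μ

theorem pairEnergy_comm (p q : ℝ) (u : X → EuclideanSpace ℝ (Fin M)) (x y : X) :
    pairEnergy ι p q u x y = pairEnergy ι p q u y x := by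
  rw [pairEnergy, pairEnergy, norm_sub_rev, dist_comm]

theorem measurable_pairEnergy (hι : Measurable ι) (p q : ℝ) {u : X → EuclideanSpace ℝ (Fin M)}
    (hu : Measurable u) : Measurable fun z : X × X => pairEnergy ι p q u z.1 z.2 :=
  ((((hu.comp measurable_fst).sub (hu.comp measurable_snd)).norm.pow_const p).div
    (((hι.comp measurable_fst).dist (hι.comp measurable_snd)).pow_const _)).ennreal_ofReal

theorem measurable_pairEnergy_right (hι : Measurable ι) (p q : ℝ)
    {u : X → EuclideanSpace ℝ (Fin M)} (hu : Measurable u) (x : X) :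
    Measurable fun y => pairEnergy ι p q u x y :=
  (((measurable_const.sub hu).norm.pow_const p).div
    ((measurable_dist_map hι x).pow_const q)).ennreal_ofReal

theorem measurable_setLIntegral_pairEnergy (hι : Measurable ι) (p q : ℝ)
    {u : X → EuclideanSpace ℝ (Fin M)} (hu : Measurable u) (s : Set X) :
    Measurable fun x => ∫⁻ y in s, pairEnergy ι p q u x y ∂μ :=
  (measurable_pairEnergy hι p q hu).lintegral_prod_right'

theorem measurable_energyDensity (hι : Measurable ι) (p q : ℝ)
    {u : X → EuclideanSpace ℝ (Fin M)} (hu : Measurable u) :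
    Measurable (energyDensity ι μ p q u) :=
  (measurable_pairEnergy hι p q hu).lintegral_prod_right'

theorem setLIntegral_pairEnergy_comm (hι : Measurable ι) (p q : ℝ)
    {u : X → EuclideanSpace ℝ (Fin M)} (hu : Measurable u) (s t : Set X) :
    ∫⁻ x in s, ∫⁻ y in t, pairEnergy ι p q u x y ∂μ ∂μ =
      ∫⁻ x in t, ∫⁻ y in s, pairEnergy ι p q u x y ∂μ ∂μ := by
  rw [lintegral_lintegral_swap (measurable_pairEnergy hι p q hu).aemeasurable]
  simp_rw [pairEnergy_comm p q u]

/-- The energy of a modification of `u` on `B`, on a set outside `B`. -/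
theorem setLIntegral_energyDensity_le_of_eqOn (hι : Measurable ι) (p q : ℝ)
    {u v : X → EuclideanSpace ℝ (Fin M)} (hv : Measurable v) {B s : Set X}
    (hB : MeasurableSet B) (huv : ∀ x, x ∉ B → v x = u x) (hs : MeasurableSet s) :
    ∫⁻ x in s, energyDensity ι μ p q v x ∂μ ≤
      ∫⁻ x in s, energyDensity ι μ p q u x ∂μ + 2 * ∫⁻ x in B, energyDensity ι μ p q v x ∂μ := by
  have h1 : ∫⁻ x in s \ B, ∫⁻ y in B, pairEnergy ι p q v x y ∂μ ∂μ ≤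
      ∫⁻ x in B, energyDensity ι μ p q v x ∂μ := by
    rw [setLIntegral_pairEnergy_comm hι p q hv]
    exact lintegral_mono fun x => setLIntegral_le_lintegral _ _
  have h2 : ∫⁻ x in s \ B, ∫⁻ y in Bᶜ, pairEnergy ι p q v x y ∂μ ∂μ ≤
      ∫⁻ x in s, energyDensity ι μ p q u x ∂μ := by
    calc _ ≤ ∫⁻ x in s \ B, energyDensity ι μ p q u x ∂μ := by
          refine setLIntegral_mono' (hs.diff hB) fun x hx => ?_
          refine le_trans (setLIntegral_mono' hB.compl fun y hy => ?_)
            (setLIntegral_le_lintegral _ _)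
          rw [pairEnergy, pairEnergy, huv x hx.2, huv y hy]
      _ ≤ _ := lintegral_mono_set sdiff_subset
  have h3 : ∫⁻ x in s \ B, energyDensity ι μ p q v x ∂μ =
      ∫⁻ x in s \ B, ∫⁻ y in B, pairEnergy ι p q v x y ∂μ ∂μ +
        ∫⁻ x in s \ B, ∫⁻ y in Bᶜ, pairEnergy ι p q v x y ∂μ ∂μ := by
    rw [← lintegral_add_left (measurable_setLIntegral_pairEnergy hι p q hv B)]
    refine lintegral_congr fun x => ?_
    rw [energyDensity, lintegral_add_compl _ hB]
  rw [← lintegral_inter_add_sdiff _ s hB, h3, two_mul]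
  have h4 : ∫⁻ x in s ∩ B, energyDensity ι μ p q v x ∂μ ≤
      ∫⁻ x in B, energyDensity ι μ p q v x ∂μ := lintegral_mono_set inter_subset_right
  calc _ ≤ ∫⁻ x in B, energyDensity ι μ p q v x ∂μ + (∫⁻ x in B, energyDensity ι μ p q v x ∂μ +
        ∫⁻ x in s, energyDensity ι μ p q u x ∂μ) := by gcongr
    _ = _ := by ring

theorem lintegral_energyDensity_eq (hι : Measurable ι) (p q : ℝ)
    {u : X → EuclideanSpace ℝ (Fin M)} (hu : Measurable u) {B : Set X} (hB : MeasurableSet B) :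
    ∫⁻ x, energyDensity ι μ p q u x ∂μ = ∫⁻ x in B, energyDensity ι μ p q u x ∂μ +
      (∫⁻ x in Bᶜ, ∫⁻ y in B, pairEnergy ι p q u x y ∂μ ∂μ +
      ∫⁻ x in Bᶜ, ∫⁻ y in Bᶜ, pairEnergy ι p q u x y ∂μ ∂μ) := by
  rw [← lintegral_add_compl _ hB, ← lintegral_add_left
    (measurable_setLIntegral_pairEnergy hι p q hu B)]
  congr 1
  refine lintegral_congr fun x => ?_
  rw [energyDensity, lintegral_add_compl _ hB]

/-- If a modification of `u` on `B` does not decrease the energy, then the energy of `u` on `B`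
is bounded by the energy of the modification on `B`. -/
theorem setLIntegral_energyDensity_le_of_energy_le (hι : Measurable ι) (p q : ℝ)
    {u v : X → EuclideanSpace ℝ (Fin M)} (hu : Measurable u) (hv : Measurable v) {B : Set X}
    (hB : MeasurableSet B) (huv : ∀ x, x ∉ B → v x = u x)
    (hfin : ∫⁻ x, energyDensity ι μ p q u x ∂μ ≠ ⊤)
    (hle : ∫⁻ x, energyDensity ι μ p q u x ∂μ ≤ ∫⁻ x, energyDensity ι μ p q v x ∂μ) :
    ∫⁻ x in B, energyDensity ι μ p q u x ∂μ ≤ 2 * ∫⁻ x in B, energyDensity ι μ p q v x ∂μ := by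
  have hE : ∫⁻ x in Bᶜ, ∫⁻ y in Bᶜ, pairEnergy ι p q v x y ∂μ ∂μ =
      ∫⁻ x in Bᶜ, ∫⁻ y in Bᶜ, pairEnergy ι p q u x y ∂μ ∂μ := by
    refine setLIntegral_congr_fun hB.compl fun x hx => ?_
    refine setLIntegral_congr_fun hB.compl fun y hy => ?_
    simp only [pairEnergy, huv x hx, huv y hy]
  rw [lintegral_energyDensity_eq hι p q hu hB] at hfin
  rw [lintegral_energyDensity_eq hι p q hu hB, lintegral_energyDensity_eq hι p q hv hB, hE] at hle
  have hb : ∫⁻ x in Bᶜ, ∫⁻ y in B, pairEnergy ι p q v x y ∂μ ∂μ ≤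
      ∫⁻ x in B, energyDensity ι μ p q v x ∂μ := by
    rw [setLIntegral_pairEnergy_comm hι p q hv]
    exact lintegral_mono fun x => setLIntegral_le_lintegral _ _
  have hfin' := (ENNReal.add_ne_top.1 (ENNReal.add_ne_top.1 hfin).2).2
  -- The interaction of the complement of `B` with itself is common to both maps and finite, so it
  -- cancels. The remaining cross term is at most the integral of the density over `B`, whence the
  -- factor `2`.
  refine ENNReal.le_of_add_le_add_right hfin' ?_
  rw [← add_assoc, ← add_assoc] at hle
  refine (add_le_add_left le_self_add _).trans (hle.trans ?_)
  rw [two_mul]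
  gcongr

theorem exists_le_inv_mul_setLIntegral {s : Set X} {φ : X → ℝ≥0∞} (hφ : Measurable φ) {m : ℝ≥0∞}
    (hm : m ≠ 0) (hs : m ≤ μ s) : ∃ z ∈ s, φ z ≤ m⁻¹ * ∫⁻ x in s, φ x ∂μ := by
  have h0 : μ s ≠ 0 := fun h0 => hm (le_zero_iff.1 (h0 ▸ hs))
  obtain ⟨z, hz, h⟩ := exists_le_setLAverage h0 (measure_ne_top μ s) hφ.aemeasurable
  refine ⟨z, hz, h.trans ?_⟩
  rw [setLAverage_eq, ENNReal.div_eq_inv_mul]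
  gcongr

theorem exists_le_setLIntegral_iball (hA : IsAhlfors n ι μ c C) (x : X) {r : ℝ} (hr : 0 < r)
    (hr1 : r ≤ 1) {φ : X → ℝ≥0∞} (hφ : Measurable φ) :
    ∃ z ∈ iball ι x r, φ z ≤ (c⁻¹ : ℝ≥0) * ENNReal.ofReal (1 / r ^ n) *
      ∫⁻ y in iball ι x r, φ y ∂μ := by
  have hc := hA.pos
  have hr0 : ENNReal.ofReal r ^ n ≠ 0 := pow_ne_zero _ (ENNReal.ofReal_pos.2 hr).ne'
  obtain ⟨z, hz, h⟩ := exists_le_inv_mul_setLIntegral (μ := μ) hφ (s := iball ι x r)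
    (mul_ne_zero (ENNReal.coe_ne_zero.2 hc.ne') hr0) (hA.le_measure x r hr hr1)
  refine ⟨z, hz, h.trans (le_of_eq ?_)⟩
  rw [ENNReal.mul_inv (Or.inr (by finiteness)) (Or.inr hr0), ENNReal.coe_inv hc.ne', one_div,
    ENNReal.ofReal_inv_of_pos (by positivity), ENNReal.ofReal_pow hr.le]

/-- The averages at scale `h` are close to values of `u` if the truncated energy is small. -/
theorem exists_tentAvg_near_range (hι : Measurable ι) (hA : IsAhlfors n ι μ c C) {p : ℝ}
    (hp : 1 < p) :
    ∃ K : ℝ≥0, ∀ a : ℝ, n ≤ a → a ≤ p → ∀ h : X → ℝ, IsScale ι h →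
      ∀ u : X → EuclideanSpace ℝ (Fin M), Measurable u → Integrable u μ → ∀ x, 0 < h x →
      ∃ z, ENNReal.ofReal (‖tentAvg ι μ h u x - u z‖ ^ p) ≤
        K * ∫⁻ y in {y | 0 < h y}, truncDensity ι μ p (n + a) h u y ∂μ := by
  obtain ⟨K, hK⟩ := exists_tentAvg_sub_rpow_le (M := M) hι hA hp
  refine ⟨K * c⁻¹ * ((2 : ℝ) ^ (n + p)).toNNReal, fun a ha hap h hh u hu hui x hx => ?_⟩
  have ha0 : 0 ≤ a := le_trans (by positivity) ha
  set B := iball ι x (h x)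
  have hB : MeasurableSet B := measurableSet_iball hι _ _
  set φ : X → ℝ≥0∞ := fun z => ∫⁻ y in B, ENNReal.ofReal (‖u y - u z‖ ^ p) ∂μ
  have hφ : Measurable φ := Measurable.lintegral_prod_right'
    (f := fun w : X × X => ENNReal.ofReal (‖u w.2 - u w.1‖ ^ p))
    (((hu.comp measurable_snd).sub (hu.comp measurable_fst)).norm.pow_const p).ennreal_ofReal
  -- Some `z` in the ball does no worse than the mean of `φ`, so the double integral of `‖u y - u z‖
  -- ^ p` bounds the oscillation about the actual value `u z`.
  obtain ⟨z, -, hz⟩ := exists_le_setLIntegral_iball hA x hx (hh.le_one x) hφ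
  have hle : ∀ z ∈ B, φ z ≤ ENNReal.ofReal ((2 * h x) ^ (n + a)) *
      truncDensity ι μ p (n + a) h u z := by
    intro z hz
    rw [truncDensity, ← lintegral_const_mul' _ _ ENNReal.ofReal_ne_top]
    refine (setLIntegral_mono' hB fun y hy => ?_).trans (setLIntegral_le_lintegral _ _)
    have hz : dist (ι x) (ι z) < h x := hz
    have hy : dist (ι x) (ι y) < h x := hy
    have h1 := dist_triangle_left (ι z) (ι y) (ι x)
    have h2 := abs_le.1 (hh.lip x z)
    rw [← ENNReal.ofReal_mul (by positivity)]
    refine ENNReal.ofReal_le_ofReal ?_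
    have hm : 0 < max (dist (ι z) (ι y)) (h z) := lt_max_of_lt_right (by linarith)
    have h3 : max (dist (ι z) (ι y)) (h z) ^ (n + a) ≤ (2 * h x) ^ (n + a) :=
      Real.rpow_le_rpow hm.le (max_le (by linarith) (by linarith)) (by positivity)
    rw [norm_sub_rev, mul_div_assoc', le_div_iff₀ (by positivity), mul_comm]
    gcongr
  have hBh : B ⊆ {y | 0 < h y} := fun y hy => by
    have hy : dist (ι x) (ι y) < h x := hy
    have := abs_le.1 (hh.lip x y)
    show 0 < h y
    linarith
  set J := ∫⁻ y in {y | 0 < h y}, truncDensity ι μ p (n + a) h u y ∂μ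
  have hint : ∫⁻ y in B, φ y ∂μ ≤ ENNReal.ofReal ((2 * h x) ^ (n + a)) * J := by
    refine (setLIntegral_mono' hB hle).trans ?_
    rw [lintegral_const_mul _ (measurable_truncDensity hι hh.measurable hu)]
    exact mul_le_mul_right (lintegral_mono_set hBh) _
  refine ⟨z, (hK h hh u hui x hx (u z)).trans ?_⟩
  calc _ ≤ K * ENNReal.ofReal (1 / h x ^ n) * ((c⁻¹ : ℝ≥0) * ENNReal.ofReal (1 / h x ^ n) *
        (ENNReal.ofReal ((2 * h x) ^ (n + a)) * J)) :=
        mul_le_mul_right (hz.trans (mul_le_mul_right hint _)) _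
    _ = K * (c⁻¹ : ℝ≥0) * ENNReal.ofReal ((2 * h x) ^ (n + a) / h x ^ n / h x ^ n) * J := by
        rw [show (2 * h x) ^ (n + a) / h x ^ n / h x ^ n =
          1 / h x ^ n * (1 / h x ^ n) * (2 * h x) ^ (n + a) by ring,
          ENNReal.ofReal_mul (by positivity), ENNReal.ofReal_mul (by positivity)]
        ring
    -- This is where criticality enters: `h ^ a / h ^ n ≤ 1`, as `n ≤ a` and `h ≤ 1`, so no negative
    -- power of the scale survives.
    _ ≤ K * (c⁻¹ : ℝ≥0) * ENNReal.ofReal (2 ^ (n + p)) * J := by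
        gcongr
        rw [div_le_iff₀ (by positivity)]
        refine (two_mul_rpow_div_le hx hap).trans ?_
        gcongr
        rw [← Real.rpow_natCast]
        exact Real.rpow_le_rpow_of_exponent_ge hx (hh.le_one x) ha
    _ = _ := by
        push_cast
        rfl

open Classical in
/-- The map which is `e` on the ball `iball ι x₀ r` and `u` outside. -/
noncomputable def fillBall (ι : X → EuclideanSpace ℝ (Fin L)) (x₀ : X) (r : ℝ)
    (e : EuclideanSpace ℝ (Fin M)) (u : X → EuclideanSpace ℝ (Fin M)) :
    X → EuclideanSpace ℝ (Fin M) :=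
  (iball ι x₀ r).piecewise (fun _ => e) u

theorem fillBall_of_mem {x₀ x : X} {r : ℝ} (e : EuclideanSpace ℝ (Fin M))
    (u : X → EuclideanSpace ℝ (Fin M)) (hx : x ∈ iball ι x₀ r) : fillBall ι x₀ r e u x = e := by
  classical
  exact piecewise_eq_of_mem _ _ _ hx

theorem fillBall_of_notMem {x₀ x : X} {r : ℝ} (e : EuclideanSpace ℝ (Fin M))
    (u : X → EuclideanSpace ℝ (Fin M)) (hx : x ∉ iball ι x₀ r) : fillBall ι x₀ r e u x = u x := by
  classical
  exact piecewise_eq_of_notMem _ _ _ hx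

/-- The scale vanishing outside the ball `iball ι x₀ R`. -/
noncomputable def ballScale (ι : X → EuclideanSpace ℝ (Fin L)) (x₀ : X) (R : ℝ) (x : X) : ℝ :=
  max 0 (R - dist (ι x₀) (ι x)) / 8

theorem isScale_ballScale (hι : Measurable ι) (x₀ : X) {R : ℝ} (hR : R ≤ 1) :
    IsScale ι (ballScale ι x₀ R) where
  measurable := (measurable_const.max (measurable_const.sub (measurable_dist_map hι x₀))).div_const 8
  nonneg x := div_nonneg (le_max_left _ _) (by norm_num)
  le_one x := by
    rw [ballScale, div_le_one (by norm_num)]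
    have := dist_nonneg (x := ι x₀) (y := ι x)
    exact max_le (by norm_num) (by linarith)
  lip x y := by
    have h1 := abs_max_sub_max_le_abs (R - dist (ι x₀) (ι x)) (R - dist (ι x₀) (ι y)) 0
    rw [max_comm _ (0 : ℝ), max_comm _ (0 : ℝ)] at h1
    have h2 := abs_dist_sub_le (ι x) (ι y) (ι x₀)
    rw [dist_comm _ (ι x₀), dist_comm _ (ι x₀)] at h2
    rw [ballScale, ballScale, ← sub_div, abs_div, abs_of_pos (by norm_num : (0 : ℝ) < 8)]
    refine div_le_div_of_nonneg_right (h1.trans ?_) (by norm_num)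
    rwa [sub_sub_sub_cancel_left, abs_sub_comm]

theorem ballScale_pos {x₀ x : X} {R : ℝ} : 0 < ballScale ι x₀ R x ↔ x ∈ iball ι x₀ R := by
  simp [ballScale, iball]

/-- The truncated distance between points in and outside the inner ball. -/
theorem dist_le_max_ballScale {x₀ x y o z : X} {r R : ℝ} (hR : 2 * r ≤ R) (hx : x ∈ iball ι x₀ R)
    (hz : z ∈ iball ι x₀ R)
    (ho : (x ∈ iball ι x₀ r ∧ y ∉ iball ι x₀ r ∧ o = y) ∨ (y ∈ iball ι x₀ r ∧ o = x)) :
    dist (ι z) (ι o) ≤ 64 * max (dist (ι x) (ι y)) (ballScale ι x₀ R x) := by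
  have hx : dist (ι x₀) (ι x) < R := hx
  have hz : dist (ι x₀) (ι z) < R := hz
  have hb : R - dist (ι x₀) (ι x) ≤ 8 * ballScale ι x₀ R x := by
    rw [ballScale]; linarith [le_max_right 0 (R - dist (ι x₀) (ι x))]
  have h1 := le_max_left (dist (ι x) (ι y)) (ballScale ι x₀ R x)
  have h2 := le_max_right (dist (ι x) (ι y)) (ballScale ι x₀ R x)
  have h3 := dist_triangle_left (ι z) (ι o) (ι x₀)
  have h0 := dist_nonneg (x := ι x) (y := ι y)
  rcases ho with ⟨hxr, -, rfl⟩ | ⟨hyr, rfl⟩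
  · have hxr : dist (ι x₀) (ι x) < r := hxr
    have h4 := dist_triangle (ι x₀) (ι x) (ι o)
    linarith
  · have hyr : dist (ι x₀) (ι y) < r := hyr
    have h4 := dist_triangle_right (ι x₀) (ι o) (ι y)
    linarith

theorem ofReal_div_max_le (hinj : Function.Injective ι) {p q : ℝ} (hp : 0 < p) (hq : 0 ≤ q)
    {u : X → EuclideanSpace ℝ (Fin M)} {z o : X} {m : ℝ} (hm : 0 < m)
    (hz : dist (ι z) (ι o) ≤ 64 * m) :
    ENNReal.ofReal (‖u z - u o‖ ^ p / m ^ q) ≤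
      ENNReal.ofReal (64 ^ q) * pairEnergy ι p q u z o := by
  rcases eq_or_ne z o with rfl | hne
  · simp [Real.zero_rpow hp.ne']
  have hD : 0 < dist (ι z) (ι o) := dist_pos.2 (hinj.ne hne)
  rw [pairEnergy, ← ENNReal.ofReal_mul (by positivity)]
  refine ENNReal.ofReal_le_ofReal ?_
  have h1 : dist (ι z) (ι o) ^ q ≤ 64 ^ q * m ^ q := by
    rw [← Real.mul_rpow (by norm_num) hm.le]
    exact Real.rpow_le_rpow hD.le hz hq
  rw [mul_div_assoc', div_le_div_iff₀ (by positivity) (by positivity)]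
  calc _ ≤ ‖u z - u o‖ ^ p * (64 ^ q * m ^ q) := by gcongr
    _ = _ := by ring

/-- Pairs inside the filled ball contribute nothing. For a pair with one point in it, the truncated
distance is comparable to the radius or larger: either `x` is deep inside the outer ball, where the
scale is of order `R`, or it is far from the inner ball. Such a pair is therefore dominated by the
interaction of `z` with the other point, and these add up to the energy density at the single point
`z`. -/
theorem lintegral_truncDensity_fillBall_le (hι : Measurable ι) (hinj : Function.Injective ι)
    {p q : ℝ} (hp : 0 < p) (hq : 0 ≤ q) {u : X → EuclideanSpace ℝ (Fin M)} (hu : Measurable u)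
    {x₀ z : X} {r R : ℝ} (hR : 2 * r ≤ R) (hz : z ∈ iball ι x₀ R \ iball ι x₀ r) :
    ∫⁻ x in iball ι x₀ R, truncDensity ι μ p q (ballScale ι x₀ R) (fillBall ι x₀ r (u z) u) x ∂μ ≤
      ∫⁻ x in iball ι x₀ R \ iball ι x₀ r, energyDensity ι μ p q u x ∂μ +
      2 * ENNReal.ofReal (64 ^ q) * μ (iball ι x₀ r) * energyDensity ι μ p q u z := by
  set A := iball ι x₀ R \ iball ι x₀ r
  set Br := iball ι x₀ r with hBrdef
  have hBr : MeasurableSet Br := measurableSet_iball hι _ _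
  have hBR : MeasurableSet (iball ι x₀ R) := measurableSet_iball hι _ _
  set h := ballScale ι x₀ R
  set T := truncDensity ι μ p q h (fillBall ι x₀ r (u z) u)
  set k := ENNReal.ofReal (64 ^ q)
  have hm : ∀ x ∈ iball ι x₀ R, ∀ y, 0 < max (dist (ι x) (ι y)) (h x) := fun x hx y =>
    lt_max_of_lt_right (ballScale_pos.2 hx)
  have h1 : ∀ x ∈ A, T x ≤ energyDensity ι μ p q u x + k * μ Br * pairEnergy ι p q u z x := by
    intro x hx
    have hfx : fillBall ι x₀ r (u z) u x = u x := fillBall_of_notMem _ _ hx.2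
    rw [show T x = _ from (lintegral_add_compl _ hBr).symm, add_comm]
    refine add_le_add ?_ ?_
    · refine le_trans (setLIntegral_mono' hBr.compl fun y hy => ?_) (setLIntegral_le_lintegral _ _)
      have hfy : fillBall ι x₀ r (u z) u y = u y := fillBall_of_notMem _ _ hy
      rw [hfx, hfy, pairEnergy]
      rcases eq_or_ne x y with rfl | hne
      · simp [Real.zero_rpow hp.ne']
      have hD : 0 < dist (ι x) (ι y) := dist_pos.2 (hinj.ne hne)
      gcongr
      exact le_max_left _ _
    · refine (setLIntegral_le_const_mul hBr (b := k * pairEnergy ι p q u z x) fun y hy => ?_).trans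
        (le_of_eq (by ring))
      have hfy : fillBall ι x₀ r (u z) u y = u z := fillBall_of_mem _ _ hy
      rw [hfx, hfy, norm_sub_rev]
      exact ofReal_div_max_le hinj hp hq (hm x hx.1 y)
        (dist_le_max_ballScale hR hx.1 hz.1 (Or.inr ⟨hy, rfl⟩))
  have h2 : ∀ x ∈ Br, x ∈ iball ι x₀ R → T x ≤ k * energyDensity ι μ p q u z := by
    intro x hx hxR
    have hfx : fillBall ι x₀ r (u z) u x = u z := fillBall_of_mem _ _ hx
    rw [energyDensity, ← lintegral_const_mul' _ _ ENNReal.ofReal_ne_top]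
    refine lintegral_mono fun y => ?_
    by_cases hy : y ∈ Br
    · have hfy : fillBall ι x₀ r (u z) u y = u z := fillBall_of_mem _ _ hy
      rw [hfx, hfy]
      simp [Real.zero_rpow hp.ne']
    · have hfy : fillBall ι x₀ r (u z) u y = u y := fillBall_of_notMem _ _ hy
      rw [hfx, hfy]
      exact ofReal_div_max_le hinj hp hq (hm x hxR y)
        (dist_le_max_ballScale hR hxR hz.1 (Or.inl ⟨hx, hy, rfl⟩))
  rw [← lintegral_inter_add_sdiff _ (iball ι x₀ R) hBr, add_comm]
  have h3 : ∫⁻ x in iball ι x₀ R ∩ Br, T x ∂μ ≤ k * energyDensity ι μ p q u z * μ Br :=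
    (setLIntegral_le_const_mul (hBR.inter hBr) fun x hx => h2 x hx.2 hx.1).trans
      (mul_le_mul_right (measure_mono inter_subset_right) _)
  have h4 : ∫⁻ x in A, T x ∂μ ≤ ∫⁻ x in A, energyDensity ι μ p q u x ∂μ +
      k * μ Br * energyDensity ι μ p q u z := by
    refine (setLIntegral_mono' (hBR.diff hBr) h1).trans ?_
    rw [lintegral_add_left (measurable_energyDensity hι p q hu),
      lintegral_const_mul _ (measurable_pairEnergy_right hι p q hu z)]
    gcongr
    exact setLIntegral_le_lintegral _ _
  refine (add_le_add h4 h3).trans (le_of_eq ?_)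
  ring

/-- The retraction is an unrestricted choice away from the tube, so measurability is available only
for maps with values in the tube. -/
theorem IsTubularRetraction.measurable_comp {N : Set (EuclideanSpace ℝ (Fin M))} {δ : ℝ}
    {K : ℝ≥0} {P : EuclideanSpace ℝ (Fin M) → EuclideanSpace ℝ (Fin M)}
    (hP : IsTubularRetraction N δ K P) {w : X → EuclideanSpace ℝ (Fin M)} (hw : Measurable w)
    (hwN : ∀ x, w x ∈ Metric.thickening δ N) : Measurable (P ∘ w) := by
  classical
  have h1 : Measurable ((Metric.thickening δ N).piecewise P fun _ => 0) :=
    hP.lipschitz.continuousOn.measurable_piecewise continuousOn_const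
      Metric.isOpen_thickening.measurableSet
  have h2 : P ∘ w = (Metric.thickening δ N).piecewise P (fun _ => 0) ∘ w := by
    funext x
    simp [hwN x]
  rw [h2]
  exact h1.comp hw

/-- Existence of a comparison map of small energy. -/
theorem exists_comparison (hn : 1 ≤ n) (hι : Measurable ι) (hinj : Function.Injective ι)
    (hA : IsAhlfors n ι μ c C) {p κ : ℝ} (hp : 1 < p) (hκ : 0 < κ)
    {N : Set (EuclideanSpace ℝ (Fin M))} {δ : ℝ} (hδ : 0 < δ) {KP : ℝ≥0}
    {P : EuclideanSpace ℝ (Fin M) → EuclideanSpace ℝ (Fin M)} (hP : IsTubularRetraction N δ KP P) :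
    ∃ K : ℝ≥0, ∃ ε : ℝ≥0, 0 < ε ∧ ∀ a : ℝ, n ≤ a → a + κ ≤ p →
      ∀ u : X → EuclideanSpace ℝ (Fin M), Measurable u → Integrable u μ → (∀ x, u x ∈ N) →
      ∀ (x₀ : X) (r R : ℝ), 0 < r → 2 * r ≤ R → R ≤ 1 →
      μ (iball ι x₀ r) ≤ μ (iball ι x₀ R \ iball ι x₀ r) →
      ∫⁻ x in iball ι x₀ R, energyDensity ι μ p (n + a) u x ∂μ ≤ ε →
      ∃ v : X → EuclideanSpace ℝ (Fin M), Measurable v ∧ (∀ x, v x ∈ N) ∧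
        (∀ x, x ∉ iball ι x₀ R → v x = u x) ∧
        ∫⁻ x in iball ι x₀ R, energyDensity ι μ p (n + a) v x ∂μ ≤
          K * ∫⁻ x in iball ι x₀ R \ iball ι x₀ r, energyDensity ι μ p (n + a) u x ∂μ := by
  obtain ⟨K₁, hK₁⟩ := exists_energy_tentAvg_le (M := M) hn hι hA hp hκ
  obtain ⟨K₂, hK₂⟩ := exists_tentAvg_near_range (M := M) hι hA hp
  have hp0 : 0 < p := by linarith
  set K₃ : ℝ≥0 := 1 + 2 * ((64 : ℝ) ^ (n + p)).toNNReal
  -- With this bound on the energy, every average lies within `δ / 2` of a value of the filled map,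
  -- hence in the tube; `K₃` is the constant of the filling estimate.
  set ε : ℝ≥0 := ((δ / 2) ^ p).toNNReal / (K₂ * K₃ + 1)
  have hε : 0 < ε := div_pos (Real.toNNReal_pos.2 (by positivity)) (by positivity)
  refine ⟨(((KP : ℝ) ^ p).toNNReal) * (K₁ * K₃), ε, hε,
    fun a ha hap u hu hui huN x₀ r R hr hR hR1 hmeas hsmall => ?_⟩
  have ha0 : 0 ≤ a := le_trans (by positivity) ha
  have hap' : a ≤ p := by linarith
  set A := iball ι x₀ R \ iball ι x₀ r
  have hpos : μ (iball ι x₀ r) ≠ 0 := by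
    refine (lt_of_lt_of_le ?_ (hA.le_measure x₀ r hr (by linarith))).ne'
    have := hA.pos
    have := ENNReal.ofReal_pos.2 hr
    positivity
  have hA0 : μ A ≠ 0 := fun h0 => hpos (le_zero_iff.1 (h0 ▸ hmeas))
  -- At `z` the density is at most its mean over the annulus. Since the inner ball has no more
  -- measure than the annulus, its measure times this density is at most `I`.
  obtain ⟨z, hzA, hz⟩ := exists_le_inv_mul_setLIntegral (μ := μ)
    (measurable_energyDensity (μ := μ) hι p (n + a) hu) hA0 le_rfl
  set I := ∫⁻ x in A, energyDensity ι μ p (n + a) u x ∂μ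
  set h := ballScale ι x₀ R
  have hh : IsScale ι h := isScale_ballScale hι x₀ hR1
  set f := fillBall ι x₀ r (u z) u
  have hfm : Measurable f := by
    classical
    exact Measurable.piecewise (measurableSet_iball hι _ _) measurable_const hu
  have hfi : Integrable f μ := by
    classical
    exact Integrable.piecewise (measurableSet_iball hι _ _) (integrable_const (μ := μ) (u z)).integrableOn
      hui.integrableOn
  have hfN : ∀ x, f x ∈ N := fun x => by
    by_cases hx : x ∈ iball ι x₀ r
    · rw [show f x = u z from fillBall_of_mem _ _ hx]; exact huN z
    · rw [show f x = u x from fillBall_of_notMem _ _ hx]; exact huN x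
  have hset : {x | 0 < h x} = iball ι x₀ R := by
    ext x
    exact ballScale_pos
  have hJ : ∫⁻ x in iball ι x₀ R, truncDensity ι μ p (n + a) h f x ∂μ ≤ K₃ * I := by
    refine (lintegral_truncDensity_fillBall_le hι hinj hp0 (by positivity) hu hR
      hzA).trans ?_
    have h1 : μ (iball ι x₀ r) * energyDensity ι μ p (n + a) u z ≤ I := by
      calc _ ≤ μ A * ((μ A)⁻¹ * I) := mul_le_mul' hmeas hz
        _ = I := by
          rw [← mul_assoc, ENNReal.mul_inv_cancel hA0 (measure_ne_top μ _), one_mul]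
    calc _ ≤ I + 2 * ENNReal.ofReal (64 ^ (n + p)) * I := by
          rw [mul_assoc (2 * _)]
          gcongr
          norm_num
      _ = _ := by
          simp only [K₃]
          push_cast
          rw [add_mul, one_mul]
          rfl
  set w := tentAvg ι μ h f
  have hwm : Measurable w := measurable_tentAvg hι hh hfm
  have hw0 : ∀ x, x ∉ iball ι x₀ R → w x = u x := by
    intro x hx
    have h0 : h x = 0 := le_antisymm (not_lt.1 fun h' => hx (ballScale_pos.1 h')) (hh.nonneg x)
    have hxr : x ∉ iball ι x₀ r := fun hxr => hx (by
      have : dist (ι x₀) (ι x) < r := hxr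
      show dist (ι x₀) (ι x) < R
      linarith)
    rw [show w x = f x from if_pos h0]
    exact fillBall_of_notMem _ _ hxr
  have hIε : I ≤ ε := (lintegral_mono_set sdiff_subset).trans hsmall
  have hwN : ∀ x, w x ∈ Metric.thickening δ N := by
    intro x
    by_cases hx : x ∈ iball ι x₀ R
    · obtain ⟨y, hy⟩ := hK₂ a ha hap' h hh f hfm hfi x (ballScale_pos.2 hx)
      refine Metric.mem_thickening_iff.2 ⟨f y, hfN y, ?_⟩
      rw [hset] at hy
      have h1 : ENNReal.ofReal (‖w x - f y‖ ^ p) ≤ ENNReal.ofReal ((δ / 2) ^ p) := by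
        refine hy.trans ((mul_le_mul_right (hJ.trans (mul_le_mul_right hIε _)) _).trans ?_)
        change _ ≤ (((δ / 2) ^ p).toNNReal : ℝ≥0∞)
        norm_cast
        rw [← mul_assoc]
        calc _ ≤ (K₂ * K₃ + 1) * ε := by gcongr; exact le_self_add
          _ = _ := mul_div_cancel₀ _ (by positivity)
      have h2 := (ENNReal.ofReal_le_ofReal_iff (by positivity)).1 h1
      rw [Real.rpow_le_rpow_iff (norm_nonneg _) (by positivity) hp0] at h2
      rw [dist_eq_norm]
      linarith
    · rw [hw0 x hx]
      exact Metric.self_subset_thickening hδ N (huN x)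
  refine ⟨P ∘ w, hP.measurable_comp hwm hwN, fun x => hP.mem _, fun x hx => ?_, ?_⟩
  · rw [Function.comp_apply, hw0 x hx, hP.eq_self _ (huN x)]
  · have h1 := hK₁ a ha hap h hh f hfm hfi
    rw [hset] at h1
    have h2 : ∀ x, energyDensity ι μ p (n + a) (P ∘ w) x ≤
        ((KP : ℝ) ^ p).toNNReal * energyDensity ι μ p (n + a) w x := by
      intro x
      rw [energyDensity, energyDensity, ← lintegral_const_mul' _ _ ENNReal.coe_ne_top]
      refine lintegral_mono fun y => ?_
      change _ ≤ ENNReal.ofReal _ * _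
      rw [pairEnergy, pairEnergy, ← ENNReal.ofReal_mul (by positivity)]
      refine ENNReal.ofReal_le_ofReal ?_
      rw [mul_div_assoc', ← Real.mul_rpow KP.coe_nonneg (norm_nonneg _)]
      gcongr
      exact hP.lipschitz.norm_sub_le (hwN x) (hwN y)
    calc _ ≤ ∫⁻ x in iball ι x₀ R, ((KP : ℝ) ^ p).toNNReal * energyDensity ι μ p (n + a) w x ∂μ :=
          lintegral_mono fun x => h2 x
      _ = ((KP : ℝ) ^ p).toNNReal * ∫⁻ x in iball ι x₀ R, energyDensity ι μ p (n + a) w x ∂μ :=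
          lintegral_const_mul' _ _ ENNReal.coe_ne_top
      _ ≤ ((KP : ℝ) ^ p).toNNReal * (K₁ * (K₃ * I)) :=
          mul_le_mul_right (h1.trans (mul_le_mul_right hJ _)) _
      _ = _ := by
          push_cast
          ring

end Competitor

end FractionalHarmonic

/-! ### Ball averages, smooth homotopies and smooth averages -/

namespace FractionalHarmonic

section BallAverage

set_option linter.unusedSectionVars false

variable {X : Type*} [MeasurableSpace X] {L M n : ℕ} {ι : X → EuclideanSpace ℝ (Fin L)}
  {μ : Measure X} [IsFiniteMeasure μ] {c C : ℝ≥0}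

theorem norm_ballAverage_sub_le (hA : IsAhlfors n ι μ c C) {u : X → EuclideanSpace ℝ (Fin M)}
    (hu : Integrable u μ) (y : X) {r : ℝ} (hr : 0 < r) (hr1 : r ≤ 1)
    (e : EuclideanSpace ℝ (Fin M)) :
    ‖(⨍ z in iball ι y r, u z ∂μ) - e‖ ≤ 1 / c / r ^ n * ∫ z in iball ι y r, ‖u z - e‖ ∂μ := by
  have hc : (0 : ℝ) < c := hA.pos
  have hm := hA.le_measureReal y hr hr1
  have hm0 : 0 < c * r ^ n := by positivity
  have h1 : (⨍ z in iball ι y r, u z ∂μ) - e =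
      (μ.real (iball ι y r))⁻¹ • ∫ z in iball ι y r, (u z - e) ∂μ := by
    rw [setAverage_eq, integral_sub hu.integrableOn (integrable_const e), setIntegral_const,
      smul_sub, inv_smul_smul₀ (hm0.trans_le hm).ne']
  rw [h1, norm_smul, norm_inv, Real.norm_of_nonneg measureReal_nonneg, div_div, one_div]
  gcongr
  exact norm_integral_le_integral_norm _

theorem exists_ballAverage_sub_rpow_le (hA : IsAhlfors n ι μ c C) {p : ℝ} (hp : 1 < p) :
    ∃ K : ℝ≥0, ∀ u : X → EuclideanSpace ℝ (Fin M), Integrable u μ → ∀ y r, 0 < r → r ≤ 1 → ∀ e,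
      ENNReal.ofReal (‖(⨍ z in iball ι y r, u z ∂μ) - e‖ ^ p) ≤ K * ENNReal.ofReal (1 / r ^ n) *
        ∫⁻ z in iball ι y r, ENNReal.ofReal (‖u z - e‖ ^ p) ∂μ := by
  have hc : (0 : ℝ) < c := hA.pos
  refine ⟨((1 / c : ℝ) ^ p * (C : ℝ) ^ (p - 1)).toNNReal, fun u hu y r hr hr1 e => ?_⟩
  have h1 := norm_ballAverage_sub_le hA hu y hr hr1 e
  have h2 := ofReal_setIntegral_rpow_le hA hp (hu.sub (integrable_const e)) y hr
  have h0 : 0 ≤ ∫ z in iball ι y r, ‖u z - e‖ ∂μ := integral_nonneg fun _ => norm_nonneg _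
  calc _ ≤ ENNReal.ofReal ((1 / c / r ^ n) ^ p * (∫ z in iball ι y r, ‖u z - e‖ ∂μ) ^ p) := by
        rw [← Real.mul_rpow (by positivity) h0]
        gcongr
    _ ≤ ENNReal.ofReal ((1 / c / r ^ n) ^ p) * (ENNReal.ofReal ((C * r ^ n) ^ (p - 1)) *
        ∫⁻ z in iball ι y r, ENNReal.ofReal (‖u z - e‖ ^ p) ∂μ) := by
        rw [ENNReal.ofReal_mul (by positivity)]
        gcongr
        exact h2
    _ = _ := by
        rw [← mul_assoc, ← ENNReal.ofReal_mul (by positivity),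
          rpow_div_mul_rpow (by positivity) (by positivity) (by positivity), div_eq_mul_one_div,
          ENNReal.ofReal_mul (by positivity)]
        rfl

theorem ofReal_norm_rpow_le_mul_pairEnergy (hinj : Function.Injective ι) {p q : ℝ} (hp : 0 < p)
    (hq : 0 ≤ q) {u : X → EuclideanSpace ℝ (Fin M)} {z y : X} {r : ℝ}
    (hzy : dist (ι z) (ι y) ≤ r) :
    ENNReal.ofReal (‖u y - u z‖ ^ p) ≤ ENNReal.ofReal (r ^ q) * pairEnergy ι p q u z y := by
  rcases eq_or_ne z y with rfl | hne
  · simp [Real.zero_rpow hp.ne']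
  have hD : 0 < dist (ι z) (ι y) := dist_pos.2 (hinj.ne hne)
  rw [pairEnergy, ← ENNReal.ofReal_mul (Real.rpow_nonneg (hD.le.trans hzy) q)]
  refine ENNReal.ofReal_le_ofReal ?_
  rw [mul_div_assoc', le_div_iff₀ (by positivity), norm_sub_rev, mul_comm]
  gcongr

/-- In every ball there is a point at which the oscillation of `u` is controlled by the energy. -/
theorem exists_good_point (hι : Measurable ι) (hinj : Function.Injective ι)
    (hA : IsAhlfors n ι μ c C) {p : ℝ} (hp : 0 < p) :
    ∃ K : ℝ≥0, ∀ a : ℝ, 0 ≤ a → a ≤ p → ∀ u : X → EuclideanSpace ℝ (Fin M), Measurable u →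
      ∀ x r, 0 < r → r ≤ 1 → ∃ z,
        ∫⁻ y in iball ι x r, ENNReal.ofReal (‖u y - u z‖ ^ p) ∂μ ≤
          K * ENNReal.ofReal (r ^ a) * ∫⁻ y in iball ι x r, energyDensity ι μ p (n + a) u y ∂μ := by
  refine ⟨c⁻¹ * ((2 : ℝ) ^ (n + p)).toNNReal, fun a ha hap u hu x r hr hr1 => ?_⟩
  set B := iball ι x r
  have hB : MeasurableSet B := measurableSet_iball hι _ _
  set φ : X → ℝ≥0∞ := fun z => ∫⁻ y in B, ENNReal.ofReal (‖u y - u z‖ ^ p) ∂μ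
  have hφ : Measurable φ := Measurable.lintegral_prod_right'
    (f := fun w : X × X => ENNReal.ofReal (‖u w.2 - u w.1‖ ^ p))
    (((hu.comp measurable_snd).sub (hu.comp measurable_fst)).norm.pow_const p).ennreal_ofReal
  obtain ⟨z, -, hz⟩ := exists_le_setLIntegral_iball hA x hr hr1 hφ
  refine ⟨z, hz.trans ?_⟩
  have hle : ∀ z ∈ B, φ z ≤ ENNReal.ofReal ((2 * r) ^ (n + a)) *
      energyDensity ι μ p (n + a) u z := by
    intro z hz
    rw [energyDensity, ← lintegral_const_mul' _ _ ENNReal.ofReal_ne_top]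
    refine (setLIntegral_mono' hB fun y hy => ?_).trans (setLIntegral_le_lintegral _ _)
    have hz : dist (ι x) (ι z) < r := hz
    have hy : dist (ι x) (ι y) < r := hy
    have h1 := dist_triangle_left (ι z) (ι y) (ι x)
    exact ofReal_norm_rpow_le_mul_pairEnergy hinj hp (by positivity) (by linarith)
  set E := ∫⁻ y in B, energyDensity ι μ p (n + a) u y ∂μ
  have hint : ∫⁻ y in B, φ y ∂μ ≤ ENNReal.ofReal ((2 * r) ^ (n + a)) * E := by
    refine (setLIntegral_mono' hB hle).trans (le_of_eq ?_)
    exact lintegral_const_mul _ (measurable_energyDensity hι p _ hu)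
  calc _ ≤ (c⁻¹ : ℝ≥0) * ENNReal.ofReal (1 / r ^ n) * (ENNReal.ofReal ((2 * r) ^ (n + a)) * E) :=
        mul_le_mul_right hint _
    _ = (c⁻¹ : ℝ≥0) * ENNReal.ofReal ((2 * r) ^ (n + a) / r ^ n) * E := by
        rw [show (2 * r) ^ (n + a) / r ^ n = 1 / r ^ n * (2 * r) ^ (n + a) by ring,
          ENNReal.ofReal_mul (by positivity)]
        ring
    _ ≤ (c⁻¹ : ℝ≥0) * ENNReal.ofReal (2 ^ (n + p) * r ^ a) * E := by
        gcongr
        exact two_mul_rpow_div_le hr hap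
    _ = _ := by
        rw [ENNReal.ofReal_mul (by positivity)]
        push_cast
        rw [← mul_assoc]
        rfl

theorem ofReal_norm_add_rpow_le {F : Type*} [NormedAddCommGroup F] {p : ℝ} (hp : 0 < p) (a b : F) :
    ENNReal.ofReal (‖a + b‖ ^ p) ≤
      ((3 : ℝ) ^ p).toNNReal * (ENNReal.ofReal (‖a‖ ^ p) + ENNReal.ofReal (‖b‖ ^ p)) := by
  have h := norm_rpow_le_three hp a b 0
  rw [add_zero, norm_zero, Real.zero_rpow hp.ne', add_zero] at h
  rw [← ENNReal.ofReal_add (by positivity) (by positivity)]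
  change _ ≤ ENNReal.ofReal _ * _
  rw [← ENNReal.ofReal_mul (by positivity)]
  exact ENNReal.ofReal_le_ofReal h

end BallAverage

section Homotopy

variable {n L M : ℕ} {S : Type*} [EMetricSpace S] [ChartedSpace (EuclideanSpace ℝ (Fin n)) S]
  {N : Set (EuclideanSpace ℝ (Fin M))} {f g k : S → EuclideanSpace ℝ (Fin M)}

theorem SmoothHomotopic.symm (h : SmoothHomotopic n N f g) : SmoothHomotopic n N g f := by
  obtain ⟨H, hH, hN, h0, h1⟩ := h
  have hφ : ContMDiff (𝓘(ℝ, ℝ).prod (𝓡 n)) (𝓘(ℝ, ℝ).prod (𝓡 n)) ∞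
      fun z : ℝ × S => (1 - z.1, z.2) :=
    ((contDiff_const.sub contDiff_id).contMDiff.comp contMDiff_fst).prodMk contMDiff_snd
  have hmem : ∀ r ∈ Icc (0 : ℝ) 1, 1 - r ∈ Icc (0 : ℝ) 1 := fun r hr =>
    ⟨by linarith [hr.2], by linarith [hr.1]⟩
  refine ⟨fun z => H (1 - z.1, z.2), hH.comp hφ.contMDiffOn fun z hz => ⟨hmem _ hz.1, mem_univ _⟩,
    fun r hr x => hN _ (hmem r hr) x, fun x => ?_, fun x => ?_⟩
  · simpa using h1 x
  · simpa using h0 x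

theorem SmoothHomotopic.trans (h : SmoothHomotopic n N f g) (h' : SmoothHomotopic n N g k) :
    SmoothHomotopic n N f k := by
  obtain ⟨H, hH, hN, h0, h1⟩ := h
  obtain ⟨H', hH', hN', h0', h1'⟩ := h'
  have hmem : ∀ r, Real.smoothTransition r ∈ Icc (0 : ℝ) 1 := fun r =>
    ⟨Real.smoothTransition.nonneg r, Real.smoothTransition.le_one r⟩
  -- Smooth concatenation: `b = 0` finishes the first homotopy at time `1 / 3`, `b = 2` starts the
  -- second at `2 / 3`. On the plateau between, both formulas equal `g`, so the glued map is smooth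
  -- across `1 / 2`.
  have hφ : ∀ b : ℝ, ContMDiff (𝓘(ℝ, ℝ).prod (𝓡 n)) (𝓘(ℝ, ℝ).prod (𝓡 n)) ∞
      fun z : ℝ × S => (Real.smoothTransition (3 * z.1 - b), z.2) := fun b =>
    ((Real.smoothTransition.contDiff.comp
      ((contDiff_const.mul contDiff_id).sub contDiff_const)).contMDiff.comp contMDiff_fst).prodMk
      contMDiff_snd
  have hs : ContMDiff (𝓘(ℝ, ℝ).prod (𝓡 n)) 𝓘(ℝ, EuclideanSpace ℝ (Fin M)) ∞
      fun z : ℝ × S => H (Real.smoothTransition (3 * z.1 - 0), z.2) :=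
    hH.comp_contMDiff (hφ 0) fun z => ⟨hmem _, mem_univ _⟩
  have hs' : ContMDiff (𝓘(ℝ, ℝ).prod (𝓡 n)) 𝓘(ℝ, EuclideanSpace ℝ (Fin M)) ∞
      fun z : ℝ × S => H' (Real.smoothTransition (3 * z.1 - 2), z.2) :=
    hH'.comp_contMDiff (hφ 2) fun z => ⟨hmem _, mem_univ _⟩
  set G : ℝ × S → EuclideanSpace ℝ (Fin M) := fun z =>
    if z.1 ≤ 1 / 2 then H (Real.smoothTransition (3 * z.1 - 0), z.2)
    else H' (Real.smoothTransition (3 * z.1 - 2), z.2)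
  have hG1 : ∀ z : ℝ × S, z.1 < 2 / 3 →
      G z = H (Real.smoothTransition (3 * z.1 - 0), z.2) := by
    intro z hz
    by_cases hz' : z.1 ≤ 1 / 2
    · exact if_pos hz'
    · rw [show G z = _ from if_neg hz', Real.smoothTransition.zero_of_nonpos (by linarith),
        Real.smoothTransition.one_of_one_le (by linarith), h0', h1]
  have hG2 : ∀ z : ℝ × S, 1 / 3 < z.1 →
      G z = H' (Real.smoothTransition (3 * z.1 - 2), z.2) := by
    intro z hz
    by_cases hz' : z.1 ≤ 1 / 2
    · rw [show G z = _ from if_pos hz', Real.smoothTransition.one_of_one_le (by linarith),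
        Real.smoothTransition.zero_of_nonpos (by linarith), h0', h1]
    · exact if_neg hz'
  refine ⟨G, fun z _ => ContMDiffAt.contMDiffWithinAt ?_, fun r _ x => ?_, fun x => ?_, fun x => ?_⟩
  · rcases lt_or_ge z.1 (1 / 2) with hz | hz
    · refine (hs z).congr_of_eventuallyEq ?_
      filter_upwards [(isOpen_lt continuous_fst continuous_const).mem_nhds
        (show z.1 < 2 / 3 by linarith)] with y hy using hG1 y hy
    · refine (hs' z).congr_of_eventuallyEq ?_
      filter_upwards [(isOpen_lt continuous_const continuous_fst).mem_nhds
        (show 1 / 3 < z.1 by linarith)] with y hy using hG2 y hy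
  · simp only [G]
    split_ifs
    · exact hN _ (hmem _) _
    · exact hN' _ (hmem _) _
  · rw [hG1 _ (by norm_num), Real.smoothTransition.zero_of_nonpos (by norm_num), h0]
  · rw [hG2 _ (by norm_num), Real.smoothTransition.one_of_one_le (by norm_num), h1']

/-- Maps which are pointwise close to a common point of `N` have homotopic projections. -/
theorem IsTubularRetraction.smoothHomotopic {δ : ℝ} {K : ℝ≥0}
    {P : EuclideanSpace ℝ (Fin M) → EuclideanSpace ℝ (Fin M)} (hP : IsTubularRetraction N δ K P)
    (hf : ContMDiff (𝓡 n) 𝓘(ℝ, EuclideanSpace ℝ (Fin M)) ∞ f)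
    (hg : ContMDiff (𝓡 n) 𝓘(ℝ, EuclideanSpace ℝ (Fin M)) ∞ g)
    (h : ∀ x, ∃ e ∈ N, ‖f x - e‖ < δ ∧ ‖g x - e‖ < δ) :
    SmoothHomotopic n N (P ∘ f) (P ∘ g) := by
  set F : ℝ × S → EuclideanSpace ℝ (Fin M) := fun z => (1 - z.1) • f z.2 + z.1 • g z.2
  have hF : ContMDiff (𝓘(ℝ, ℝ).prod (𝓡 n)) 𝓘(ℝ, EuclideanSpace ℝ (Fin M)) ∞ F :=
    ((contMDiff_const.sub contMDiff_fst).smul (hf.comp contMDiff_snd)).add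
      (contMDiff_fst.smul (hg.comp contMDiff_snd))
  have hmem : ∀ r ∈ Icc (0 : ℝ) 1, ∀ x, F (r, x) ∈ Metric.thickening δ N := by
    intro r hr x
    obtain ⟨e, he, h1, h2⟩ := h x
    refine Metric.mem_thickening_iff.2 ⟨e, he, ?_⟩
    have h3 : F (r, x) ∈ Metric.ball e δ :=
      convex_ball e δ (mem_ball_iff_norm.2 h1) (mem_ball_iff_norm.2 h2)
        (by linarith [hr.2]) hr.1 (by ring)
    exact h3
  refine ⟨fun z => P (F z), fun z hz => ContMDiffAt.contMDiffWithinAt ?_, fun r _ x => hP.mem _,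
    fun x => by simp [F], fun x => by simp [F]⟩
  exact (hP.contDiffAt _ (hmem z.1 hz.1 z.2)).contMDiffAt.comp z (hF z)

end Homotopy

section SmoothAverage

set_option linter.unusedSectionVars false

variable {n L M : ℕ} {S : Type*} [EMetricSpace S] [CompactSpace S] [MeasurableSpace S]
  [BorelSpace S] [ChartedSpace (EuclideanSpace ℝ (Fin n)) S] [IsManifold (𝓡 n) ∞ S]
  {ι : S → EuclideanSpace ℝ (Fin L)} {μ : Measure S} [IsFiniteMeasure μ] {c C : ℝ≥0}

/-- A partition of unity subordinate to balls of radius `r / 2` combines constant ball averages into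
a smooth map. At `x` only averages over balls contained in that of radius `r` about `x` enter, so
any bound defining a convex set passes to `F x`. -/
theorem exists_smooth_average (hι : Continuous ι) (hA : IsAhlfors n ι μ c C) {p : ℝ}
    (hp : 1 < p) :
    ∃ K : ℝ≥0, ∀ r, 0 < r → r ≤ 1 → ∀ f : S → EuclideanSpace ℝ (Fin M), Integrable f μ →
      ∃ F : S → EuclideanSpace ℝ (Fin M), ContMDiff (𝓡 n) 𝓘(ℝ, EuclideanSpace ℝ (Fin M)) ∞ F ∧
        ∀ x e, ENNReal.ofReal (‖F x - e‖ ^ p) ≤ K * ENNReal.ofReal (1 / r ^ n) *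
          ∫⁻ z in iball ι x r, ENNReal.ofReal (‖f z - e‖ ^ p) ∂μ := by
  obtain ⟨K, hK⟩ := exists_ballAverage_sub_rpow_le (M := M) hA hp
  refine ⟨K * 2 ^ n, fun r hr hr1 f hf => ?_⟩
  have hp0 : 0 < p := by linarith
  obtain ⟨ψ, hψ⟩ := SmoothPartitionOfUnity.exists_isSubordinate (𝓡 n) (isClosed_univ (X := S))
    (fun y : S => iball ι y (r / 2))
    (fun y => isOpen_lt (continuous_const.dist hι) continuous_const)
    (fun x _ => mem_iUnion.2 ⟨x, show dist (ι x) (ι x) < r / 2 by rw [dist_self]; positivity⟩)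
  refine ⟨fun x => ∑ᶠ y, ψ y x • ⨍ z in iball ι y (r / 2), f z ∂μ,
    ψ.contMDiff_finsum_smul (n := ⊤) (g := fun y _ => ⨍ z in iball ι y (r / 2), f z ∂μ)
      fun y x _ => contMDiffAt_const, fun x e => ?_⟩
  set b := (K * 2 ^ n : ℝ≥0) * ENNReal.ofReal (1 / r ^ n) *
    ∫⁻ z in iball ι x r, ENNReal.ofReal (‖f z - e‖ ^ p) ∂μ
  rcases eq_or_ne b ⊤ with hb | hb
  · rw [hb]; exact le_top
  have hball : ∀ v : EuclideanSpace ℝ (Fin M), v ∈ Metric.closedBall e (b.toReal ^ (1 / p)) ↔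
      ENNReal.ofReal (‖v - e‖ ^ p) ≤ b := by
    intro v
    rw [mem_closedBall_iff_norm, ENNReal.ofReal_le_iff_le_toReal hb, one_div,
      Real.le_rpow_inv_iff_of_pos (norm_nonneg _) ENNReal.toReal_nonneg hp0]
  rw [← hball]
  refine ψ.finsum_smul_mem_convex (g := fun y _ => ⨍ z in iball ι y (r / 2), f z ∂μ) (mem_univ x)
    (fun y hy => ?_) (convex_closedBall e (b.toReal ^ (1 / p)))
  rw [hball]
  have hxy : dist (ι y) (ι x) < r / 2 := hψ y (subset_tsupport _ hy)
  have hsub : iball ι y (r / 2) ⊆ iball ι x r := fun z hz => by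
    have hz : dist (ι y) (ι z) < r / 2 := hz
    have := dist_triangle_left (ι x) (ι z) (ι y)
    show dist (ι x) (ι z) < r
    linarith
  refine (hK f hf y (r / 2) (by positivity) (by linarith) e).trans ?_
  have h2 : ENNReal.ofReal (1 / (r / 2) ^ n) = 2 ^ n * ENNReal.ofReal (1 / r ^ n) := by
    rw [div_pow, show 1 / (r ^ n / 2 ^ n) = 2 ^ n * (1 / r ^ n) by field_simp,
      ENNReal.ofReal_mul (by positivity), ENNReal.ofReal_pow (by norm_num)]
    simp
  rw [h2, ← mul_assoc]
  simp only [b]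
  push_cast
  exact mul_le_mul_right (lintegral_mono_set hsub) _

/-- Uniform continuity for the chordal distance, which attains a positive minimum on the compact set
of pairs where `f` varies by at least `τ`. -/
theorem exists_norm_sub_lt_of_dist_lt (hι : Continuous ι) (hinj : Function.Injective ι)
    {f : S → EuclideanSpace ℝ (Fin M)} (hf : Continuous f) {τ : ℝ} (hτ : 0 < τ) :
    ∃ r, 0 < r ∧ ∀ x y, dist (ι x) (ι y) < r → ‖f y - f x‖ < τ := by
  set s : Set (S × S) := {z | τ ≤ ‖f z.2 - f z.1‖}
  have hs : IsCompact s := (isClosed_le continuous_const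
    ((hf.comp continuous_snd).sub (hf.comp continuous_fst)).norm).isCompact
  rcases s.eq_empty_or_nonempty with h0 | hne
  · refine ⟨1, one_pos, fun x y _ => ?_⟩
    by_contra hxy
    have : (x, y) ∈ s := not_lt.1 hxy
    simp [h0] at this
  · obtain ⟨z, hz, hmin⟩ := hs.exists_isMinOn hne
      (f := fun z : S × S => dist (ι z.1) (ι z.2)) (by fun_prop)
    refine ⟨dist (ι z.1) (ι z.2), dist_pos.2 (hinj.ne fun h => ?_), fun x y hxy => ?_⟩
    · have : τ ≤ ‖f z.2 - f z.1‖ := hz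
      rw [h, sub_self, norm_zero] at this
      linarith
    · by_contra h
      have h1 : (x, y) ∈ s := not_lt.1 h
      exact absurd (hmin h1) (not_le.2 hxy)

end SmoothAverage

end FractionalHarmonic

/-! ### Homotopy of smooth maps with small local energy -/

namespace FractionalHarmonic

section SmoothHomotopy

set_option linter.unusedSectionVars false

variable {n L M : ℕ} {S : Type*} [EMetricSpace S] [CompactSpace S] [MeasurableSpace S]
  [BorelSpace S] [ChartedSpace (EuclideanSpace ℝ (Fin n)) S] [IsManifold (𝓡 n) ∞ S]
  {ι : S → EuclideanSpace ℝ (Fin L)} {μ : Measure S} [IsFiniteMeasure μ] {c C : ℝ≥0}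
  {N : Set (EuclideanSpace ℝ (Fin M))} {δ : ℝ} {KP : ℝ≥0}
  {P : EuclideanSpace ℝ (Fin M) → EuclideanSpace ℝ (Fin M)}

theorem lt_of_ofReal_rpow_le {a d p : ℝ} (hp : 0 < p) (ha : 0 ≤ a) (hd : 0 < d)
    (h : ENNReal.ofReal (a ^ p) ≤ ENNReal.ofReal ((d / 2) ^ p)) : a < d := by
  rw [ENNReal.ofReal_le_ofReal_iff (by positivity), Real.rpow_le_rpow_iff ha (by positivity) hp]
    at h
  linarith

/-- `F` is a smooth average of `f` at scale `r`. -/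
structure IsSmoothAverage (ι : S → EuclideanSpace ℝ (Fin L)) (μ : Measure S) (n : ℕ)
    [ChartedSpace (EuclideanSpace ℝ (Fin n)) S] (p : ℝ) (K : ℝ≥0) (r : ℝ)
    (f F : S → EuclideanSpace ℝ (Fin M)) : Prop where
  contMDiff : ContMDiff (𝓡 n) 𝓘(ℝ, EuclideanSpace ℝ (Fin M)) ∞ F
  le : ∀ x e, ENNReal.ofReal (‖F x - e‖ ^ p) ≤ K * ENNReal.ofReal (1 / r ^ n) *
    ∫⁻ z in iball ι x r, ENNReal.ofReal (‖f z - e‖ ^ p) ∂μ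

theorem IsSmoothAverage.le_mul {p r : ℝ} {K : ℝ≥0} {f F : S → EuclideanSpace ℝ (Fin M)}
    (hF : IsSmoothAverage ι μ n p K r f F) (hr : 0 < r) {x : S} {e : EuclideanSpace ℝ (Fin M)}
    {B : ℝ≥0∞}
    (h : ∫⁻ z in iball ι x r, ENNReal.ofReal (‖f z - e‖ ^ p) ∂μ ≤ B * ENNReal.ofReal (r ^ n)) :
    ENNReal.ofReal (‖F x - e‖ ^ p) ≤ K * B := by
  refine (hF.le x e).trans ((mul_le_mul_right h _).trans (le_of_eq ?_))
  have h1 : ENNReal.ofReal (1 / r ^ n) * ENNReal.ofReal (r ^ n) = 1 := by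
    rw [← ENNReal.ofReal_mul (by positivity), one_div_mul_cancel (by positivity),
      ENNReal.ofReal_one]
  calc _ = K * B * (ENNReal.ofReal (1 / r ^ n) * ENNReal.ofReal (r ^ n)) := by ring
    _ = _ := by rw [h1, mul_one]

/-- A smooth map into `N` is homotopic to the projections of its averages at small scales. -/
theorem IsSmoothInto.eventually_smoothHomotopic_average {f : S → EuclideanSpace ℝ (Fin M)}
    (hf : IsSmoothInto n N f) (hι : Continuous ι) (hinj : Function.Injective ι)
    (hA : IsAhlfors n ι μ c C) {p : ℝ} (hp : 0 < p) (hδ : 0 < δ)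
    (hP : IsTubularRetraction N δ KP P) (K : ℝ≥0) :
    ∃ ρ, 0 < ρ ∧ ∀ r, 0 < r → r < ρ → ∀ F, IsSmoothAverage ι μ n p K r f F →
      SmoothHomotopic n N f (P ∘ F) := by
  set τ : ℝ := ((δ / 2) ^ p / (K * C + 1)) ^ (1 / p)
  have hτ : 0 < τ := by positivity
  have hτp : τ ^ p = (δ / 2) ^ p / (K * C + 1) := by
    rw [← Real.rpow_mul (by positivity), one_div_mul_cancel hp.ne', Real.rpow_one]
  obtain ⟨ρ, hρ, h⟩ := exists_norm_sub_lt_of_dist_lt hι hinj hf.1.continuous hτ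
  refine ⟨ρ, hρ, fun r hr hrρ F hF => ?_⟩
  have hPf : P ∘ f = f := funext fun x => hP.eq_self _ (hf.2 x)
  rw [← hPf]
  refine hP.smoothHomotopic hf.1 hF.contMDiff fun x => ⟨f x, hf.2 x, by simpa using hδ, ?_⟩
  refine lt_of_ofReal_rpow_le hp (norm_nonneg _) hδ ?_
  have h1 : ∫⁻ z in iball ι x r, ENNReal.ofReal (‖f z - f x‖ ^ p) ∂μ ≤
      ENNReal.ofReal (τ ^ p) * C * ENNReal.ofReal (r ^ n) := by
    refine (setLIntegral_le_const_mul (measurableSet_iball hι.measurable _ _)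
      (b := ENNReal.ofReal (τ ^ p)) fun z hz => ?_).trans ?_
    · have hz : dist (ι x) (ι z) < r := hz
      have := (h x z (hz.trans hrρ)).le
      gcongr
    · rw [mul_assoc, ENNReal.ofReal_pow hr.le]
      exact mul_le_mul_right (hA.measure_le x r hr) _
  refine (hF.le_mul hr h1).trans ?_
  rw [hτp, ← ENNReal.ofReal_coe_nnreal (p := K), ← ENNReal.ofReal_coe_nnreal (p := C),
    ← ENNReal.ofReal_mul (by positivity), ← ENNReal.ofReal_mul (by positivity)]
  refine ENNReal.ofReal_le_ofReal ?_
  have : (K : ℝ) * ((δ / 2) ^ p / (K * C + 1) * C) = (δ / 2) ^ p * (K * C / (K * C + 1)) := by ring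
  rw [this]
  refine mul_le_of_le_one_right (by positivity) ?_
  rw [div_le_one (by positivity)]
  linarith

theorem ofReal_half_pow (r : ℝ) :
    ENNReal.ofReal (r ^ n) = (2 ^ n : ℝ≥0) * ENNReal.ofReal ((r / 2) ^ n) := by
  rw [← ENNReal.ofReal_coe_nnreal, ← ENNReal.ofReal_mul (by positivity)]
  congr 1
  push_cast
  rw [← mul_pow]
  congr 1
  ring

/-- Smooth maps into `N` with small energy on balls of radius `r₀` which are `L^p`-close at scale
`r₀` are homotopic. -/
theorem exists_smoothHomotopic (hι : Continuous ι) (hinj : Function.Injective ι)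
    (hA : IsAhlfors n ι μ c C) {p : ℝ} (hp : 1 < p) (hnp : n ≤ p) (hδ : 0 < δ)
    (hP : IsTubularRetraction N δ KP P) :
    ∃ η : ℝ≥0, 0 < η ∧ ∀ r₀, 0 < r₀ → r₀ ≤ 1 → ∀ f g : S → EuclideanSpace ℝ (Fin M),
      IsSmoothInto n N f → IsSmoothInto n N g →
      (∀ x, ∫⁻ y in iball ι x r₀, energyDensity ι μ p (n + n) f y ∂μ ≤ η) →
      (∀ x, ∫⁻ y in iball ι x r₀, energyDensity ι μ p (n + n) g y ∂μ ≤ η) →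
      ∫⁻ x, ENNReal.ofReal (‖g x - f x‖ ^ p) ∂μ ≤ η * ENNReal.ofReal (r₀ ^ n) →
      SmoothHomotopic n N f g := by
  obtain ⟨K, hK⟩ := exists_smooth_average (M := M) hι hA hp
  obtain ⟨K', hK'⟩ := exists_good_point (M := M) hι.measurable hinj hA (p := p) (by linarith)
  have hp0 : 0 < p := by linarith
  set T : ℝ≥0 := ((3 : ℝ) ^ p).toNNReal
  -- The term `2 ^ n * K'` pays for averaging at scale `r / 2` while the energy is measured at scale
  -- `r`; `T * (1 + K')` comes from writing `g - f z` as `(g - f) + (f - f z)`.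
  set Q : ℝ≥0 := K * (2 ^ n * K' + T * (1 + K')) + 1
  set η : ℝ≥0 := ((δ / 2) ^ p).toNNReal / Q
  have hQ : 0 < Q := by positivity
  have hη : 0 < η := div_pos (Real.toNNReal_pos.2 (by positivity)) hQ
  have hQη : ∀ B : ℝ≥0, B ≤ 2 ^ n * K' + T * (1 + K') → (K : ℝ≥0∞) * (B * η : ℝ≥0) ≤
      ENNReal.ofReal ((δ / 2) ^ p) := by
    intro B hB
    change _ ≤ (((δ / 2) ^ p).toNNReal : ℝ≥0∞)
    norm_cast
    calc K * (B * η) ≤ Q * η := by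
          rw [← mul_assoc]
          gcongr
          exact (mul_le_mul_right hB K).trans le_self_add
      _ = _ := mul_div_cancel₀ _ hQ.ne'
  have hgood : ∀ f : S → EuclideanSpace ℝ (Fin M), IsSmoothInto n N f → ∀ r, 0 < r → r ≤ 1 →
      (∀ x, ∫⁻ y in iball ι x r, energyDensity ι μ p (n + n) f y ∂μ ≤ η) → ∀ x, ∃ z,
      ∫⁻ y in iball ι x r, ENNReal.ofReal (‖f y - f z‖ ^ p) ∂μ ≤
        (K' * η : ℝ≥0) * ENNReal.ofReal (r ^ n) := by
    intro f hf r hr hr1 hfE x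
    obtain ⟨z, hz⟩ := hK' n (by positivity) hnp f hf.1.continuous.measurable x r hr hr1
    refine ⟨z, hz.trans ((mul_le_mul_right (hfE x) _).trans (le_of_eq ?_))⟩
    rw [Real.rpow_natCast]
    push_cast
    ring
  have hmono : ∀ r r' : ℝ, r' ≤ r → ∀ x, iball ι x r' ⊆ iball ι x r := fun r r' h x y hy =>
    lt_of_lt_of_le (show dist (ι x) (ι y) < r' from hy) h
  have hint : ∀ f : S → EuclideanSpace ℝ (Fin M), IsSmoothInto n N f → Integrable f μ :=
    fun f hf => hf.1.continuous.integrable_of_hasCompactSupport (HasCompactSupport.of_compactSpace f)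
  -- Averages at scales `r` and `r / 2` about the same point are both within `δ` of one value `f z`,
  -- so their projections are homotopic.
  have hstep : ∀ f : S → EuclideanSpace ℝ (Fin M), IsSmoothInto n N f → ∀ r, 0 < r → r ≤ 1 →
      (∀ x, ∫⁻ y in iball ι x r, energyDensity ι μ p (n + n) f y ∂μ ≤ η) → ∀ F F',
      IsSmoothAverage ι μ n p K r f F → IsSmoothAverage ι μ n p K (r / 2) f F' →
      SmoothHomotopic n N (P ∘ F') (P ∘ F) := by
    intro f hf r hr hr1 hfE F F' hF hF'
    refine hP.smoothHomotopic hF'.contMDiff hF.contMDiff fun x => ?_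
    obtain ⟨z, hz⟩ := hgood f hf r hr hr1 hfE x
    refine ⟨f z, hf.2 z, lt_of_ofReal_rpow_le hp0 (norm_nonneg _) hδ ?_,
      lt_of_ofReal_rpow_le hp0 (norm_nonneg _) hδ ?_⟩
    · refine (hF'.le_mul (by positivity) (B := (2 ^ n * K' * η : ℝ≥0)) ?_).trans
        (hQη _ le_self_add)
      refine (lintegral_mono_set (hmono r (r / 2) (by linarith) x)).trans (hz.trans (le_of_eq ?_))
      rw [ofReal_half_pow r]
      push_cast
      ring
    · refine (hF.le_mul hr hz).trans (hQη _ (le_trans ?_ le_self_add))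
      exact le_mul_of_one_le_left (by positivity) (one_le_pow₀ (by norm_num))
  have hself : ∀ f : S → EuclideanSpace ℝ (Fin M), IsSmoothInto n N f → ∀ r, 0 < r → r ≤ 1 →
      (∀ x, ∫⁻ y in iball ι x r, energyDensity ι μ p (n + n) f y ∂μ ≤ η) →
      ∃ F, IsSmoothAverage ι μ n p K r f F ∧ SmoothHomotopic n N f (P ∘ F) := by
    intro f hf r hr hr1 hfE
    have hr' : ∀ k : ℕ, r / 2 ^ k ≤ r := fun k => div_le_self hr.le (one_le_pow₀ (by norm_num))
    have : ∀ k : ℕ, ∃ F, IsSmoothAverage ι μ n p K (r / 2 ^ k) f F := fun k => by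
      obtain ⟨F, h1, h2⟩ := hK (r / 2 ^ k) (by positivity) ((hr' k).trans hr1) f (hint f hf)
      exact ⟨F, h1, h2⟩
    choose F hF using this
    obtain ⟨ρ, hρ, h⟩ := hf.eventually_smoothHomotopic_average hι hinj hA hp0 hδ hP K
    -- The number of halvings needed depends on the modulus of continuity of `f`, but the energy
    -- threshold `η` does not.
    have hind : ∀ k : ℕ, SmoothHomotopic n N f (P ∘ F k) → SmoothHomotopic n N f (P ∘ F 0) := by
      intro k
      induction k with
      | zero => exact id
      | succ k ih =>
        intro hk
        refine ih (hk.trans (hstep f hf (r / 2 ^ k) (by positivity) ((hr' k).trans hr1)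
          (fun x => (lintegral_mono_set (hmono _ _ (hr' k) x)).trans (hfE x)) _ _ (hF k) ?_))
        have := hF (k + 1)
        rwa [pow_succ, ← div_div] at this
    obtain ⟨k, hk⟩ := exists_pow_lt_of_lt_one (div_pos hρ hr) (by norm_num : (1 / 2 : ℝ) < 1)
    refine ⟨F 0, by simpa using hF 0, hind k (h _ (by positivity) ?_ _ (hF k))⟩
    rw [lt_div_iff₀ hr] at hk
    calc r / 2 ^ k = (1 / 2) ^ k * r := by rw [div_pow, one_pow]; ring
      _ < ρ := hk
  refine ⟨η, hη, fun r₀ hr hr1 f g hf hg hfE hgE hfg => ?_⟩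
  obtain ⟨F, hF, hfF⟩ := hself f hf r₀ hr hr1 hfE
  obtain ⟨G, hG, hgG⟩ := hself g hg r₀ hr hr1 hgE
  refine (hfF.trans (hP.smoothHomotopic hF.contMDiff hG.contMDiff fun x => ?_)).trans hgG.symm
  obtain ⟨z, hz⟩ := hgood f hf r₀ hr hr1 hfE x
  refine ⟨f z, hf.2 z, lt_of_ofReal_rpow_le hp0 (norm_nonneg _) hδ ?_,
    lt_of_ofReal_rpow_le hp0 (norm_nonneg _) hδ ?_⟩
  · refine (hF.le_mul hr hz).trans (hQη _ (le_trans ?_ le_self_add))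
    exact le_mul_of_one_le_left (by positivity) (one_le_pow₀ (by norm_num))
  · refine (hG.le_mul hr (B := (T * (1 + K') * η : ℝ≥0)) ?_).trans (hQη _ le_add_self)
    calc _ ≤ ∫⁻ y in iball ι x r₀, T * (ENNReal.ofReal (‖g y - f y‖ ^ p) +
          ENNReal.ofReal (‖f y - f z‖ ^ p)) ∂μ := by
          refine lintegral_mono fun y => ?_
          rw [← sub_add_sub_cancel (g y) (f y) (f z)]
          exact ofReal_norm_add_rpow_le hp0 _ _
      _ = T * (∫⁻ y in iball ι x r₀, ENNReal.ofReal (‖g y - f y‖ ^ p) ∂μ +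
          ∫⁻ y in iball ι x r₀, ENNReal.ofReal (‖f y - f z‖ ^ p) ∂μ) := by
          rw [lintegral_const_mul' _ _ ENNReal.coe_ne_top, lintegral_add_left]
          exact ((hg.1.continuous.sub hf.1.continuous).norm.measurable.pow_const p).ennreal_ofReal
      _ ≤ T * (η * ENNReal.ofReal (r₀ ^ n) + (K' * η : ℝ≥0) * ENNReal.ofReal (r₀ ^ n)) := by
          gcongr
          exact (setLIntegral_le_lintegral _ _).trans hfg
      _ = _ := by
          push_cast
          ring

end SmoothHomotopy

end FractionalHarmonic

/-! ### From smooth to Sobolev homotopy -/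

namespace FractionalHarmonic

section EnergyComparison

set_option linter.unusedSectionVars false

variable {X : Type*} [MeasurableSpace X] {L M n : ℕ} {ι : X → EuclideanSpace ℝ (Fin L)}
  {μ : Measure X} [IsFiniteMeasure μ]

theorem energyDensity_add_le (hι : Measurable ι) {p : ℝ} (q : ℝ) (hp : 0 < p)
    {f g : X → EuclideanSpace ℝ (Fin M)} (hf : Measurable f) (x : X) :
    energyDensity ι μ p q (fun x => f x + g x) x ≤
      ((3 : ℝ) ^ p).toNNReal * (energyDensity ι μ p q f x + energyDensity ι μ p q g x) := by
  rw [energyDensity, energyDensity, energyDensity,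
    ← lintegral_add_left (measurable_pairEnergy_right hι p q hf x),
    ← lintegral_const_mul' _ _ ENNReal.coe_ne_top]
  refine lintegral_mono fun y => ?_
  have h := norm_rpow_le_three hp (f x - f y) (g x - g y) 0
  rw [add_zero, norm_zero, Real.zero_rpow hp.ne', add_zero] at h
  rw [pairEnergy, pairEnergy, pairEnergy, ← ENNReal.ofReal_add (by positivity) (by positivity)]
  change _ ≤ ENNReal.ofReal _ * _
  rw [← ENNReal.ofReal_mul (by positivity), ← add_div, mul_div_assoc', add_sub_add_comm]
  gcongr

/-- The kernels differ by the factor `dist ^ (a - n)`, at most `Δ ^ p` on a bounded set. Hence a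
small energy of order `t ≥ s` makes the critical energy small, which is the one that decides
homotopy. -/
theorem energyDensity_le_mul (hn : 1 ≤ n) {Δ : ℝ} (hΔ : 1 ≤ Δ) (hdist : ∀ x y, dist (ι x) (ι y) ≤ Δ)
    {p a : ℝ} (hna : n ≤ a) (hap : a ≤ p) (u : X → EuclideanSpace ℝ (Fin M)) (x : X) :
    energyDensity ι μ p (n + n) u x ≤ (Δ ^ p).toNNReal * energyDensity ι μ p (n + a) u x := by
  rw [energyDensity, energyDensity, ← lintegral_const_mul' _ _ ENNReal.coe_ne_top]
  refine lintegral_mono fun y => ?_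
  have hn0 : (0 : ℝ) ≤ n := by positivity
  rw [pairEnergy, pairEnergy]
  change _ ≤ ENNReal.ofReal _ * _
  rw [← ENNReal.ofReal_mul (by positivity)]
  refine ENNReal.ofReal_le_ofReal ?_
  rcases (dist_nonneg (x := ι x) (y := ι y)).eq_or_lt with h0 | h0
  · have hn1 : (1 : ℝ) ≤ n := by exact_mod_cast hn
    rw [← h0, Real.zero_rpow (by linarith : (n : ℝ) + n ≠ 0), div_zero]
    positivity
  · have h1 : dist (ι x) (ι y) ^ (n + a) ≤ Δ ^ p * dist (ι x) (ι y) ^ ((n : ℝ) + n) := by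
      calc _ = dist (ι x) (ι y) ^ (a - n) * dist (ι x) (ι y) ^ ((n : ℝ) + n) := by
            rw [← Real.rpow_add h0]; congr 1; ring
        _ ≤ Δ ^ p * dist (ι x) (ι y) ^ ((n : ℝ) + n) := by
            refine mul_le_mul_of_nonneg_right ?_ (by positivity)
            exact (Real.rpow_le_rpow h0.le (hdist x y) (by linarith)).trans
              (Real.rpow_le_rpow_of_exponent_le hΔ (by linarith))
    rw [mul_div_assoc', div_le_div_iff₀ (by positivity) (by positivity)]
    calc _ ≤ ‖u x - u y‖ ^ p * (Δ ^ p * dist (ι x) (ι y) ^ ((n : ℝ) + n)) := by gcongr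
      _ = _ := by ring

end EnergyComparison

section Sobolev

variable {n L M : ℕ} {S : Type*} [EMetricSpace S] [CompactSpace S] [MeasurableSpace S]
  [BorelSpace S] [ChartedSpace (EuclideanSpace ℝ (Fin n)) S] [IsManifold (𝓡 n) ∞ S]
  {ι : S → EuclideanSpace ℝ (Fin L)} [IsFiniteMeasure (μHE[n] : Measure S)] {c C : ℝ≥0}
  {N : Set (EuclideanSpace ℝ (Fin M))} {δ : ℝ} {KP : ℝ≥0}
  {P : EuclideanSpace ℝ (Fin M) → EuclideanSpace ℝ (Fin M)}

theorem energy_eq_lintegral_energyDensity {S : Type*} [EMetricSpace S] [MeasurableSpace S]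
    [BorelSpace S] (ι : S → EuclideanSpace ℝ (Fin L)) (t p : ℝ)
    (u : S → EuclideanSpace ℝ (Fin M)) :
    energy n ι t p u = ∫⁻ x, energyDensity ι (μHE[n] : Measure S) p (n + t * p) u x ∂μHE[n] := by
  simp only [energy, energyDensity, pairEnergy, dist_eq_norm]

theorem lintegral_ofReal_rpow_eq_eLpNorm_rpow {X : Type*} [MeasurableSpace X] {μ : Measure X}
    {p : ℝ} (hp : 0 < p) (f : X → EuclideanSpace ℝ (Fin M)) :
    ∫⁻ x, ENNReal.ofReal (‖f x‖ ^ p) ∂μ = eLpNorm f (ENNReal.ofReal p) μ ^ p := by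
  rw [eLpNorm_eq_lintegral_rpow_enorm_toReal (ENNReal.ofReal_pos.2 hp).ne' ENNReal.ofReal_ne_top,
    ENNReal.toReal_ofReal hp.le, ← ENNReal.rpow_mul, one_div_mul_cancel hp.ne', ENNReal.rpow_one]
  refine lintegral_congr fun x => ?_
  rw [← ENNReal.ofReal_rpow_of_nonneg (norm_nonneg _) hp.le, ofReal_norm]

theorem IsSmoothApprox.eventually_le {S : Type*} [EMetricSpace S] [MeasurableSpace S]
    [BorelSpace S] [ChartedSpace (EuclideanSpace ℝ (Fin n)) S] {ι : S → EuclideanSpace ℝ (Fin L)}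
    {s p : ℝ} (hp : 0 < p) {u : S → EuclideanSpace ℝ (Fin M)}
    {w : ℝ → S → EuclideanSpace ℝ (Fin M)} (h : IsSmoothApprox n ι N s p u w) {b : ℝ≥0∞}
    (hb : b ≠ 0) :
    ∀ᶠ ε in 𝓝[>] (0 : ℝ), ∫⁻ x, ENNReal.ofReal (‖w ε x - u x‖ ^ p) ∂(μHE[n] : Measure S) ≤ b ∧
      energy n ι s p (fun x => w ε x - u x) ≤ b := by
  have hb' : b ^ (1 / p) ≠ 0 := by
    rw [Ne, ENNReal.rpow_eq_zero_iff_of_pos (by positivity)]; exact hb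
  filter_upwards [h.2.eventually (Iio_mem_nhds (pos_iff_ne_zero.2 hb'))] with ε hε
  have hε : sobolevNorm n ι s p (fun x => w ε x - u x) < b ^ (1 / p) := hε
  have key : ∀ z : ℝ≥0∞, z ^ (1 / p) ≤ b ^ (1 / p) → z ≤ b := fun z hz =>
    (ENNReal.rpow_le_rpow_iff (by positivity)).1 hz
  refine ⟨key _ ?_, key _ (le_add_self.trans hε.le)⟩
  rw [lintegral_ofReal_rpow_eq_eLpNorm_rpow hp, ← ENNReal.rpow_mul, mul_one_div_cancel hp.ne',
    ENNReal.rpow_one]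
  exact le_self_add.trans hε.le

/-- Maps with small energy on balls of radius `r₀` which are `L^p`-close at scale `r₀` are
homotopic. -/
theorem exists_sobolevHomotopic (hι : Continuous ι) (hinj : Function.Injective ι)
    (hA : IsAhlfors n ι (μHE[n] : Measure S) c C) {s : ℝ} (hs : 0 < s) (hs1 : s < 1) (hn : 1 ≤ n)
    (hδ : 0 < δ) (hP : IsTubularRetraction N δ KP P) :
    ∃ η : ℝ≥0, 0 < η ∧ ∀ r₀, 0 < r₀ → r₀ ≤ 1 → ∀ u v : S → EuclideanSpace ℝ (Fin M),
      Measurable u → Measurable v →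
      (∀ x, ∫⁻ y in iball ι x r₀, energyDensity ι (μHE[n] : Measure S) (n / s) (n + n) u y ∂μHE[n]
        ≤ η) →
      (∀ x, ∫⁻ y in iball ι x r₀, energyDensity ι (μHE[n] : Measure S) (n / s) (n + n) v y ∂μHE[n]
        ≤ η) →
      ∫⁻ x, ENNReal.ofReal (‖v x - u x‖ ^ (n / s : ℝ)) ∂(μHE[n] : Measure S) ≤
        η * ENNReal.ofReal (r₀ ^ n) →
      SobolevHomotopic n ι N s (n / s) u v := by
  have hn1 : (1 : ℝ) ≤ n := by exact_mod_cast hn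
  set p : ℝ := n / s
  have hp : 1 < p := by rw [lt_div_iff₀ hs]; linarith
  have hp0 : 0 < p := by linarith
  have hnp : n ≤ p := by rw [le_div_iff₀ hs]; nlinarith
  have hsp : s * p = n := mul_div_cancel₀ _ hs.ne'
  obtain ⟨η₀, hη₀, hhom⟩ := exists_smoothHomotopic hι hinj hA hp hnp hδ hP
  set T : ℝ≥0 := ((3 : ℝ) ^ p).toNNReal
  have hT : 0 < T := Real.toNNReal_pos.2 (by positivity)
  -- Room for three terms: `vε - uε` passes through `v` and `u`, and `T` is the constant of the
  -- triangle inequality for `p`-th powers.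
  set η : ℝ≥0 := η₀ / (3 * T)
  have hη : 0 < η := by positivity
  have hTη : T * (3 * η) = η₀ := by simp only [η]; field_simp
  refine ⟨η, hη, fun r₀ hr hr1 u v hu hv huE hvE huv uε vε huε hvε => ?_⟩
  have hrn : ENNReal.ofReal (r₀ ^ n) ≤ 1 := by
    rw [ENNReal.ofReal_le_one]
    exact pow_le_one₀ hr.le hr1
  have hb : (η : ℝ≥0∞) * ENNReal.ofReal (r₀ ^ n) ≠ 0 :=
    mul_ne_zero (ENNReal.coe_ne_zero.2 hη.ne') (ENNReal.ofReal_pos.2 (by positivity)).ne'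
  obtain ⟨ε₀, hε₀, h⟩ := mem_nhdsGT_iff_exists_Ioo_subset.1
    ((huε.eventually_le hp0 hb).and (hvε.eventually_le hp0 hb))
  -- A smooth map close to `g` in the seminorm inherits small energy on every ball of radius `r₀`.
  have hE : ∀ f g : S → EuclideanSpace ℝ (Fin M), Measurable f → Measurable g →
      (∀ x, ∫⁻ y in iball ι x r₀, energyDensity ι (μHE[n] : Measure S) p (n + n) g y ∂μHE[n]
        ≤ η) → energy n ι s p (fun x => f x - g x) ≤ η * ENNReal.ofReal (r₀ ^ n) → ∀ x,
      ∫⁻ y in iball ι x r₀, energyDensity ι (μHE[n] : Measure S) p (n + n) f y ∂μHE[n] ≤ η₀ := by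
    intro f g hf hg hgE hfg x
    rw [energy_eq_lintegral_energyDensity, hsp] at hfg
    calc _ ≤ ∫⁻ y in iball ι x r₀, T * (energyDensity ι (μHE[n] : Measure S) p (n + n)
          (fun x => f x - g x) y + energyDensity ι (μHE[n] : Measure S) p (n + n) g y) ∂μHE[n] := by
          refine lintegral_mono fun y => ?_
          have := energyDensity_add_le (μ := (μHE[n] : Measure S)) hι.measurable (n + n) hp0
            (f := fun x => f x - g x) (g := g) (hf.sub hg) y
          simpa only [sub_add_cancel] using this
      _ = T * (∫⁻ y in iball ι x r₀, energyDensity ι (μHE[n] : Measure S) p (n + n)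
          (fun x => f x - g x) y ∂μHE[n] +
          ∫⁻ y in iball ι x r₀, energyDensity ι (μHE[n] : Measure S) p (n + n) g y ∂μHE[n]) := by
          rw [lintegral_const_mul' _ _ ENNReal.coe_ne_top, lintegral_add_left]
          exact measurable_energyDensity hι.measurable _ _ (hf.sub hg)
      _ ≤ T * (η * 1 + η) := by
          gcongr
          · exact (setLIntegral_le_lintegral _ _).trans (hfg.trans (mul_le_mul_right hrn _))
          · exact hgE x
      _ ≤ T * (3 * η) := by
          gcongr
          calc (η : ℝ≥0∞) * 1 + η = 2 * η := by ring
            _ ≤ _ := by gcongr; norm_num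
      _ = η₀ := by rw [← hTη]; push_cast; rfl
  refine ⟨ε₀, hε₀, fun ε hε hε' => ?_⟩
  obtain ⟨⟨hu1, hu2⟩, hv1, hv2⟩ := h ⟨hε, hε'⟩
  have hum := (huε.1 ε hε).1.continuous.measurable
  have hvm := (hvε.1 ε hε).1.continuous.measurable
  refine hhom r₀ hr hr1 _ _ (huε.1 ε hε) (hvε.1 ε hε) (hE _ u hum hu huE hu2)
    (hE _ v hvm hv hvE hv2) ?_
  have h3 : ∀ x, ENNReal.ofReal (‖vε ε x - uε ε x‖ ^ p) ≤
      T * (ENNReal.ofReal (‖vε ε x - v x‖ ^ p) + ENNReal.ofReal (‖v x - u x‖ ^ p) +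
        ENNReal.ofReal (‖uε ε x - u x‖ ^ p)) := by
    intro x
    have := ofReal_three_point_le hp0 (vε ε x) (uε ε x) (v x) (u x) (d := 1) zero_le_one
    simpa using this
  calc _ ≤ ∫⁻ x, T * (ENNReal.ofReal (‖vε ε x - v x‖ ^ p) + ENNReal.ofReal (‖v x - u x‖ ^ p) +
        ENNReal.ofReal (‖uε ε x - u x‖ ^ p)) ∂(μHE[n] : Measure S) := lintegral_mono h3
    _ = T * (∫⁻ x, ENNReal.ofReal (‖vε ε x - v x‖ ^ p) ∂(μHE[n] : Measure S) +
        ∫⁻ x, ENNReal.ofReal (‖v x - u x‖ ^ p) ∂(μHE[n] : Measure S) +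
        ∫⁻ x, ENNReal.ofReal (‖uε ε x - u x‖ ^ p) ∂(μHE[n] : Measure S)) := by
        have m1 : Measurable fun x => ENNReal.ofReal (‖vε ε x - v x‖ ^ p) :=
          ((hvm.sub hv).norm.pow_const p).ennreal_ofReal
        have m2 : Measurable fun x => ENNReal.ofReal (‖v x - u x‖ ^ p) :=
          ((hv.sub hu).norm.pow_const p).ennreal_ofReal
        have m3 : Measurable fun x => ENNReal.ofReal (‖vε ε x - v x‖ ^ p) +
          ENNReal.ofReal (‖v x - u x‖ ^ p) := m1.add m2
        rw [lintegral_const_mul' _ _ ENNReal.coe_ne_top, lintegral_add_left m3,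
          lintegral_add_left m1]
    _ ≤ T * (η * ENNReal.ofReal (r₀ ^ n) + η * ENNReal.ofReal (r₀ ^ n) +
        η * ENNReal.ofReal (r₀ ^ n)) := by gcongr
    _ = (T * (3 * η) : ℝ≥0) * ENNReal.ofReal (r₀ ^ n) := by
        push_cast
        ring
    _ = _ := by rw [hTη]

end Sobolev

end FractionalHarmonic

/-! ### Campanato's criterion -/

namespace FractionalHarmonic

section Campanato

set_option linter.unusedSectionVars false

variable {X : Type*} [MeasurableSpace X] {L M n : ℕ} {ι : X → EuclideanSpace ℝ (Fin L)}
  {μ : Measure X} [IsFiniteMeasure μ] {c C : ℝ≥0}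

/-- Averages over comparable balls contained in a common ball are close to a common vector. -/
theorem exists_ballAverage_near (hι : Measurable ι) (hinj : Function.Injective ι)
    (hA : IsAhlfors n ι μ c C) {p : ℝ} (hp : 1 < p) {l : ℝ} (hl : 0 < l) :
    ∃ K : ℝ≥0, ∀ a : ℝ, n ≤ a → a ≤ p → ∀ u : X → EuclideanSpace ℝ (Fin M), Measurable u →
      Integrable u μ → ∀ x r, 0 < r → r ≤ 1 → ∃ e, ∀ y r', 0 < r' → r' ≤ 1 → l * r ≤ r' →
        iball ι y r' ⊆ iball ι x r →
        ENNReal.ofReal (‖(⨍ z in iball ι y r', u z ∂μ) - e‖ ^ p) ≤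
          K * ∫⁻ z in iball ι x r, energyDensity ι μ p (n + a) u z ∂μ := by
  obtain ⟨K₁, hK₁⟩ := exists_ballAverage_sub_rpow_le (M := M) (ι := ι) hA hp
  obtain ⟨K₂, hK₂⟩ := exists_good_point (M := M) hι hinj hA (p := p) (by linarith)
  refine ⟨K₁ * K₂ * (1 / l ^ n).toNNReal, fun a ha hap u hu hui x r hr hr1 => ?_⟩
  have ha0 : 0 ≤ a := le_trans (by positivity) ha
  obtain ⟨z, hz⟩ := hK₂ a ha0 hap u hu x r hr hr1
  refine ⟨u z, fun y r' hr' hr1' hlr hsub => ?_⟩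
  set E := ∫⁻ z in iball ι x r, energyDensity ι μ p (n + a) u z ∂μ
  calc _ ≤ K₁ * ENNReal.ofReal (1 / r' ^ n) *
        ∫⁻ w in iball ι y r', ENNReal.ofReal (‖u w - u z‖ ^ p) ∂μ := hK₁ u hui y r' hr' hr1' _
    _ ≤ K₁ * ENNReal.ofReal (1 / r' ^ n) * (K₂ * ENNReal.ofReal (r ^ a) * E) :=
        mul_le_mul_right ((lintegral_mono_set hsub).trans hz) _
    _ = K₁ * K₂ * (ENNReal.ofReal (1 / r' ^ n) * ENNReal.ofReal (r ^ a)) * E := by ring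
    _ ≤ K₁ * K₂ * ENNReal.ofReal (1 / l ^ n) * E := by
        gcongr
        rw [← ENNReal.ofReal_mul (by positivity)]
        refine ENNReal.ofReal_le_ofReal ?_
        have h1 : r ^ a ≤ r ^ n := by
          rw [← Real.rpow_natCast]
          exact Real.rpow_le_rpow_of_exponent_ge hr hr1 ha
        have h2 : (l * r) ^ n ≤ r' ^ n := by gcongr
        rw [one_div_mul_eq_div, div_le_div_iff₀ (by positivity) (by positivity), one_mul]
        calc r ^ a * l ^ n ≤ r ^ n * l ^ n := by gcongr
          _ = (l * r) ^ n := by rw [mul_pow, mul_comm]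
          _ ≤ r' ^ n := h2
    _ = _ := by
        push_cast
        rfl

/-- The averages of `u` converge to `u x` at points of finite energy density. -/
theorem tendsto_ballAverage (hι : Measurable ι) (hinj : Function.Injective ι)
    (hA : IsAhlfors n ι μ c C) {p a : ℝ} (hp : 1 < p) (ha : 0 < a)
    {u : X → EuclideanSpace ℝ (Fin M)} (hui : Integrable u μ) {x : X}
    (hx : energyDensity ι μ p (n + a) u x ≠ ⊤) {l : ℝ} (hl : 0 < l) (hl1 : l < 1) :
    Tendsto (fun k : ℕ => ⨍ z in iball ι x (l ^ k), u z ∂μ) atTop (𝓝 (u x)) := by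
  obtain ⟨K, hK⟩ := exists_ballAverage_sub_rpow_le (M := M) (ι := ι) hA hp
  have hp0 : 0 < p := by linarith
  have hb : ∀ k : ℕ, ENNReal.ofReal (‖(⨍ z in iball ι x (l ^ k), u z ∂μ) - u x‖ ^ p) ≤
      K * (ENNReal.ofReal ((l ^ k) ^ a) * energyDensity ι μ p (n + a) u x) := by
    intro k
    have hr : 0 < l ^ k := by positivity
    refine (hK u hui x _ hr (pow_le_one₀ hl.le hl1.le) (u x)).trans ?_
    have h1 : ∫⁻ z in iball ι x (l ^ k), ENNReal.ofReal (‖u z - u x‖ ^ p) ∂μ ≤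
        ENNReal.ofReal ((l ^ k) ^ (n + a)) * energyDensity ι μ p (n + a) u x := by
      rw [energyDensity, ← lintegral_const_mul' _ _ ENNReal.ofReal_ne_top]
      refine (setLIntegral_mono' (measurableSet_iball hι _ _) fun z hz => ?_).trans
        (setLIntegral_le_lintegral _ _)
      exact ofReal_norm_rpow_le_mul_pairEnergy hinj hp0 (by positivity)
        (show dist (ι x) (ι z) < l ^ k from hz).le
    refine (mul_le_mul_right h1 _).trans (le_of_eq ?_)
    rw [mul_assoc (K : ℝ≥0∞), ← mul_assoc (ENNReal.ofReal _), ← ENNReal.ofReal_mul (by positivity),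
      Real.rpow_add hr, Real.rpow_natCast, ← mul_assoc (1 / _), one_div_mul_cancel (by positivity),
      one_mul]
  have hlim : Tendsto (fun k : ℕ => K * (ENNReal.ofReal ((l ^ k) ^ a) *
      energyDensity ι μ p (n + a) u x)) atTop (𝓝 0) := by
    have h1 : Tendsto (fun k : ℕ => (l ^ k) ^ a) atTop (𝓝 0) := by
      have := (tendsto_pow_atTop_nhds_zero_of_lt_one hl.le hl1).rpow_const (p := a) (Or.inr ha.le)
      rwa [Real.zero_rpow ha.ne'] at this
    have h2 := ENNReal.tendsto_ofReal h1
    rw [ENNReal.ofReal_zero] at h2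
    have h3 := ENNReal.Tendsto.const_mul (a := (K : ℝ≥0∞))
      (ENNReal.Tendsto.mul_const h2 (Or.inr hx)) (Or.inr ENNReal.coe_ne_top)
    simpa using h3
  have h4 := tendsto_of_tendsto_of_tendsto_of_le_of_le tendsto_const_nhds hlim
    (fun k => zero_le) hb
  have h5 := (ENNReal.continuous_rpow_const (y := 1 / p)).tendsto 0 |>.comp h4
  rw [ENNReal.zero_rpow_of_pos (by positivity)] at h5
  rw [tendsto_iff_edist_tendsto_0]
  refine h5.congr fun k => ?_
  rw [Function.comp_apply, ENNReal.ofReal_rpow_of_nonneg (by positivity) (by positivity),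
    ← Real.rpow_mul (norm_nonneg _), mul_one_div_cancel hp0.ne', Real.rpow_one, edist_dist,
    dist_eq_norm]

theorem norm_le_of_ofReal_rpow_le {v : EuclideanSpace ℝ (Fin M)} {p : ℝ} (hp : 0 < p) {K B θ : ℝ≥0}
    {k : ℕ} (h : ENNReal.ofReal (‖v‖ ^ p) ≤ K * (B * θ ^ k : ℝ≥0)) :
    ‖v‖ ≤ ((K * B : ℝ) ^ (1 / p)) * ((θ : ℝ) ^ (1 / p)) ^ k := by
  have h1 : ‖v‖ ^ p ≤ K * B * (θ : ℝ) ^ k := by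
    have : (K * (B * θ ^ k : ℝ≥0) : ℝ≥0∞) = ENNReal.ofReal (K * B * (θ : ℝ) ^ k) := by
      rw [← ENNReal.coe_mul, ← ENNReal.ofReal_coe_nnreal]
      push_cast
      rw [mul_assoc]
    rw [this] at h
    exact (ENNReal.ofReal_le_ofReal_iff (by positivity)).1 h
  calc ‖v‖ = (‖v‖ ^ p) ^ (1 / p) := by
        rw [← Real.rpow_mul (norm_nonneg _), mul_one_div_cancel hp.ne', Real.rpow_one]
    _ ≤ (K * B * (θ : ℝ) ^ k) ^ (1 / p) := by gcongr
    _ = _ := by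
        rw [Real.mul_rpow (by positivity) (by positivity), Real.rpow_pow_comm θ.coe_nonneg]

/-- Campanato's criterion: geometric decay of the energy on balls implies Hölder continuity of the
limit of averages. -/
theorem exists_dist_limUnder_le (hι : Measurable ι) (hinj : Function.Injective ι)
    (hA : IsAhlfors n ι μ c C) {p a : ℝ} (hp : 1 < p) (hna : n ≤ a) (hap : a ≤ p)
    {u : X → EuclideanSpace ℝ (Fin M)} (hu : Measurable u) (hui : Integrable u μ)
    {l : ℝ} (hl : 0 < l) (hl1 : l < 1) {θ B : ℝ≥0} (hθ : θ < 1) {α : ℝ} (hα : 0 < α)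
    (hαθ : l ^ α = (θ : ℝ) ^ (1 / p)) {s : Set X}
    (hs : ∀ x ∈ s, ∀ k : ℕ, ∫⁻ y in iball ι x (l ^ k), energyDensity ι μ p (n + a) u y ∂μ ≤
      (B * θ ^ k : ℝ≥0)) :
    ∃ Q : ℝ≥0, ∀ x ∈ s, ∀ y ∈ s,
      dist (limUnder atTop fun k : ℕ => ⨍ z in iball ι x (l ^ k), u z ∂μ)
        (limUnder atTop fun k : ℕ => ⨍ z in iball ι y (l ^ k), u z ∂μ) ≤
      Q * dist (ι x) (ι y) ^ α := by
  have hp0 : 0 < p := by linarith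
  obtain ⟨K, hK⟩ := exists_ballAverage_near (M := M) hι hinj hA hp hl
  set m : X → ℕ → EuclideanSpace ℝ (Fin M) := fun x k => ⨍ z in iball ι x (l ^ k), u z ∂μ
  set w : X → EuclideanSpace ℝ (Fin M) := fun x => limUnder atTop (m x)
  set β : ℝ := (θ : ℝ) ^ (1 / p)
  set b : ℝ := (K * B : ℝ) ^ (1 / p)
  have hb : 0 ≤ b := by positivity
  have hβ0 : 0 ≤ β := by positivity
  have hβ1 : β < 1 := Real.rpow_lt_one θ.coe_nonneg (by exact_mod_cast hθ) (by positivity)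
  have hpow : ∀ k : ℕ, 0 < l ^ k ∧ l ^ k ≤ 1 := fun k =>
    ⟨by positivity, pow_le_one₀ hl.le hl1.le⟩
  -- The distance condition puts the ball of radius `l ^ (k + 1)` about `y` inside that of radius `l
  -- ^ k` about `x`. The case `y = x` compares consecutive generations; the general case links two
  -- centres.
  have hstep : ∀ x ∈ s, ∀ y, ∀ k : ℕ, dist (ι x) (ι y) ≤ (1 - l) * l ^ k →
      dist (m x k) (m y (k + 1)) ≤ 2 * b * β ^ k := by
    intro x hx y k hxy
    obtain ⟨e, he⟩ := hK a hna hap u hu hui x (l ^ k) (hpow k).1 (hpow k).2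
    have h1 := norm_le_of_ofReal_rpow_le hp0 ((he x (l ^ k) (hpow k).1 (hpow k).2
      (mul_le_of_le_one_left (hpow k).1.le hl1.le) subset_rfl).trans (mul_le_mul_right (hs x hx k) _))
    have h2 := norm_le_of_ofReal_rpow_le hp0 ((he y (l ^ (k + 1)) (hpow _).1 (hpow _).2
      (by rw [pow_succ, mul_comm]) (fun z hz => by
        have hz : dist (ι y) (ι z) < l ^ (k + 1) := hz
        have := dist_triangle (ι x) (ι y) (ι z)
        rw [pow_succ] at hz
        show dist (ι x) (ι z) < l ^ k
        linarith)).trans (mul_le_mul_right (hs x hx k) _))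
    have h3 := dist_triangle_right (m x k) (m y (k + 1)) e
    rw [dist_eq_norm _ e, dist_eq_norm _ e] at h3
    linarith
  have hlim : ∀ x ∈ s, ∀ k, dist (m x k) (w x) ≤ 2 * b * β ^ k / (1 - β) := by
    intro x hx k
    have h1 : ∀ k, dist (m x k) (m x (k + 1)) ≤ 2 * b * β ^ k := fun k =>
      hstep x hx x k (by rw [dist_self]; exact mul_nonneg (by linarith) (hpow k).1.le)
    exact dist_le_of_le_geometric_of_tendsto β (2 * b) hβ1 h1
      (cauchySeq_of_le_geometric β (2 * b) hβ1 h1).tendsto_limUnder k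
  set U : ℝ := 1 / c * ∫ z, ‖u z‖ ∂μ
  have hU0 : 0 ≤ U := mul_nonneg (by positivity) (integral_nonneg fun _ => norm_nonneg _)
  have hU : ∀ x, ‖m x 0‖ ≤ U := by
    intro x
    have := norm_ballAverage_sub_le hA hui x (hpow 0).1 (hpow 0).2 0
    simp only [pow_zero, one_pow, div_one, sub_zero] at this
    simp only [m, pow_zero]
    exact this.trans (mul_le_mul_of_nonneg_left (setIntegral_le_integral hui.norm
      (Eventually.of_forall fun z => norm_nonneg _)) (by positivity))
  set T : ℝ := 4 * b / (1 - β) + 2 * b + 2 * U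
  have hβ' : 0 < 1 - β := by linarith
  have hl' : 0 < 1 - l := by linarith
  have hT : 0 ≤ T := by positivity
  refine ⟨⟨T * (1 / ((1 - l) * l)) ^ α, by positivity⟩, fun x hx y hy => ?_⟩
  change dist (w x) (w y) ≤ T * (1 / ((1 - l) * l)) ^ α * dist (ι x) (ι y) ^ α
  rw [mul_assoc, ← Real.mul_rpow (by positivity) dist_nonneg, one_div_mul_eq_div]
  set D := dist (ι x) (ι y)
  rcases eq_or_ne x y with rfl | hne
  · rw [dist_self]
    exact mul_nonneg hT (Real.rpow_nonneg (div_nonneg dist_nonneg (by positivity)) _)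
  have hD : 0 < D := dist_pos.2 (hinj.ne hne)
  rcases le_or_gt D (1 - l) with hDl | hDl
  -- The generation is chosen with `l ^ (k + 1) < D / (1 - l) ≤ l ^ k`: the upper bound allows the
  -- link between centres, and the lower one turns `β ^ k = (l ^ k) ^ α` into a multiple of `D ^ α`.
  -- Distances above `1 - l` are handled by the crude bound `U`.
  · obtain ⟨k, hk1, hk2⟩ := exists_nat_pow_near_of_lt_one (x := D / (1 - l)) (y := l)
      (by positivity) (by rwa [div_le_one hl']) hl hl1
    have h1 := hlim x hx k
    have h2 := hstep x hx y k (by rwa [div_le_iff₀ hl', mul_comm] at hk2)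
    have h3 := hlim y hy (k + 1)
    have h4 : 2 * b * β ^ (k + 1) / (1 - β) ≤ 2 * b * β ^ k / (1 - β) := by
      gcongr 2 * b * ?_ / _
      exact pow_le_pow_of_le_one hβ0 hβ1.le (Nat.le_succ k)
    have h5 : dist (w x) (w y) ≤ T * β ^ k := by
      have h6 := dist_triangle4 (w x) (m x k) (m y (k + 1)) (w y)
      rw [dist_comm (w x) (m x k)] at h6
      have h7 : T * β ^ k = 2 * b * β ^ k / (1 - β) + 2 * b * β ^ k + 2 * b * β ^ k / (1 - β) +
          2 * U * β ^ k := by simp only [T]; ring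
      have h8 : 0 ≤ 2 * U * β ^ k := by positivity
      linarith
    refine h5.trans (mul_le_mul_of_nonneg_left ?_ hT)
    rw [← hαθ, Real.rpow_pow_comm hl.le]
    refine Real.rpow_le_rpow (hpow k).1.le ?_ hα.le
    rw [← div_div, le_div_iff₀ hl, ← pow_succ]
    exact hk1.le
  · have h1 := hlim x hx 0
    have h2 := hlim y hy 0
    rw [pow_zero, mul_one] at h1 h2
    have h3 : dist (m x 0) (m y 0) ≤ 2 * U := by
      rw [dist_eq_norm]
      have := norm_sub_le (m x 0) (m y 0)
      linarith [hU x, hU y]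
    have h4 := dist_triangle4 (w x) (m x 0) (m y 0) (w y)
    rw [dist_comm (w x) (m x 0)] at h4
    have h5 : dist (w x) (w y) ≤ T := by
      have : T = 2 * b / (1 - β) + 2 * U + 2 * b / (1 - β) + 2 * b := by simp only [T]; ring
      linarith
    refine h5.trans (le_mul_of_one_le_right hT (Real.one_le_rpow ?_ hα.le))
    rw [one_le_div (by positivity)]
    nlinarith

end Campanato

end FractionalHarmonic

/-! ### Hole filling, iteration and change of representative -/

namespace FractionalHarmonic

section Decay

set_option linter.unusedSectionVars false

variable {X : Type*} [MeasurableSpace X] {L M n : ℕ} {ι : X → EuclideanSpace ℝ (Fin L)}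
  {μ : Measure X} [IsFiniteMeasure μ] {c C : ℝ≥0}

/-- A sufficiently small concentric ball has smaller measure than its complement. -/
theorem exists_measure_iball_le_annulus (hn : 1 ≤ n) (hι : Measurable ι)
    (hA : IsAhlfors n ι μ c C) :
    ∃ l : ℝ, 0 < l ∧ 2 * l ≤ 1 ∧ ∀ x r, 0 < r → r ≤ 1 →
      μ (iball ι x (l * r)) ≤ μ (iball ι x r \ iball ι x (l * r)) := by
  have hc : (0 : ℝ) < c := hA.pos
  -- Since `l ^ n ≤ l`, this gives `2 * C * (l * r) ^ n ≤ c * r ^ n`, so the small ball carries at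
  -- most half of the measure.
  set l : ℝ := min (1 / 2) (c / (2 * C + 1))
  have hl : 0 < l := lt_min (by norm_num) (by positivity)
  have hl2 : l ≤ 1 / 2 := min_le_left _ _
  refine ⟨l, hl, by linarith, fun x r hr hr1 => ?_⟩
  have hlC : l * (2 * C + 1) ≤ c := (le_div_iff₀ (by positivity)).1 (min_le_right _ _)
  have h1 := hA.measureReal_le x (r := l * r) (by positivity)
  have h2 := hA.le_measureReal x hr hr1
  have hsub : iball ι x (l * r) ⊆ iball ι x r := fun y hy => by
    have hy : dist (ι x) (ι y) < l * r := hy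
    show dist (ι x) (ι y) < r
    nlinarith
  have h3 := measureReal_sdiff (μ := μ) hsub (measurableSet_iball hι x (l * r))
  have h4 : 2 * (C * (l * r) ^ n) ≤ c * r ^ n := by
    have h5 : l ^ n ≤ l := pow_le_of_le_one hl.le (by linarith) (by omega)
    have h6 : l ^ n * (2 * C) ≤ c := by
      have : l ^ n * (2 * C) ≤ l * (2 * C) := by gcongr
      linarith
    calc 2 * (C * (l * r) ^ n) = l ^ n * (2 * C) * r ^ n := by rw [mul_pow]; ring
      _ ≤ _ := by gcongr
  refine (ENNReal.toReal_le_toReal (measure_ne_top μ _) (measure_ne_top μ _)).1 ?_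
  change μ.real _ ≤ μ.real _
  linarith

/-- The decay is iterated from the first power `l ^ k₀` below `ρ`; the finitely many larger radii
are absorbed by `B = E / θ ^ k₀`. -/
theorem exists_le_mul_pow_of_le_mul {G : X → ℝ → ℝ≥0∞} {s : Set X} {l ρ : ℝ} {θ E : ℝ≥0}
    (hl : 0 < l) (hl1 : l < 1) (hρ : 0 < ρ) (hθ : 0 < θ) (hθ1 : θ ≤ 1)
    (hE : ∀ x r, G x r ≤ E) (hG : ∀ x ∈ s, ∀ r, 0 < r → r ≤ ρ → G x (l * r) ≤ θ * G x r) :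
    ∃ B : ℝ≥0, ∀ x ∈ s, ∀ k : ℕ, G x (l ^ k) ≤ (B * θ ^ k : ℝ≥0) := by
  obtain ⟨k₀, hk₀⟩ := exists_pow_lt_of_lt_one hρ hl1
  have hB : ∀ k ≤ k₀, E ≤ E / θ ^ k₀ * θ ^ k := by
    intro k hk
    rw [div_mul_eq_mul_div, le_div_iff₀ (by positivity)]
    exact mul_le_mul_right (pow_le_pow_of_le_one (by positivity) hθ1 hk) E
  refine ⟨E / θ ^ k₀, fun x hx k => ?_⟩
  induction k with
  | zero => exact (hE x _).trans (by exact_mod_cast hB 0 (by omega))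
  | succ k ih =>
    rcases le_or_gt (k + 1) k₀ with h | h
    · exact (hE x _).trans (by exact_mod_cast hB _ h)
    · rw [pow_succ']
      refine (hG x hx _ (by positivity)
        ((pow_le_pow_of_le_one hl.le hl1.le (by omega)).trans hk₀.le)).trans
        ((mul_le_mul_right ih _).trans (le_of_eq ?_))
      norm_cast
      ring

/-- Here `a` is the energy in the hole and `b` that in the annulus: adding `K * a` to both sides of
`a ≤ K * b` gives `(1 + K) * a ≤ K * (a + b)`. -/
theorem le_mul_of_hole_filling {a b : ℝ≥0∞} {K : ℝ≥0} (ha : a ≠ ⊤)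
    (h : a + b ≤ K * b) : a ≤ (K / (1 + K) : ℝ≥0) * (a + b) := by
  rcases eq_or_ne b ⊤ with rfl | hb
  · rcases eq_or_ne K 0 with rfl | hK
    · simp at h
    · rw [add_top, ENNReal.mul_top]
      · exact le_top
      · simpa using hK
  lift a to ℝ≥0 using ha
  lift b to ℝ≥0 using hb
  norm_cast at h ⊢
  rw [div_mul_eq_mul_div, le_div_iff₀ (by positivity)]
  have : a ≤ K * b := le_self_add.trans h
  calc a * (1 + K) = a + K * a := by ring
    _ ≤ K * b + K * a := by gcongr
    _ = _ := by ring

/-- The integrals of an integrable function on small balls are uniformly small. -/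
theorem exists_setLIntegral_iball_le (hn : 1 ≤ n) (hA : IsAhlfors n ι μ c C)
    {F : X → ℝ≥0∞} (hF : ∫⁻ x, F x ∂μ ≠ ⊤) {η : ℝ≥0} (hη : 0 < η) :
    ∃ r, 0 < r ∧ r ≤ 1 ∧ ∀ x, ∫⁻ y in iball ι x r, F y ∂μ ≤ η := by
  obtain ⟨d, hd, h⟩ := exists_pos_setLIntegral_lt_of_measure_lt hF
    (ENNReal.coe_ne_zero.2 hη.ne')
  obtain ⟨e, he, hed⟩ := ENNReal.lt_iff_exists_nnreal_btwn.1 hd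
  have he0 : 0 < e := by exact_mod_cast he
  set r : ℝ := min 1 (e / (C + 1))
  have hr : 0 < r := lt_min one_pos (by positivity)
  refine ⟨r, hr, min_le_left _ _, fun x => (h _ (lt_of_le_of_lt ?_ hed)).le⟩
  refine (hA.measure_le x r hr).trans ?_
  rw [← ENNReal.ofReal_pow hr.le, ← ENNReal.ofReal_coe_nnreal (p := C),
    ← ENNReal.ofReal_coe_nnreal (p := e), ← ENNReal.ofReal_mul (by positivity)]
  refine ENNReal.ofReal_le_ofReal ?_
  have h1 : r ^ n ≤ r := pow_le_of_le_one hr.le (min_le_left _ _) (by omega)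
  have h2 : r * (C + 1) ≤ e := (le_div_iff₀ (by positivity)).1 (min_le_right _ _)
  calc (C : ℝ) * r ^ n ≤ C * r := by gcongr
    _ ≤ e := by linarith

end Decay

section Congr

variable {n L M : ℕ} {S : Type*} [EMetricSpace S] [MeasurableSpace S] [BorelSpace S]
  {ι : S → EuclideanSpace ℝ (Fin L)} {N : Set (EuclideanSpace ℝ (Fin M))} {s t p : ℝ}
  {u u' v : S → EuclideanSpace ℝ (Fin M)}

theorem energy_congr_ae (h : u =ᵐ[(μHE[n] : Measure S)] u') :
    energy n ι t p u = energy n ι t p u' := by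
  refine lintegral_congr_ae ?_
  filter_upwards [h] with x hx
  refine lintegral_congr_ae ?_
  filter_upwards [h] with y hy
  rw [hx, hy]

theorem sobolevNorm_congr_ae (h : u =ᵐ[(μHE[n] : Measure S)] u') :
    sobolevNorm n ι t p u = sobolevNorm n ι t p u' := by
  rw [sobolevNorm, sobolevNorm, energy_congr_ae h, eLpNorm_congr_ae h]

/-- A Sobolev map has a Borel representative with values in `N` everywhere. -/
theorem MemSobolev.exists_measurable (hu : MemSobolev n ι N t p u) (hN : IsClosed N)
    (hne : N.Nonempty) :
    ∃ u' : S → EuclideanSpace ℝ (Fin M), Measurable u' ∧ (∀ x, u' x ∈ N) ∧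
      u =ᵐ[(μHE[n] : Measure S)] u' := by
  classical
  obtain ⟨g, hg, hug⟩ := hu.memLp.1
  obtain ⟨e, he⟩ := hne
  have hm : MeasurableSet (g ⁻¹' N) := hg.measurable hN.measurableSet
  refine ⟨(g ⁻¹' N).piecewise g fun _ => e, hg.measurable.piecewise hm measurable_const,
    fun x => ?_, ?_⟩
  · by_cases hx : x ∈ g ⁻¹' N
    · rw [piecewise_eq_of_mem _ _ _ hx]; exact hx
    · rw [piecewise_eq_of_notMem _ _ _ hx]; exact he
  · filter_upwards [hug, hu.ae_mem] with x hx hxN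
    have hxg : x ∈ g ⁻¹' N := by rwa [mem_preimage, ← hx]
    rw [piecewise_eq_of_mem _ _ _ hxg, hx]

variable [ChartedSpace (EuclideanSpace ℝ (Fin n)) S]

theorem SobolevHomotopic.congr_left (h : u =ᵐ[(μHE[n] : Measure S)] u')
    (hu : SobolevHomotopic n ι N s p u' v) : SobolevHomotopic n ι N s p u v := by
  refine fun uε vε huε hvε => hu uε vε ⟨huε.1, huε.2.congr fun ε => sobolevNorm_congr_ae ?_⟩ hvε
  filter_upwards [h] with x hx
  rw [hx]

theorem IsMinimizingInHomotopy.congr_ae {B : Set S} (h : u =ᵐ[(μHE[n] : Measure S)] u')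
    (hu : IsMinimizingInHomotopy n ι N s t B u) : IsMinimizingInHomotopy n ι N s t B u' where
  mem := ⟨hu.mem.memLp.ae_eq h, by rw [← energy_congr_ae h]; exact hu.mem.energy_lt_top, by
    filter_upwards [h, hu.mem.ae_mem] with x hx hxN
    rwa [← hx]⟩
  energy_le v hv hvu huv := by
    rw [← energy_congr_ae h]
    refine hu.energy_le v hv ?_ (huv.congr_left h)
    filter_upwards [h, hvu] with x hx hxv hxB
    rw [hxv hxB, hx]

end Congr

/-! ### Energy decay for minimizers -/

section Minimizer

set_option linter.unusedSectionVars false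

variable {n L M : ℕ} {S : Type*} [EMetricSpace S] [CompactSpace S] [MeasurableSpace S]
  [BorelSpace S] [ChartedSpace (EuclideanSpace ℝ (Fin n)) S] [IsManifold (𝓡 n) ∞ S]
  {ι : S → EuclideanSpace ℝ (Fin L)} [IsFiniteMeasure (μHE[n] : Measure S)] {c C : ℝ≥0}
  {N : Set (EuclideanSpace ℝ (Fin M))} {δ : ℝ} {KP : ℝ≥0}
  {P : EuclideanSpace ℝ (Fin M) → EuclideanSpace ℝ (Fin M)}

theorem exists_dist_le_of_compact (hι : Continuous ι) :
    ∃ Δ : ℝ, 1 ≤ Δ ∧ ∀ x y, dist (ι x) (ι y) ≤ Δ := by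
  obtain ⟨D, hD⟩ := Metric.isBounded_iff.1 (isCompact_range hι).isBounded
  exact ⟨max 1 D, le_max_left _ _, fun x y =>
    (hD (mem_range_self x) (mem_range_self y)).trans (le_max_right _ _)⟩

/-- Energy decay for minimizers. -/
theorem exists_energy_decay (hι : Continuous ι) (hinj : Function.Injective ι)
    (hA : IsAhlfors n ι (μHE[n] : Measure S) c C) {s s₁ : ℝ} (hs : 0 < s) (hs1 : s < 1)
    (hs₁ : s₁ < 1) (hn : 1 ≤ n) (hδ : 0 < δ) (hP : IsTubularRetraction N δ KP P)
    (hN : Bornology.IsBounded N) {l : ℝ} (hl : 0 < l) (hl2 : 2 * l ≤ 1)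
    (hlA : ∀ x r, 0 < r → r ≤ 1 → (μHE[n] : Measure S) (iball ι x (l * r)) ≤
      (μHE[n] : Measure S) (iball ι x r \ iball ι x (l * r))) :
    ∃ θ : ℝ≥0, 0 < θ ∧ θ < 1 ∧ ∀ t, s ≤ t → t ≤ s₁ → ∀ (B : Set S)
      (u : S → EuclideanSpace ℝ (Fin M)), Measurable u → (∀ x, u x ∈ N) →
      IsMinimizingInHomotopy n ι N s t B u → ∃ r₁, 0 < r₁ ∧ ∀ x r, 0 < r → r ≤ r₁ →
        iball ι x r ⊆ B →
        ∫⁻ y in iball ι x (l * r), energyDensity ι (μHE[n] : Measure S) (n / s)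
          (n + t * (n / s)) u y ∂μHE[n] ≤
        θ * ∫⁻ y in iball ι x r, energyDensity ι (μHE[n] : Measure S) (n / s)
          (n + t * (n / s)) u y ∂μHE[n] := by
  have hn1 : (1 : ℝ) ≤ n := by exact_mod_cast hn
  set p : ℝ := n / s
  have hp : 1 < p := by rw [lt_div_iff₀ hs]; linarith
  have hp0 : 0 < p := by linarith
  have hsp : s * p = n := mul_div_cancel₀ _ hs.ne'
  -- The gap between `a = t * p` and `p` that is common to all `t ≤ s₁`.
  have hκ : 0 < p * (1 - s₁) := mul_pos hp0 (by linarith)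
  obtain ⟨K, ε, hε, hcomp⟩ := exists_comparison (M := M) hn hι.measurable hinj hA hp hκ hδ hP
  obtain ⟨η, hη, hhom⟩ := exists_sobolevHomotopic hι hinj hA hs hs1 hn hδ hP
  obtain ⟨Δ, hΔ, hdist⟩ := exists_dist_le_of_compact hι
  obtain ⟨D, hD0, hD⟩ := hN.exists_pos_norm_le
  set KΔ : ℝ≥0 := (Δ ^ p).toNNReal
  -- `2 * K` is the comparison constant; the summand `1` ensures `0 < θ`, needed for taking `logb`
  -- of a power of it.
  set K' : ℝ≥0 := 2 * K + 1
  refine ⟨K' / (1 + K'), by positivity, by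
    rw [div_lt_one (by positivity)]; exact lt_add_of_pos_left _ one_pos,
    fun t hst hts B u hu huN hmin => ?_⟩
  set a : ℝ := t * p
  have hna : n ≤ a := by rw [← hsp]; exact mul_le_mul_of_nonneg_right hst hp0.le
  have haκ : a + p * (1 - s₁) ≤ p := by
    have : t * p ≤ s₁ * p := mul_le_mul_of_nonneg_right hts hp0.le
    simp only [a]
    linarith
  have hap : a ≤ p := by linarith
  set F := energyDensity ι (μHE[n] : Measure S) p (n + a) u
  have hE : ∫⁻ x, F x ∂(μHE[n] : Measure S) ≠ ⊤ := by
    have := hmin.mem.energy_lt_top.ne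
    rwa [energy_eq_lintegral_energyDensity] at this
  -- The first entry permits the construction of the comparison map. The second makes the critical
  -- energies of both maps on balls of radius `r₀` at most `η`: the comparison map adds at most `2 *
  -- K * η'`, and `KΔ` passes to the critical exponent.
  set η' : ℝ≥0 := min ε (η / (KΔ * (1 + 2 * K) + 1))
  have hη' : 0 < η' := lt_min hε (by positivity)
  have hη'' : KΔ * ((1 + 2 * K) * η') ≤ η := by
    have := (le_div_iff₀ (by positivity)).1 (min_le_right ε (η / (KΔ * (1 + 2 * K) + 1)))
    calc KΔ * ((1 + 2 * K) * η') ≤ η' * (KΔ * (1 + 2 * K) + 1) := by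
          rw [mul_add, mul_one]
          refine le_trans (le_of_eq ?_) le_self_add
          ring
      _ ≤ η := this
  obtain ⟨r₀, hr₀, hr₀1, hFr₀⟩ := exists_setLIntegral_iball_le hn hA hE hη'
  -- The maps differ only on a ball of radius `r`, and by at most `2 * D`. Taking `r ≤ σ * r₀` makes
  -- the `p`-th power of their `L^p` distance at most `η * r₀ ^ n`, without any use of the energy.
  set σ : ℝ := min 1 (η / ((2 * D) ^ p * C + 1))
  have hσ : 0 < σ := lt_min one_pos (by positivity)
  have hσ1 : σ ≤ 1 := min_le_left _ _
  refine ⟨σ * r₀, by positivity, fun x r hr hrr hrB => ?_⟩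
  have hrr₀ : r ≤ r₀ := hrr.trans (mul_le_of_le_one_left hr₀.le hσ1)
  have hr1 : r ≤ 1 := hrr₀.trans hr₀1
  set Br := iball ι x r
  have hBr : MeasurableSet Br := measurableSet_iball hι.measurable _ _
  have hBrη : ∫⁻ y in Br, F y ∂(μHE[n] : Measure S) ≤ η' :=
    (lintegral_mono_set fun y hy =>
      lt_of_lt_of_le (show dist (ι x) (ι y) < r from hy) hrr₀).trans (hFr₀ x)
  have hbd : ∀ f : S → EuclideanSpace ℝ (Fin M), Measurable f → (∀ x, f x ∈ N) → ∀ q : ℝ≥0∞,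
      MemLp f q (μHE[n] : Measure S) := fun f hf hfN q =>
    MemLp.of_bound hf.aestronglyMeasurable D (Eventually.of_forall fun x => hD _ (hfN x))
  obtain ⟨v, hv, hvN, hvu, hvE⟩ := hcomp a hna haκ u hu
    (memLp_one_iff_integrable.1 (hbd u hu huN 1)) huN x (l * r) r (by positivity)
    (by nlinarith) hr1 (hlA x r hr hr1)
    (hBrη.trans (ENNReal.coe_le_coe.2 (min_le_left _ _)))
  set A := Br \ iball ι x (l * r)
  have hAη : ∫⁻ y in A, F y ∂(μHE[n] : Measure S) ≤ η' := (lintegral_mono_set sdiff_subset).trans hBrη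
  have hvρ : ∀ z : Set S, MeasurableSet z →
      ∫⁻ y in z, energyDensity ι (μHE[n] : Measure S) p (n + a) v y ∂μHE[n] ≤
      ∫⁻ y in z, F y ∂μHE[n] + 2 * (K * ∫⁻ y in A, F y ∂μHE[n]) := fun z hz =>
    (setLIntegral_energyDensity_le_of_eqOn hι.measurable p (n + a) hv hBr hvu hz).trans
      (add_le_add_right (mul_le_mul_right hvE 2) _)
  have hsmall : ∀ f : S → EuclideanSpace ℝ (Fin M), (∀ y, ∫⁻ y in iball ι y r₀,
      energyDensity ι (μHE[n] : Measure S) p (n + a) f y ∂μHE[n] ≤ ((1 + 2 * K) * η' : ℝ≥0)) →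
      ∀ y, ∫⁻ y in iball ι y r₀, energyDensity ι (μHE[n] : Measure S) p (n + n) f y ∂μHE[n] ≤
        η := by
    intro f hf y
    calc _ ≤ ∫⁻ y in iball ι y r₀, KΔ * energyDensity ι (μHE[n] : Measure S) p (n + a) f y
          ∂μHE[n] := lintegral_mono fun z => energyDensity_le_mul hn hΔ hdist hna hap f z
      _ = KΔ * ∫⁻ y in iball ι y r₀, energyDensity ι (μHE[n] : Measure S) p (n + a) f y
          ∂μHE[n] := lintegral_const_mul' _ _ ENNReal.coe_ne_top
      _ ≤ KΔ * ((1 + 2 * K) * η' : ℝ≥0) := mul_le_mul_right (hf y) _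
      _ ≤ η := by exact_mod_cast hη''
  have hLp : ∫⁻ y, ENNReal.ofReal (‖v y - u y‖ ^ p) ∂(μHE[n] : Measure S) ≤
      η * ENNReal.ofReal (r₀ ^ n) := by
    have h1 : ∀ y, y ∉ Br → ENNReal.ofReal (‖v y - u y‖ ^ p) = 0 := fun y hy => by
      simp [hvu y hy, Real.zero_rpow hp0.ne']
    rw [← setLIntegral_eq_of_support_subset (s := Br) (fun y hy => by
      by_contra h; exact hy (h1 y h))]
    refine (setLIntegral_le_const_mul hBr (b := ENNReal.ofReal ((2 * D) ^ p)) fun y _ => ?_).trans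
      ((mul_le_mul_right (hA.measure_le x r hr) _).trans ?_)
    · have := norm_sub_le (v y) (u y)
      have h2 : ‖v y - u y‖ ≤ 2 * D := by linarith [hD _ (hvN y), hD _ (huN y)]
      gcongr
    · rw [← ENNReal.ofReal_pow hr.le, ← ENNReal.ofReal_coe_nnreal (p := C),
        ← ENNReal.ofReal_coe_nnreal (p := η), ← ENNReal.ofReal_mul (by positivity),
        ← ENNReal.ofReal_mul (by positivity), ← ENNReal.ofReal_mul (by positivity)]
      refine ENNReal.ofReal_le_ofReal ?_
      have h3 : r ^ n ≤ σ * r₀ ^ n := by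
        calc r ^ n ≤ (σ * r₀) ^ n := by gcongr
          _ = σ ^ n * r₀ ^ n := mul_pow _ _ _
          _ ≤ σ * r₀ ^ n := by
              gcongr
              exact pow_le_of_le_one hσ.le hσ1 (by omega)
      have h4 : σ * ((2 * D) ^ p * C + 1) ≤ η :=
        (le_div_iff₀ (by positivity)).1 (min_le_right _ _)
      calc (2 * D) ^ p * (C * r ^ n) ≤ (2 * D) ^ p * (C * (σ * r₀ ^ n)) := by gcongr
        _ = σ * ((2 * D) ^ p * C) * r₀ ^ n := by ring
        _ ≤ η * r₀ ^ n := by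
            gcongr
            linarith
  have hhomuv : SobolevHomotopic n ι N s p u v := by
    refine hhom r₀ hr₀ hr₀1 u v hu hv (hsmall u fun y => (hFr₀ y).trans ?_)
      (hsmall v fun y => (hvρ _ (measurableSet_iball hι.measurable _ _)).trans ?_) hLp
    · rw [ENNReal.coe_le_coe, add_mul, one_mul]
      exact le_self_add
    · calc _ ≤ (η' : ℝ≥0∞) + 2 * (K * η') := by
            gcongr
            exact hFr₀ y
        _ = _ := by push_cast; ring
  have hvEtop : ∫⁻ y, energyDensity ι (μHE[n] : Measure S) p (n + a) v y ∂μHE[n] < ⊤ := by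
    have := hvρ univ MeasurableSet.univ
    simp only [Measure.restrict_univ] at this
    refine this.trans_lt ?_
    have h1 : ∫⁻ y in A, F y ∂(μHE[n] : Measure S) < ⊤ := hAη.trans_lt ENNReal.coe_lt_top
    have h2 := hE.lt_top
    finiteness
  have hle : ∫⁻ y, F y ∂(μHE[n] : Measure S) ≤
      ∫⁻ y, energyDensity ι (μHE[n] : Measure S) p (n + a) v y ∂μHE[n] := by
    have := hmin.energy_le v ⟨hbd v hv hvN _, by rwa [energy_eq_lintegral_energyDensity],
      Eventually.of_forall hvN⟩ (Eventually.of_forall fun y hy => hvu y fun h => hy (hrB h)) hhomuv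
    rwa [energy_eq_lintegral_energyDensity, energy_eq_lintegral_energyDensity] at this
  have hmain := (setLIntegral_energyDensity_le_of_energy_le hι.measurable p (n + a) hu hv hBr hvu hE
    hle).trans (mul_le_mul_right hvE 2)
  have hsub : iball ι x (l * r) ⊆ Br := fun y hy => by
    have hy : dist (ι x) (ι y) < l * r := hy
    show dist (ι x) (ι y) < r
    nlinarith
  have hsplit : ∫⁻ y in Br, F y ∂(μHE[n] : Measure S) =
      ∫⁻ y in iball ι x (l * r), F y ∂μHE[n] + ∫⁻ y in A, F y ∂μHE[n] := by
    rw [← lintegral_inter_add_sdiff _ Br (measurableSet_iball hι.measurable x (l * r)),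
      inter_eq_right.2 hsub]
  rw [hsplit]
  refine le_mul_of_hole_filling
    (((lintegral_mono_set hsub).trans hBrη).trans_lt ENNReal.coe_lt_top).ne ?_
  rw [← hsplit]
  refine hmain.trans ?_
  rw [← mul_assoc]
  gcongr
  simp only [K']
  push_cast
  exact le_self_add

theorem exists_iball_subset (hι : Continuous ι) (hinj : Function.Injective ι) {K U : Set S}
    (hK : IsCompact K) (hU : IsOpen U) (hKU : K ⊆ U) :
    ∃ ρ, 0 < ρ ∧ ∀ x ∈ K, iball ι x ρ ⊆ U := by
  rcases (K ×ˢ Uᶜ).eq_empty_or_nonempty with h0 | hne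
  · refine ⟨1, one_pos, fun x hx y _ => ?_⟩
    by_contra hy
    have : (x, y) ∈ K ×ˢ Uᶜ := ⟨hx, hy⟩
    simp [h0] at this
  · obtain ⟨z, hz, hmin⟩ := (hK.prod hU.isClosed_compl.isCompact).exists_isMinOn hne
      (f := fun z : S × S => dist (ι z.1) (ι z.2)) (by fun_prop)
    refine ⟨dist (ι z.1) (ι z.2), dist_pos.2 (hinj.ne fun h => hz.2 (h ▸ hKU hz.1)),
      fun x hx y hxy => ?_⟩
    by_contra hy
    have h1 : (x, y) ∈ K ×ˢ Uᶜ := ⟨hx, hy⟩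
    have h2 := isMinOn_iff.1 hmin _ h1
    have hxy : dist (ι x) (ι y) < dist (ι z.1) (ι z.2) := hxy
    exact absurd h2 (not_le.2 hxy)

end Minimizer

end FractionalHarmonic

/-! ### Hölder regularity -/

theorem mainTheorem9 {n k L M : ℕ} (hn : 1 ≤ n)
    {S : Type*} [EMetricSpace S] [CompactSpace S] [MeasurableSpace S] [BorelSpace S]
    [ChartedSpace (EuclideanSpace ℝ (Fin n)) S] [IsManifold (𝓡 n) ∞ S]
    [RiemannianBundle (fun x : S => TangentSpace (𝓡 n) x)]
    [IsContMDiffRiemannianBundle (𝓡 n) ∞ (EuclideanSpace ℝ (Fin n))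
      (fun x : S => TangentSpace (𝓡 n) x)]
    [IsRiemannianManifold (𝓡 n) S]
    (ι : S → EuclideanSpace ℝ (Fin L))
    (hι : IsSmoothEmbedding (𝓡 n) 𝓘(ℝ, EuclideanSpace ℝ (Fin L)) ∞ ι)
    {N : Type*} [TopologicalSpace N] [CompactSpace N] [ConnectedSpace N]
    [ChartedSpace (EuclideanSpace ℝ (Fin k)) N] [IsManifold (𝓡 k) ∞ N]
    (j : N → EuclideanSpace ℝ (Fin M))
    (hj : IsSmoothEmbedding (𝓡 k) 𝓘(ℝ, EuclideanSpace ℝ (Fin M)) ∞ j)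
    (s : ℝ) (hs₀ : 0 < s) (hs₁ : s < 1) :
    ∃ α : ℝ≥0, 0 < α ∧ ∃ s₁ : ℝ, s < s₁ ∧
      ∀ t : ℝ, s ≤ t → t < s₁ →
        ∀ (u : S → EuclideanSpace ℝ (Fin M)) (x₀ : S) (R : ℝ), 0 < R →
          FractionalHarmonic.IsMinimizingInHomotopy n ι (range j) s t
            (Metric.eball x₀ (ENNReal.ofReal R)) u →
          FractionalHarmonic.MemHolderLoc n α (Metric.eball x₀ (ENNReal.ofReal R)) u := by
  have hιc : Continuous ι := hι.isEmbedding.continuous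
  have hinj : Function.Injective ι := hι.isEmbedding.injective
  obtain ⟨Cι, hL⟩ := FractionalHarmonic.exists_lipschitzWith_of_contMDiff (n := n) hι.contMDiff
  obtain ⟨hfin, c, C, hA⟩ := FractionalHarmonic.exists_isAhlfors hι hL
  have hjc : Continuous j := hj.isEmbedding.continuous
  have hN : IsCompact (range j) := isCompact_range hjc
  have hne : (range j).Nonempty := range_nonempty j
  obtain ⟨δ, KP, P, hδ, hP⟩ :=
    (FractionalHarmonic.hasLocalParam_range hj).exists_retraction hN hne
  obtain ⟨l, hl, hl2, hlA⟩ :=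
    FractionalHarmonic.exists_measure_iball_le_annulus hn hιc.measurable hA
  have hl1 : l < 1 := by linarith
  obtain ⟨θ, hθ, hθ1, hdecay⟩ := FractionalHarmonic.exists_energy_decay hιc hinj hA hs₀ hs₁
    (s₁ := (1 + s) / 2) (by linarith) hn hδ hP hN.isBounded hl hl2 hlA
  have hn1 : (1 : ℝ) ≤ n := by exact_mod_cast hn
  set p : ℝ := n / s
  have hp : 1 < p := by rw [lt_div_iff₀ hs₀]; linarith
  have hp0 : 0 < p := by linarith
  have hsp : s * p = n := mul_div_cancel₀ _ hs₀.ne'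
  have hθ0' : (0 : ℝ) < θ := by exact_mod_cast hθ
  have hθ1' : (θ : ℝ) < 1 := by exact_mod_cast hθ1
  set β : ℝ := (θ : ℝ) ^ (1 / p)
  have hβ0 : 0 < β := by positivity
  have hβ1 : β < 1 := Real.rpow_lt_one hθ0'.le hθ1' (by positivity)
  -- The exponent for which `l ^ α = θ ^ (1 / p)`; it is fixed before `t` and `u`.
  set α : ℝ := Real.logb l β
  have hα : 0 < α := Real.logb_pos_of_base_lt_one hl hl1 hβ0 hβ1
  have hαβ : l ^ α = β := Real.rpow_logb hl hl1.ne hβ0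
  refine ⟨⟨α, hα.le⟩, hα, (1 + s) / 2, by linarith, fun t hst hts u x₀ R _ hmin => ?_⟩
  obtain ⟨u', hu', hu'N, huu'⟩ := hmin.mem.exists_measurable hN.isClosed hne
  have hmin' := hmin.congr_ae huu'
  obtain ⟨r₁, hr₁, hr₁d⟩ := hdecay t hst hts.le _ u' hu' hu'N hmin'
  set a : ℝ := t * p
  have hna : n ≤ a := by rw [← hsp]; exact mul_le_mul_of_nonneg_right hst hp0.le
  have hap : a ≤ p := mul_le_of_le_one_left hp0.le (by linarith)
  set F := FractionalHarmonic.energyDensity ι (μHE[n] : Measure S) p (n + a) u'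
  have hE : ∫⁻ x, F x ∂(μHE[n] : Measure S) ≠ ⊤ := by
    have := hmin'.mem.energy_lt_top.ne
    rwa [FractionalHarmonic.energy_eq_lintegral_energyDensity] at this
  have hui : Integrable u' (μHE[n] : Measure S) := by
    obtain ⟨D, -, hD⟩ := hN.isBounded.exists_pos_norm_le
    exact Integrable.of_bound hu'.aestronglyMeasurable D
      (Eventually.of_forall fun x => hD _ (hu'N x))
  -- The representative is the limit of averages over balls of radius `l ^ k`. It equals `u'`
  -- wherever the energy density is finite, hence almost everywhere, and is Hölder on `K` for the
  -- chordal distance, therefore for the larger Riemannian one up to a power of `Cι`.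
  refine ⟨fun x => limUnder atTop fun k : ℕ =>
    ⨍ z in FractionalHarmonic.iball ι x (l ^ k), u' z ∂μHE[n], ?_, fun K hKB hK => ?_⟩
  · filter_upwards [ae_lt_top (FractionalHarmonic.measurable_energyDensity hιc.measurable p _ hu')
      hE, huu'] with x hx hxu _
    rw [hxu]
    exact (FractionalHarmonic.tendsto_ballAverage hιc.measurable hinj hA hp (by linarith) hui
      hx.ne hl hl1).limUnder_eq
  · obtain ⟨ρ, hρ, hρK⟩ :=
      FractionalHarmonic.exists_iball_subset hιc hinj hK Metric.isOpen_eball hKB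
    obtain ⟨B, hB⟩ := FractionalHarmonic.exists_le_mul_pow_of_le_mul (s := K) (ρ := min ρ r₁)
      (G := fun x r => ∫⁻ y in FractionalHarmonic.iball ι x r, F y ∂μHE[n])
      (E := (∫⁻ x, F x ∂(μHE[n] : Measure S)).toNNReal) hl hl1 (lt_min hρ hr₁) hθ hθ1.le
      (fun x r => by
        rw [ENNReal.coe_toNNReal hE]
        exact setLIntegral_le_lintegral _ _)
      (fun x hx r hr hrρ => hr₁d x r hr (hrρ.trans (min_le_right _ _)) fun y hy =>
        hρK x hx (lt_of_lt_of_le hy (hrρ.trans (min_le_left _ _))))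
    obtain ⟨Q, hQ⟩ := FractionalHarmonic.exists_dist_limUnder_le hιc.measurable hinj hA hp hna hap
      hu' hui hl hl1 hθ1 hα hαβ hB
    refine ⟨Q * Cι ^ α, fun x hx y hy => ?_⟩
    rw [edist_dist]
    calc _ ≤ ENNReal.ofReal (Q * dist (ι x) (ι y) ^ α) := ENNReal.ofReal_le_ofReal (hQ x hx y hy)
      _ = Q * edist (ι x) (ι y) ^ α := by
          rw [ENNReal.ofReal_mul Q.coe_nonneg, ENNReal.ofReal_coe_nnreal,
            ← ENNReal.ofReal_rpow_of_nonneg dist_nonneg hα.le, edist_dist]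
      _ ≤ Q * (Cι * edist x y) ^ α := by
          gcongr
          exact hL x y
      _ = _ := by
          rw [ENNReal.mul_rpow_of_nonneg _ _ hα.le, ENNReal.coe_mul,
            ENNReal.coe_rpow_of_nonneg _ hα.le, mul_assoc]
          rfl
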